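/- **Setting.** Let $m\ge 1$. There are $K$ Markov decision processes; the $k$-th has finite state space $\mathcal S^{(k)}$, finite action space $\mathcal A^{(k)}$ and transition matrices $P^{(k)}_a$, $a\in\mathcal A^{(k)}$. A randomized stationary policy $\pi$ on MDP $k$ is a conditional probability $\pi(a|s)$, with transition matrix $P^{(k)}_\pi(s,s')=\sum_a\pi(a|s)P^{(k)}_a(s,s')$; it is pure if all $\pi(a|s)\in\{0,1\}$. A joint randomized stationary policy is a conditional probability $\Pi(\mathbf a|\mathbf s)$ of joint actions given joint states; it is separable if $\Pi(\mathbf a|\mathbf s)=\prod_k\pi^{(k)}(a^{(k)}|s^{(k)})$. Penalties and constraints are $f^{(k)}_t(a,s)=\hat f^{(k)}(a,s,\mu_t)$ and $g^{(k)}_{i,t}(a,s)=\hat g^{(k)}_i(a,s,\omega_t)$, $i=1,\dots,m$, all bounded in absolute value by $\Psi>0$, where $(\omega_t)_{t\ge0}$ is i.i.d. and independent of $(\mu_t)_{t\ge0}$, and $(\mu_t)$ is otherwise arbitrary. *System.* The initial joint state has law $d_0$ and is independent of $(\omega,\mu)$. At slot $t$ the joint action is drawn according to the policy given the current joint state. Given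 $(\omega,\mu)$, all states and actions up to slot $t$, and the next states of the other MDPs, the next state of MDP $k$ has law $P^{(k)}_{a_t^{(k)}}(s_t^{(k)},\cdot)$. For a policy $\mathscr P$ started from $d_0$, let $$F_T(d_0,\mathscr P)=\mathbb E\sum_{t}\sum_{k=1}^K f_t^{(k)}(a_t^{(k)},s_t^{(k)}),\qquad G_{i,T}(d_0,\mathscr P)=\mathbb E\sum_{t}\sum_{k=1}^K g_{i,t}^{(k)}(a_t^{(k)},s_t^{(k)}),$$ where $t$ runs over the $T$ slots $0,\dots,T-1$, or throughout over $1,\dots,T$ (the result holds for both conventions). *Assumptions.* (1) There is $\hat r\ge1$ such that for every $r\ge\hat r$ and every $k$, every product $P^{(k)}_{\pi_1}\cdots P^{(k)}_{\pi_r}$ over pure policies has strictly positive entries. (2) For some $\eta>0$ there is a separable randomized stationary policy $\tilde\pi$ such that, in its stationary distribution $d_{\tilde\pi}$, $\mathbb E\big[\sum_k g_{i,t}^{(k)}(a_t^{(k)},s_t^{(k)})\mid d_{\tilde\pi},\tilde\pi\big]\le-\eta$ for all $i$. *Algorithm.* Let $\Theta^{(k)}$ be the set of probability vectors $\theta$ on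 $\mathcal A^{(k)}\times\mathcal S^{(k)}$ with $\sum_{s,a}\theta(a,s)P^{(k)}_a(s,s')=\sum_a\theta(a,s')$ for all $s'$. Let $\theta_0^{(k)}(a,s)=d_{\pi_0}(s)\pi_0(a|s)$ for some randomized stationary policy $\pi_0=\pi_0^{(k)}$ with stationary distribution $d_{\pi_0}$, and let $Q_i(0)=Q_i(1)=0$. For $t\ge1$, $$\theta_t^{(k)}=\operatorname*{argmin}_{\theta\in\Theta^{(k)}}\Big\langle V f_{t-1}^{(k)}+\sum_{i=1}^m Q_i(t)g_{i,t-1}^{(k)},\theta\Big\rangle+\alpha\|\theta-\theta_{t-1}^{(k)}\|_2^2,\qquad Q_i(t+1)=\max\Big\{Q_i(t)+\sum_{k=1}^K\langle g_{i,t-1}^{(k)},\theta_t^{(k)}\rangle,\,0\Big\}.$$ At every slot $t\ge 0$, MDP $k$ draws its action from $\pi_t^{(k)}(a|s)=\theta_t^{(k)}(a,s)/\sum_{b}\theta_t^{(k)}(b,s)$ (read as $0$ if the denominator is $0$), independently over $k$ given the past. *Mixing parameters.* Call $(r,\tau)$, with $r\ge1$ an integer and $\tau\ge1$ real, mixing parameters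 if $\|(d_1-d_2)P^{(k)}_{\pi_1}\cdots P^{(k)}_{\pi_r}\|_1\le e^{-1/\tau}\|d_1-d_2\|_1$ for all $k$, all state distributions $d_1,d_2$ on $\mathcal S^{(k)}$ and all randomized stationary policies $\pi_1,\dots,\pi_r$ on MDP $k$. **Theorem.** Under assumption (1) mixing parameters exist. There is a constant $C=C(\Psi,\eta,r,\tau)$, depending only on $\Psi$, $\eta$ and the mixing parameters, such that under assumptions (1) and (2), for every choice of mixing parameters $(r,\tau)$, every $T\ge1$ and every distribution $d_0$ of the initial joint state, the policy $\mathscr P$ given by the algorithm with $V=\sqrt T$ and $\alpha=T$ satisfies $$G_{i,T}(d_0,\mathscr P)\le C\,m^{3/2}K^2\sum_{k=1}^K|\mathcal A^{(k)}||\mathcal S^{(k)}|\,\sqrt T,\qquad i=1,\dots,m,$$ and, for every joint randomized stationary policy $\Pi$ with stationary distribution $d_\Pi$ such that $G_{i,T}(d_\Pi,\Pi)\le0$ for $i=1,\dots,m$, $$F_T(d_0,\mathscr P)-F_T(d_\Pi,\Pi)\le C\,m^{3/2}K^2\sum_{k=1}^K|\mathcal A^{(k)}||\mathcal S^{(k)}|\,\sqrt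 T.$$ -/

import Mathlib

open MeasureTheory ProbabilityTheory

open scoped ProbabilityTheory

noncomputable section

namespace OCMDP

/-- `d` is a probability vector on the finite set `α`. -/
def IsProbVector {α : Type*} [Fintype α] (d : α → ℝ) : Prop :=
  (∀ x, 0 ≤ d x) ∧ ∑ x, d x = 1

/-- `π s a` is the probability `π(a|s)` of a randomized stationary policy. It is used both for a
single MDP and for the product MDP (joint randomized stationary policies). -/
def IsRandomizedPolicy {σ α : Type*} [Fintype α] (π : σ → α → ℝ) : Prop :=
  ∀ s, IsProbVector (π s)

/-- A pure policy: all probabilities are `0` or `1`. -/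
def IsPurePolicy {σ α : Type*} [Fintype α] (π : σ → α → ℝ) : Prop :=
  IsRandomizedPolicy π ∧ ∀ s a, π s a = 0 ∨ π s a = 1

/-- Transition matrix `P_π(s,s') = ∑_a π(a|s) P_a(s,s')`. -/
def policyMatrix {σ α : Type*} [Fintype α] (P : α → Matrix σ σ ℝ) (π : σ → α → ℝ) :
    Matrix σ σ ℝ :=
  fun s s' => ∑ a, π s a * P a s s'

/-- `d` is a stationary distribution of the transition matrix `Q`: a probability vector with
`d = d Q`. -/
def IsStationary {σ : Type*} [Fintype σ] (Q : Matrix σ σ ℝ) (d : σ → ℝ) : Prop :=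
  IsProbVector d ∧ Matrix.vecMul d Q = d

/-- The state-action polyhedron `Θ` of an MDP; vectors are written `θ(a,s)`. -/
def stateActionPolyhedron {σ α : Type*} [Fintype σ] [Fintype α] (P : α → Matrix σ σ ℝ) :
    Set (α → σ → ℝ) :=
  {θ | (∀ a s, 0 ≤ θ a s) ∧ ∑ s, ∑ a, θ a s = 1 ∧
    ∀ s', ∑ s, ∑ a, θ a s * P a s s' = ∑ a, θ a s'}

/-- The policy recovered from a state-action vector: `θ(a,s) / ∑_a θ(a,s)`, and `0` when the
denominator vanishes (division by zero is `0`). -/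
def recoveredPolicy {σ α : Type*} [Fintype α] (θ : α → σ → ℝ) : σ → α → ℝ :=
  fun s a => θ a s / ∑ b, θ b s

/-- Inner product `⟨h, θ⟩ = ∑_{a,s} h(a,s) θ(a,s)`. -/
def pairing {σ α : Type*} [Fintype σ] [Fintype α] (h θ : α → σ → ℝ) : ℝ :=
  ∑ a, ∑ s, h a s * θ a s

/-- Squared Euclidean distance of two state-action vectors. -/
def sqDist {σ α : Type*} [Fintype σ] [Fintype α] (θ θ' : α → σ → ℝ) : ℝ :=
  ∑ a, ∑ s, (θ a s - θ' a s) ^ 2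

/-- The joint policy of a separable policy `(π^{(1)}, …, π^{(K)})`. -/
def separable {K : ℕ} {S A : Fin K → Type*} (π : ∀ k, S k → A k → ℝ) :
    (∀ k, S k) → (∀ k, A k) → ℝ :=
  fun s a => ∏ k, π k (s k) (a k)

/-- `K` parallel finite MDPs with state spaces `S k` and action spaces `A k`, a penalty function
and `m` constraint functions driven by noise with values in the measurable space `E`, all bounded
by `Ψ`. -/
structure Model (K m : ℕ) (S A : Fin K → Type*) [∀ k, Fintype (S k)] (E : Type*)
    [MeasurableSpace E] where
  P : ∀ k, A k → Matrix (S k) (S k) ℝ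
  P_nonneg : ∀ k a s s', 0 ≤ P k a s s'
  P_row_sum : ∀ k a s, ∑ s', P k a s s' = 1
  fhat : ∀ k, A k → S k → E → ℝ
  ghat : Fin m → ∀ k, A k → S k → E → ℝ
  fhat_measurable : ∀ k a s, Measurable (fhat k a s)
  ghat_measurable : ∀ i k a s, Measurable (ghat i k a s)
  Ψ : ℝ
  Ψ_pos : 0 < Ψ
  fhat_bound : ∀ k a s e, |fhat k a s e| ≤ Ψ
  ghat_bound : ∀ i k a s e, |ghat i k a s e| ≤ Ψ

section ModelDefs

variable {K m : ℕ} {S A : Fin K → Type*} [∀ k, Fintype (S k)] [∀ k, DecidableEq (S k)]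
  [∀ k, Fintype (A k)] {E : Type*} [MeasurableSpace E]

/-- Transition probabilities of the product MDP: the components move independently given the
joint state and the joint action. -/
def Model.jointP (M : Model K m S A E) (a : ∀ k, A k) : Matrix (∀ k, S k) (∀ k, S k) ℝ :=
  fun s s' => ∏ k, M.P k (a k) (s k) (s' k)

/-- Unichain assumption: all sufficiently long products of transition matrices of pure policies
are strictly positive. -/
def Model.Unichain (M : Model K m S A E) : Prop :=
  ∃ r₀ : ℕ, 1 ≤ r₀ ∧ ∀ r : ℕ, r₀ ≤ r → ∀ k, ∀ π : Fin r → S k → A k → ℝ,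
    (∀ j, IsPurePolicy (π j)) →
      ∀ s s', 0 < (List.ofFn fun j => policyMatrix (M.P k) (π j)).prod s s'

/-- `(r, τ)` are mixing parameters of the system: every product of `r` transition matrices of
randomized stationary policies contracts the `ℓ¹` distance of state distributions by `e^{-1/τ}`. -/
def Model.IsMixing (M : Model K m S A E) (r : ℕ) (τ : ℝ) : Prop :=
  1 ≤ r ∧ 1 ≤ τ ∧ ∀ k, ∀ d₁ d₂ : S k → ℝ, IsProbVector d₁ → IsProbVector d₂ →
    ∀ π : Fin r → S k → A k → ℝ, (∀ j, IsRandomizedPolicy (π j)) →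
      ∑ s, |Matrix.vecMul (d₁ - d₂) (List.ofFn fun j => policyMatrix (M.P k) (π j)).prod s|
        ≤ Real.exp (-1 / τ) * ∑ s, |d₁ s - d₂ s|

variable {Ω : Type*} [MeasurableSpace Ω]

/-- The noise processes: `ω` (constraints) is i.i.d. and independent of `μ` (penalties), and
nothing else is assumed about `μ`. -/
structure IsEnvironment (Pr : Measure Ω) (ω μ : ℕ → Ω → E) : Prop where
  measurable_ω : ∀ t, Measurable (ω t)
  measurable_μ : ∀ t, Measurable (μ t)
  indep_ω : iIndepFun ω Pr
  ident_ω : ∀ t, IdentDistrib (ω t) (ω 0) Pr Pr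
  indep_ω_μ : IndepFun (fun x t => ω t x) (fun x t => μ t x) Pr

/-- Slater's condition with margin `η`: for some separable randomized stationary policy in its
stationary distribution, the expected one-slot value of every constraint is at most `-η`. -/
def Model.Slater (M : Model K m S A E) (Pr : Measure Ω) (ω : ℕ → Ω → E) (η : ℝ) : Prop :=
  0 < η ∧ ∃ (π : ∀ k, S k → A k → ℝ) (d : (∀ k, S k) → ℝ),
    (∀ k, IsRandomizedPolicy (π k)) ∧ IsStationary (policyMatrix M.jointP (separable π)) d ∧
      ∀ t i, ∑ s, ∑ a, d s * separable π s a *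
        ∫ x, ∑ k, M.ghat i k (a k) (s k) (ω t x) ∂Pr ≤ -η

/-- The σ-algebra generated by `X 0, …, X (n-1)` (discrete values). -/
@[reducible] def sigmaBefore {β : Type*} (X : ℕ → Ω → β) (n : ℕ) : MeasurableSpace Ω :=
  ⨆ j, ⨆ _ : j < n, MeasurableSpace.comap (X j) ⊤

/-- The σ-algebra generated by the whole noise processes. -/
@[reducible] def sigmaEnv (ω μ : ℕ → Ω → E) : MeasurableSpace Ω :=
  (⨆ t, MeasurableSpace.comap (ω t) inferInstance) ⊔
    ⨆ t, MeasurableSpace.comap (μ t) inferInstance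

/-- `(s_t, a_t)` is a realization of the controlled system, with noise `ω, μ`, started from the
joint state distribution `d₀`, when the joint action at slot `t` is drawn from the (possibly
random) conditional probabilities `p t x s a`. -/
structure Model.IsTrajectory (M : Model K m S A E) (Pr : Measure Ω) (ω μ : ℕ → Ω → E)
    (d₀ : (∀ k, S k) → ℝ) (p : ℕ → Ω → (∀ k, S k) → (∀ k, A k) → ℝ)
    (s : ℕ → Ω → ∀ k, S k) (a : ℕ → Ω → ∀ k, A k) : Prop where
  measurable_state : ∀ t y, MeasurableSet (s t ⁻¹' {y})
  measurable_action : ∀ t b, MeasurableSet (a t ⁻¹' {b})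
  /-- the initial state has law `d₀` and is independent of the noise -/
  initial : ∀ y, Pr⟦s 0 ⁻¹' {y} | sigmaEnv ω μ⟧ =ᵐ[Pr] fun _ => d₀ y
  /-- law of the action at slot `t` given the noise and the past including the state at `t` -/
  action : ∀ t b, Pr⟦a t ⁻¹' {b} | sigmaBefore s (t + 1) ⊔ sigmaBefore a t ⊔ sigmaEnv ω μ⟧
    =ᵐ[Pr] fun x => p t x (s t x) b
  /-- independent transitions: the next state of MDP `k`, given all information up to time `t`
  and the next states of the other MDPs, has law `P_a(s, ·)` with its own state and action -/
  transition : ∀ t k y, Pr⟦{x | s (t + 1) x k = y} |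
      (sigmaBefore s (t + 1) ⊔ sigmaBefore a (t + 1) ⊔ sigmaEnv ω μ) ⊔
        ⨆ j, ⨆ _ : j ≠ k, MeasurableSpace.comap (fun x => s (t + 1) x j) ⊤⟧
    =ᵐ[Pr] fun x => M.P k (a t x k) (s t x k) y

/-- Expected overall penalty of a realization over the slots `b, …, b + T - 1`. -/
def Model.penalty (M : Model K m S A E) (Pr : Measure Ω) (μ : ℕ → Ω → E)
    (s : ℕ → Ω → ∀ k, S k) (a : ℕ → Ω → ∀ k, A k) (b T : ℕ) : ℝ :=
  ∫ x, ∑ t ∈ Finset.Ico b (b + T), ∑ k, M.fhat k (a t x k) (s t x k) (μ t x) ∂Pr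

/-- Expected accumulation of constraint `i` over the slots `b, …, b + T - 1`. -/
def Model.constraint (M : Model K m S A E) (Pr : Measure Ω) (ω : ℕ → Ω → E)
    (s : ℕ → Ω → ∀ k, S k) (a : ℕ → Ω → ∀ k, A k) (i : Fin m) (b T : ℕ) : ℝ :=
  ∫ x, ∑ t ∈ Finset.Ico b (b + T), ∑ k, M.ghat i k (a t x k) (s t x k) (ω t x) ∂Pr

/-- Objective of the subproblem of MDP `k` at slot `t + 1`, with queue vector `q` and previous
state-action vector `θ'`. -/
def Model.subproblem (M : Model K m S A E) (V α : ℝ) (ω μ : ℕ → Ω → E) (t : ℕ) (x : Ω)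
    (q : Fin m → ℝ) (k : Fin K) (θ' θ : A k → S k → ℝ) : ℝ :=
  pairing (fun a s => V * M.fhat k a s (μ t x) + ∑ i, q i * M.ghat i k a s (ω t x)) θ
    + α * sqDist θ θ'

/-- `θ` (state-action vectors) and `Q` (virtual queues) are produced by the algorithm with
parameters `V, α`. -/
structure Model.IsAlgorithmRun (M : Model K m S A E) (V α : ℝ) (ω μ : ℕ → Ω → E)
    (θ : ℕ → Ω → ∀ k, A k → S k → ℝ) (Q : ℕ → Ω → Fin m → ℝ) : Prop where
  /-- `θ_0` is the stationary state-action vector of some randomized stationary policy -/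
  theta_zero : ∀ k, ∃ (π : S k → A k → ℝ) (d : S k → ℝ), IsRandomizedPolicy π ∧
    IsStationary (policyMatrix (M.P k) π) d ∧ ∀ x a s, θ 0 x k a s = d s * π s a
  queue_zero : ∀ x i, Q 0 x i = 0
  queue_one : ∀ x i, Q 1 x i = 0
  queue_succ : ∀ t x i, Q (t + 2) x i =
    max (Q (t + 1) x i + ∑ k, pairing (fun a s => M.ghat i k a s (ω t x)) (θ (t + 1) x k)) 0
  theta_mem : ∀ t x k, θ (t + 1) x k ∈ stateActionPolyhedron (M.P k)
  theta_min : ∀ t x k, IsMinOn (M.subproblem V α ω μ t x (Q (t + 1) x) k (θ t x k))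
    (stateActionPolyhedron (M.P k)) (θ (t + 1) x k)

/-- The conditional action probabilities used by the algorithm: at slot `t` every MDP `k` uses the
policy recovered from `θ_t^{(k)}`. -/
def algorithmPolicy (θ : ℕ → Ω → ∀ k, A k → S k → ℝ) :
    ℕ → Ω → (∀ k, S k) → (∀ k, A k) → ℝ :=
  fun t x => separable fun k => recoveredPolicy (θ t x k)

end ModelDefs

end OCMDP

end

/-! A stationary policy of one MDP corresponds to a point of its state-action polyhedron, and
expected one-slot penalties and constraints are linear in that point. A joint stationary policy has
its marginals in the product of the polyhedra (`Model.occupancyMarginal_mem`), so both the Slater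
policy and every benchmark become fixed feasible points `z`. The algorithm is an online proximal
drift-plus-penalty method on this product, and three errors must be of order `√T`.

Regret of the vectors `θ t`. Strong convexity of the proximal step gives the comparison
`Model.IsAlgorithmRun.drift_plus_penalty_le` with any feasible `z`. It telescopes in the potential
`‖Q(t+1)‖² + 2α‖z - θ t‖²`. The queue-weighted constraint values of `z` have the right sign in
expectation, because `θ t` and `Q (t + 1)` depend on `ω` only through `ω 0, …, ω (t - 1)`, while `ω
t` is independent of these and of all of `μ`.

Size of the queues. With the Slater point as `z`, the potential `X` has drift at most a constant of
order `√T` minus `2η` times the sum of the queues. Summed over time this bounds the average queue,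
hence the total movement of `θ`. For the final queue, `√X` has bounded jumps and `X` has nonpositive
drift above a level `B` of order `√T`, so the expected square of the excess of `√X` over `B` grows
by at most a constant per slot. Its root is therefore of order `√T`, with no logarithmic factor
(`Model.IsAlgorithmRun.integral_queue_le`).

Tracking. Given the noise, the policies are deterministic functions of time, and the marginal law of
each MDP is an inhomogeneous Markov chain. Since `r` steps contract by `e^{-1/τ}`, that law follows
the slowly moving stationary distributions of the current policies, with a total error controlled by
the total movement of `θ` (`sum_abs_sub_le_of_mixing`).

Mixing parameters exist because randomized policies cannot make entries of a product smaller than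
the worst pure policies do, and there are finitely many of those; Dobrushin's contraction then
applies. -/

namespace OCMDP

/-! ### Stochastic matrices, Dobrushin contraction, and reduction to pure policies -/

section Stochastic

variable {σ α : Type*} [Fintype σ] [DecidableEq σ] [Fintype α]

open Matrix

lemma policyMatrix_mem_rowStochastic {P : α → Matrix σ σ ℝ} (hP : ∀ a, P a ∈ rowStochastic ℝ σ)
    {π : σ → α → ℝ} (hπ : IsRandomizedPolicy π) : policyMatrix P π ∈ rowStochastic ℝ σ := by
  rw [mem_rowStochastic_iff_sum]
  refine ⟨fun s s' => Finset.sum_nonneg fun a _ => mul_nonneg ((hπ s).1 a) ((hP a).1 _ _),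
    fun s => ?_⟩
  simp only [policyMatrix]
  rw [Finset.sum_comm]
  simp only [← Finset.mul_sum, sum_row_of_mem_rowStochastic (hP _), mul_one, (hπ s).2]

lemma IsProbVector.vecMul {d : σ → ℝ} (hd : IsProbVector d) {Q : Matrix σ σ ℝ}
    (hQ : Q ∈ rowStochastic ℝ σ) : IsProbVector (d ᵥ* Q) := by
  refine ⟨nonneg_vecMul_of_mem_rowStochastic hQ hd.1, ?_⟩
  have := vecMul_dotProduct_one_eq_one_rowStochastic (x := d) hQ (by simpa [dotProduct] using hd.2)
  simpa [dotProduct] using this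

omit [DecidableEq σ] in
lemma sum_abs_sub_le_two {d₁ d₂ : σ → ℝ} (h₁ : IsProbVector d₁) (h₂ : IsProbVector d₂) :
    ∑ s, |d₁ s - d₂ s| ≤ 2 := by
  calc ∑ s, |d₁ s - d₂ s| ≤ ∑ s, (d₁ s + d₂ s) := Finset.sum_le_sum fun s _ => by
        rw [abs_le]; constructor <;> linarith [h₁.1 s, h₂.1 s]
    _ = 2 := by rw [Finset.sum_add_distrib, h₁.2, h₂.2]; norm_num

omit [DecidableEq σ] in
lemma sum_abs_vecMul_le {e : σ → ℝ} {Q : Matrix σ σ ℝ} {c : ℝ} (hQ : ∀ s s', 0 ≤ Q s s')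
    (hc : ∀ s, ∑ s', Q s s' ≤ c) : ∑ s', |(e ᵥ* Q) s'| ≤ c * ∑ s, |e s| := by
  calc ∑ s', |(e ᵥ* Q) s'| ≤ ∑ s', ∑ s, |e s| * Q s s' := Finset.sum_le_sum fun s' _ => by
        simp only [Matrix.vecMul, dotProduct]
        refine (Finset.abs_sum_le_sum_abs _ _).trans (Finset.sum_le_sum fun s _ => ?_)
        rw [abs_mul, abs_of_nonneg (hQ s s')]
    _ = ∑ s, |e s| * ∑ s', Q s s' := by
        rw [Finset.sum_comm]; simp only [Finset.mul_sum]
    _ ≤ ∑ s, |e s| * c := Finset.sum_le_sum fun s _ =>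
        mul_le_mul_of_nonneg_left (hc s) (abs_nonneg _)
    _ = _ := by rw [← Finset.sum_mul, mul_comm]

/-- Dobrushin contraction for a stochastic matrix whose entries are at least `δ`. -/
lemma sum_abs_vecMul_le_of_le {Q : Matrix σ σ ℝ} (hQ : Q ∈ rowStochastic ℝ σ) {δ : ℝ}
    (hδ0 : 0 ≤ δ) (hδ : ∀ s s', δ ≤ Q s s') {e : σ → ℝ} (he : ∑ s, e s = 0) :
    ∑ s', |(e ᵥ* Q) s'| ≤ (1 - δ) * ∑ s, |e s| := by
  -- Since `e` has total mass zero, subtracting a constant from all entries does not change `e Q`;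
  -- the new matrix is still nonnegative and its row sums are at most `1 - δ`.
  have h : e ᵥ* Q = e ᵥ* (fun s s' => Q s s' - δ) := by
    ext s'
    simp only [Matrix.vecMul, dotProduct, mul_sub, Finset.sum_sub_distrib, ← Finset.sum_mul, he]
    ring
  rw [h]
  refine sum_abs_vecMul_le (fun s s' => sub_nonneg.2 (hδ s s')) fun s => ?_
  rw [Finset.sum_sub_distrib, sum_row_of_mem_rowStochastic hQ]
  have : δ ≤ ∑ _s' : σ, δ :=
    Finset.single_le_sum (f := fun _ : σ => δ) (fun _ _ => hδ0) (Finset.mem_univ s)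
  linarith

/-- The pure policy that plays `u s` in state `s`. -/
noncomputable def purePolicy (u : σ → α) : σ → α → ℝ := by
  classical exact fun s a => if a = u s then 1 else 0

omit [Fintype σ] [DecidableEq σ] in
lemma isPurePolicy_purePolicy (u : σ → α) : IsPurePolicy (purePolicy u) := by
  classical
  refine ⟨fun s => ⟨fun a => ?_, ?_⟩, fun s a => ?_⟩
  · simp only [purePolicy]; split_ifs <;> norm_num
  · simp [purePolicy]
  · simp only [purePolicy]; split_ifs <;> simp

omit [Fintype σ] [DecidableEq σ] in
lemma policyMatrix_purePolicy (P : α → Matrix σ σ ℝ) (u : σ → α) (s s' : σ) :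
    policyMatrix P (purePolicy u) s s' = P (u s) s s' := by
  classical
  simp [policyMatrix, purePolicy]

omit [DecidableEq σ] in
lemma policyMatrix_mulVec (P : α → Matrix σ σ ℝ) (π : σ → α → ℝ) (v : σ → ℝ) (s : σ) :
    (policyMatrix P π *ᵥ v) s = ∑ a, π s a * (P a *ᵥ v) s := by
  simp only [mulVec, dotProduct, policyMatrix, Finset.sum_mul, Finset.mul_sum]
  rw [Finset.sum_comm]
  simp only [mul_assoc]

/-- Acting greedily backwards in time, pure policies do at least as badly as randomized ones. -/
lemma exists_pure_prod_mulVec_le [Nonempty α] {P : α → Matrix σ σ ℝ}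
    (hP : ∀ a s s', 0 ≤ P a s s') (r : ℕ) (π : Fin r → σ → α → ℝ)
    (hπ : ∀ j, IsRandomizedPolicy (π j)) (v : σ → ℝ) :
    ∃ u : Fin r → σ → α, ∀ s,
      ((List.ofFn fun j => policyMatrix P (purePolicy (u j))).prod *ᵥ v) s ≤
        ((List.ofFn fun j => policyMatrix P (π j)).prod *ᵥ v) s := by
  induction r with
  | zero => exact ⟨fun j => j.elim0, fun s => by simp⟩
  | succ r ih =>
    obtain ⟨u, hu⟩ := ih (fun j => π j.succ) fun j => hπ _
    set w := (List.ofFn fun j => policyMatrix P (purePolicy (u j))).prod *ᵥ v with hw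
    -- Backward dynamic programming: `w` is the value already achieved by the later pure policies,
    -- and the first policy minimizes the one-step expectation of `w` state by state. An average
    -- over actions is at least this minimum.
    choose u₀ hu₀ using fun s => Finite.exists_min fun a => (P a *ᵥ w) s
    refine ⟨Fin.cons u₀ u, fun s => ?_⟩
    simp only [List.ofFn_succ, List.prod_cons, ← mulVec_mulVec, Fin.cons_zero, Fin.cons_succ,
      ← hw]
    rw [policyMatrix_mulVec, policyMatrix_mulVec]
    calc ∑ a, purePolicy u₀ s a * (P a *ᵥ w) s = (P (u₀ s) *ᵥ w) s := by
          classical simp [purePolicy]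
      _ = ∑ a, π 0 s a * (P (u₀ s) *ᵥ w) s := by rw [← Finset.sum_mul, (hπ 0 s).2, one_mul]
      _ ≤ _ := Finset.sum_le_sum fun a _ => mul_le_mul_of_nonneg_left ?_ ((hπ 0 s).1 a)
    refine (hu₀ s a).trans (Finset.sum_le_sum fun s' _ => ?_)
    exact mul_le_mul_of_nonneg_left (hu s') (hP a s s')

/-- If all products of `r` transition matrices of pure policies are positive, then the products
for randomized policies are uniformly positive. -/
lemma exists_pos_le_prod_apply {P : α → Matrix σ σ ℝ} (hP : ∀ a s s', 0 ≤ P a s s') {r : ℕ}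
    (hr : ∀ π : Fin r → σ → α → ℝ, (∀ j, IsPurePolicy (π j)) →
      ∀ s s', 0 < (List.ofFn fun j => policyMatrix P (π j)).prod s s') (hr1 : 1 ≤ r) :
    ∃ δ : ℝ, 0 < δ ∧ ∀ π : Fin r → σ → α → ℝ, (∀ j, IsRandomizedPolicy (π j)) →
      ∀ s s', δ ≤ (List.ofFn fun j => policyMatrix P (π j)).prod s s' := by
  rcases isEmpty_or_nonempty σ with hσ | hσ
  · exact ⟨1, one_pos, fun _ _ s => isEmptyElim s⟩
  rcases isEmpty_or_nonempty α with hα | hα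
  · refine ⟨1, one_pos, fun π hπ s => ?_⟩
    have := (hπ ⟨0, hr1⟩ s).2
    simp at this
  classical
  obtain ⟨⟨u, p⟩, hu⟩ := Finite.exists_min fun q : (Fin r → σ → α) × (σ × σ) =>
    (List.ofFn fun j => policyMatrix P (purePolicy (q.1 j))).prod q.2.1 q.2.2
  refine ⟨_, hr _ (fun j => isPurePolicy_purePolicy (u j)) p.1 p.2, fun π hπ s s' => ?_⟩
  -- With the indicator of `s'` as terminal value, the product applied to it is the column `s'`.
  obtain ⟨u', hu'⟩ := exists_pure_prod_mulVec_le hP r π hπ (Pi.single s' 1)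
  have h1 := hu' s
  have h2 := hu (u', (s, s'))
  simp only [mulVec_single_one, col_apply] at h1
  exact h2.trans h1

end Stochastic

/-! ### Points of the state-action polyhedron and their recovered policies -/

section Polyhedron

variable {σ α : Type*} [Fintype σ] [Fintype α]

open Matrix

lemma stateActionPolyhedron.le_one {P : α → Matrix σ σ ℝ} {θ : α → σ → ℝ}
    (h : θ ∈ stateActionPolyhedron P) (a : α) (s : σ) : θ a s ≤ 1 := by
  rw [← h.2.1]
  refine le_trans ?_ (Finset.single_le_sum (f := fun s => ∑ a, θ a s)
    (fun s _ => Finset.sum_nonneg fun a _ => h.1 a s) (Finset.mem_univ s))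
  exact Finset.single_le_sum (f := fun a => θ a s) (fun a _ => h.1 a s) (Finset.mem_univ a)

lemma stateActionPolyhedron.isProbVector_marginal {P : α → Matrix σ σ ℝ} {θ : α → σ → ℝ}
    (h : θ ∈ stateActionPolyhedron P) : IsProbVector fun s => ∑ a, θ a s :=
  ⟨fun s => Finset.sum_nonneg fun a _ => h.1 a s, h.2.1⟩

/-- Under the unichain condition every point of the polyhedron charges every state. -/
lemma stateActionPolyhedron.marginal_pos [DecidableEq σ] {P : α → Matrix σ σ ℝ}
    (hP : ∀ a s s', 0 ≤ P a s s') {r : ℕ}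
    (hr : ∀ π : Fin r → σ → α → ℝ, (∀ j, IsPurePolicy (π j)) →
      ∀ s s', 0 < (List.ofFn fun j => policyMatrix P (π j)).prod s s')
    {θ : α → σ → ℝ} (h : θ ∈ stateActionPolyhedron P) (s' : σ) : 0 < ∑ a, θ a s' := by
  have hd := stateActionPolyhedron.isProbVector_marginal h
  refine (hd.1 s').lt_of_ne' fun hs' => ?_
  obtain ⟨s₁, hs₁⟩ : ∃ s, 0 < ∑ a, θ a s := by
    by_contra! hcon
    have : ∑ s, ∑ a, θ a s ≤ 0 := Finset.sum_nonpos fun s _ => hcon s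
    rw [h.2.1] at this
    linarith
  have hpos : ∀ s, 0 < ∑ a, θ a s → ∃ a, 0 < θ a s := fun s hs => by
    by_contra! hcon
    exact absurd (Finset.sum_nonpos fun a _ => hcon a) (not_le.2 hs)
  obtain ⟨a₁, -⟩ := hpos s₁ hs₁
  have : ∀ s, ∃ a, 0 < ∑ b, θ b s → 0 < θ a s := fun s => by
    by_cases hs : 0 < ∑ b, θ b s
    · exact (hpos s hs).imp fun a ha _ => ha
    · exact ⟨a₁, fun h => absurd h hs⟩
  choose u hu using this
  -- The policy `u` plays, in each charged state, some action that `θ` charges. The balance equation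
  -- at an uncharged state equates zero with a sum of nonnegative inflows, so no such action leads
  -- from a charged state to an uncharged one.
  have hclosed : ∀ s t, 0 < ∑ a, θ a s → ∑ a, θ a t = 0 → P (u s) s t = 0 := by
    intro s t hs ht
    have h0 := h.2.2 t
    rw [ht, Finset.sum_eq_zero_iff_of_nonneg fun s _ =>
      Finset.sum_nonneg fun a _ => mul_nonneg (h.1 a s) (hP a s t)] at h0
    have h1 := h0 s (Finset.mem_univ s)
    rw [Finset.sum_eq_zero_iff_of_nonneg fun a _ => mul_nonneg (h.1 a s) (hP a s t)] at h1
    exact (mul_eq_zero.1 (h1 (u s) (Finset.mem_univ _))).resolve_left (hu s hs).ne'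
  have hprod : ∀ n : ℕ, ∀ s t, 0 < ∑ a, θ a s → ∑ a, θ a t = 0 →
      (List.ofFn fun _ : Fin n => policyMatrix P (purePolicy u)).prod s t = 0 := by
    intro n
    induction n with
    | zero =>
      intro s t hs ht
      rw [List.ofFn_zero, List.prod_nil]
      exact one_apply_ne fun hst => hs.ne' (hst ▸ ht)
    | succ n ih =>
      intro s t hs ht
      rw [List.ofFn_succ, List.prod_cons, mul_apply]
      refine Finset.sum_eq_zero fun q _ => ?_
      rw [policyMatrix_purePolicy]
      rcases (hd.1 q).eq_or_lt with hq | hq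
      · rw [hclosed s q hs hq.symm, zero_mul]
      · rw [ih q t hq ht, mul_zero]
  -- The support of `θ` is closed under the pure policy `u`, which contradicts positivity of its
  -- `r`-step matrix at the entry from `s₁` to the uncharged `s'`.
  exact (hr _ (fun _ => isPurePolicy_purePolicy u) s₁ s').ne' (hprod r s₁ s' hs₁ hs')

omit [Fintype σ] in
lemma recoveredPolicy_isRandomizedPolicy {θ : α → σ → ℝ} (h0 : ∀ a s, 0 ≤ θ a s)
    (hpos : ∀ s, 0 < ∑ a, θ a s) : IsRandomizedPolicy (recoveredPolicy θ) := by
  refine fun s => ⟨fun a => div_nonneg (h0 a s) (hpos s).le, ?_⟩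
  simp only [recoveredPolicy]
  rw [← Finset.sum_div, div_self (hpos s).ne']

omit [Fintype σ] in
lemma marginal_mul_recoveredPolicy {θ : α → σ → ℝ} (hpos : ∀ s, 0 < ∑ a, θ a s) (a : α) (s : σ) :
    (∑ b, θ b s) * recoveredPolicy θ s a = θ a s :=
  mul_div_cancel₀ _ (hpos s).ne'

lemma marginal_vecMul_policyMatrix {P : α → Matrix σ σ ℝ} {θ : α → σ → ℝ}
    (h : θ ∈ stateActionPolyhedron P) (hpos : ∀ s, 0 < ∑ a, θ a s) :
    (fun s => ∑ a, θ a s) ᵥ* policyMatrix P (recoveredPolicy θ) = fun s => ∑ a, θ a s := by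
  ext s'
  rw [← h.2.2 s']
  simp only [Matrix.vecMul, dotProduct, policyMatrix, Finset.mul_sum]
  simp only [← mul_assoc, marginal_mul_recoveredPolicy hpos]

end Polyhedron

/-! ### Tracking of slowly varying stationary distributions -/

section Mixing

open Matrix

/-- Summing the recursion over time reproduces `ρ` times the sum itself, which is absorbed on the
left. Each `δ` is counted at most `r` times, and the first `r` terms, which the recursion does not
reach, cost at most `2` each. -/
lemma sum_range_le_of_contraction {a δ : ℕ → ℝ} {r : ℕ} {ρ : ℝ} (hρ0 : 0 ≤ ρ) (hρ : ρ < 1)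
    (ha0 : ∀ t, 0 ≤ a t) (ha : ∀ t, a t ≤ 2) (hδ : ∀ t, 0 ≤ δ t)
    (h : ∀ t, a (t + r) ≤ ρ * a t + ∑ i ∈ Finset.range r, δ (t + i)) (n : ℕ) :
    ∑ t ∈ Finset.range (n + 1), a t ≤ r * (2 + ∑ t ∈ Finset.range n, δ t) / (1 - ρ) := by
  have hD : 0 ≤ ∑ t ∈ Finset.range n, δ t := Finset.sum_nonneg fun t _ => hδ t
  have hA : 0 ≤ ∑ t ∈ Finset.range (n + 1), a t := Finset.sum_nonneg fun t _ => ha0 t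
  have h2 : ∀ k : ℕ, ∑ t ∈ Finset.range k, a t ≤ k * 2 := fun k => by
    simpa using Finset.sum_le_sum fun t (_ : t ∈ Finset.range k) => ha t
  rw [le_div_iff₀ (by linarith)]
  rcases le_total (n + 1) r with hn | hn
  · have h3 := h2 (n + 1)
    have h4 : ((n + 1 : ℕ) : ℝ) ≤ r := by exact_mod_cast hn
    nlinarith [mul_nonneg (Nat.cast_nonneg (α := ℝ) r) hD]
  · obtain ⟨N, hN⟩ := Nat.exists_eq_add_of_le hn
    have h5 : ∑ t ∈ Finset.range N, ∑ i ∈ Finset.range r, δ (t + i) ≤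
        r * ∑ t ∈ Finset.range n, δ t := by
      rw [Finset.sum_comm]
      calc _ ≤ ∑ _i ∈ Finset.range r, ∑ t ∈ Finset.range n, δ t := by
            refine Finset.sum_le_sum fun i hi => ?_
            rw [← Finset.sum_image (s := Finset.range N) (g := fun t => t + i) (f := δ)
              (fun x _ y _ hxy => by simpa using hxy)]
            refine Finset.sum_le_sum_of_subset_of_nonneg ?_ fun t _ _ => hδ t
            intro x hx
            simp only [Finset.mem_image, Finset.mem_range] at hx hi ⊢
            obtain ⟨y, hy, rfl⟩ := hx
            omega
        _ = _ := by simp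
    have h6 : ∑ t ∈ Finset.range N, a t ≤ ∑ t ∈ Finset.range (n + 1), a t :=
      Finset.sum_le_sum_of_subset_of_nonneg (by
        rw [Finset.range_subset_range]; omega) fun t _ _ => ha0 t
    have h7 : ∑ t ∈ Finset.range (n + 1), a t =
        ∑ t ∈ Finset.range r, a t + ∑ t ∈ Finset.range N, a (t + r) := by
      rw [hN, Finset.sum_range_add]
      simp only [add_comm]
    have h8 : ∑ t ∈ Finset.range N, a (t + r) ≤ ρ * ∑ t ∈ Finset.range N, a t +
        ∑ t ∈ Finset.range N, ∑ i ∈ Finset.range r, δ (t + i) := by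
      rw [Finset.mul_sum, ← Finset.sum_add_distrib]
      exact Finset.sum_le_sum fun t _ => h t
    have h9 := mul_le_mul_of_nonneg_left h6 hρ0
    linarith [h2 r]

variable {σ : Type*} [Fintype σ] [DecidableEq σ]

/-- The law `v` of an inhomogeneous chain tracks the slowly varying stationary distributions `d` of
its transition matrices. -/
lemma sum_abs_sub_le_of_mixing {v d : ℕ → σ → ℝ} {P : ℕ → Matrix σ σ ℝ} {r : ℕ} {ρ : ℝ}
    (hρ0 : 0 ≤ ρ) (hρ : ρ < 1) (hP : ∀ t, P t ∈ rowStochastic ℝ σ)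
    (hv0 : IsProbVector (v 0)) (hv : ∀ t, v (t + 1) = v t ᵥ* P t)
    (hd0 : ∀ t, IsProbVector (d t)) (hd : ∀ t, d t ᵥ* P t = d t)
    (hmix : ∀ (t : ℕ) (d₁ d₂ : σ → ℝ), IsProbVector d₁ → IsProbVector d₂ →
      ∑ s, |((d₁ - d₂) ᵥ* (List.ofFn fun j : Fin r => P (t + j)).prod) s| ≤
        ρ * ∑ s, |d₁ s - d₂ s|) (n : ℕ) :
    ∑ t ∈ Finset.range (n + 1), ∑ s, |v t s - d t s| ≤
      r * (2 + ∑ t ∈ Finset.range n, ∑ s, |d (t + 1) s - d t s|) / (1 - ρ) := by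
  have hvp : ∀ t, IsProbVector (v t) := fun t => by
    induction t with
    | zero => exact hv0
    | succ t ih => rw [hv]; exact ih.vecMul (hP t)
  -- The error `e t = v t - d t` satisfies `e (t+1) = e t P t - (d (t+1) - d t)`, as `d t` is fixed
  -- by `P t`. Unrolled over `j` steps, it is the transported error plus perturbations, none of
  -- which a stochastic matrix enlarges in `ℓ¹`.
  have key : ∀ t j : ℕ, ∑ s, |((v (t + j) - d (t + j)) -
      (v t - d t) ᵥ* (List.ofFn fun i : Fin j => P (t + i)).prod) s| ≤
        ∑ i ∈ Finset.range j, ∑ s, |d (t + i + 1) s - d (t + i) s| := by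
    intro t j
    induction j with
    | zero => simp
    | succ j ih =>
      have e : (v (t + (j + 1)) - d (t + (j + 1))) -
          (v t - d t) ᵥ* (List.ofFn fun i : Fin (j + 1) => P (t + i)).prod =
          ((v (t + j) - d (t + j)) -
            (v t - d t) ᵥ* (List.ofFn fun i : Fin j => P (t + i)).prod) ᵥ* P (t + j) -
          (d (t + j + 1) - d (t + j)) := by
        rw [List.ofFn_succ', List.concat_eq_append, List.prod_append, List.prod_singleton,
          ← vecMul_vecMul]
        simp only [Fin.val_castSucc, Fin.val_last, sub_vecMul]
        rw [hd (t + j), ← hv (t + j), ← add_assoc]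
        abel
      rw [e, Finset.sum_range_succ]
      calc _ ≤ ∑ s, (|(((v (t + j) - d (t + j)) -
            (v t - d t) ᵥ* (List.ofFn fun i : Fin j => P (t + i)).prod) ᵥ* P (t + j)) s| +
            |d (t + j + 1) s - d (t + j) s|) := Finset.sum_le_sum fun s _ => abs_sub _ _
        _ ≤ _ := by
          rw [Finset.sum_add_distrib]
          refine add_le_add_left (le_trans ?_ ih) _
          refine (sum_abs_vecMul_le (c := 1) (fun s s' => (hP _).1 s s') fun s => ?_).trans
            (one_mul _).le
          exact (sum_row_of_mem_rowStochastic (hP _) s).le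
  refine sum_range_le_of_contraction hρ0 hρ (fun t => Finset.sum_nonneg fun s _ => abs_nonneg _)
    (fun t => sum_abs_sub_le_two (hvp t) (hd0 t))
    (fun t => Finset.sum_nonneg fun s _ => abs_nonneg _) (fun t => ?_) n
  refine le_trans ?_ (add_le_add (hmix t (v t) (d t) (hvp t) (hd0 t)) (key t r))
  rw [← Finset.sum_add_distrib]
  refine Finset.sum_le_sum fun s _ => ?_
  have := abs_add_le (((v t - d t) ᵥ* (List.ofFn fun i : Fin r => P (t + i)).prod) s)
    (((v (t + r) - d (t + r)) - (v t - d t) ᵥ* (List.ofFn fun i : Fin r => P (t + i)).prod) s)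
  simpa using this

end Mixing

/-! ### Existence of mixing parameters -/

section ModelMixing

variable {K m : ℕ} {S A : Fin K → Type*} [∀ k, Fintype (S k)] [∀ k, DecidableEq (S k)]
  [∀ k, Fintype (A k)] {E : Type*} [MeasurableSpace E]

omit [∀ k, Fintype (A k)] in
lemma Model.P_mem_rowStochastic (M : Model K m S A E) (k : Fin K) (a : A k) :
    M.P k a ∈ Matrix.rowStochastic ℝ (S k) :=
  Matrix.mem_rowStochastic_iff_sum.2 ⟨M.P_nonneg k a, M.P_row_sum k a⟩

/-- Each MDP contracts by `1 - δ k` over `r` steps, uniformly in the randomized policies. As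
`e^{-1/τ}` tends to `1` when `τ` grows, one large `τ` dominates these finitely many factors. -/
lemma Model.Unichain.exists_isMixing {M : Model K m S A E} (hM : M.Unichain) :
    ∃ (r : ℕ) (τ : ℝ), M.IsMixing r τ := by
  obtain ⟨r, hr1, hr⟩ := hM
  choose δ hδ0 hδ using fun k => exists_pos_le_prod_apply (M.P_nonneg k) (hr r le_rfl k) hr1
  have hlim : Filter.Tendsto (fun τ : ℝ => Real.exp (-1 / τ)) Filter.atTop (nhds 1) := by
    have := (Real.continuous_exp.tendsto 0).comp
      (tendsto_const_nhds.div_atTop Filter.tendsto_id : Filter.Tendsto (fun τ : ℝ => -1 / τ)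
        Filter.atTop (nhds 0))
    simpa [Function.comp_def] using this
  have hall : ∀ᶠ τ : ℝ in Filter.atTop, ∀ k, 1 - δ k < Real.exp (-1 / τ) :=
    Filter.eventually_all.2 fun k => hlim.eventually (lt_mem_nhds (by linarith [hδ0 k]))
  obtain ⟨τ, hτ, hτ1⟩ := (hall.and (Filter.eventually_ge_atTop 1)).exists
  refine ⟨r, τ, hr1, hτ1, fun k d₁ d₂ h₁ h₂ π hπ => ?_⟩
  refine (sum_abs_vecMul_le_of_le (Submonoid.list_prod_mem _ ?_) (hδ0 k).le (hδ k π hπ) ?_).trans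
    (mul_le_mul_of_nonneg_right (hτ k).le (Finset.sum_nonneg fun s _ => abs_nonneg _))
  · intro Q hQ
    obtain ⟨j, rfl⟩ := (List.mem_ofFn' _ _).1 hQ
    exact policyMatrix_mem_rowStochastic (M.P_mem_rowStochastic k) (hπ j)
  · simp [Finset.sum_sub_distrib, h₁.2, h₂.2]

end ModelMixing

/-! ### Elementary estimates for pairings and distances of state-action vectors -/

section Pairing

variable {σ α : Type*} [Fintype σ] [Fintype α]

lemma pairing_sub (h θ θ' : α → σ → ℝ) : pairing h (θ - θ') = pairing h θ - pairing h θ' := by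
  simp only [pairing, Pi.sub_apply, mul_sub, Finset.sum_sub_distrib]

lemma abs_pairing_le {h : α → σ → ℝ} {c : ℝ} (hc : ∀ a s, |h a s| ≤ c) (θ : α → σ → ℝ) :
    |pairing h θ| ≤ c * ∑ a, ∑ s, |θ a s| := by
  simp only [pairing, Finset.mul_sum]
  refine (Finset.abs_sum_le_sum_abs _ _).trans (Finset.sum_le_sum fun a _ => ?_)
  refine (Finset.abs_sum_le_sum_abs _ _).trans (Finset.sum_le_sum fun s _ => ?_)
  rw [abs_mul]
  exact mul_le_mul_of_nonneg_right (hc a s) (abs_nonneg _)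

lemma stateActionPolyhedron.sum_abs_eq_one {P : α → Matrix σ σ ℝ} {θ : α → σ → ℝ}
    (h : θ ∈ stateActionPolyhedron P) : ∑ a, ∑ s, |θ a s| = 1 := by
  rw [Finset.sum_comm, ← h.2.1]
  simp only [abs_of_nonneg (h.1 _ _)]

lemma stateActionPolyhedron.abs_pairing_le {P : α → Matrix σ σ ℝ} {θ : α → σ → ℝ}
    (hθ : θ ∈ stateActionPolyhedron P) {h : α → σ → ℝ} {c : ℝ} (hc : ∀ a s, |h a s| ≤ c) :
    |pairing h θ| ≤ c := by
  simpa [stateActionPolyhedron.sum_abs_eq_one hθ] using OCMDP.abs_pairing_le hc θ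

lemma sqDist_nonneg (θ θ' : α → σ → ℝ) : 0 ≤ sqDist θ θ' :=
  Finset.sum_nonneg fun _ _ => Finset.sum_nonneg fun _ _ => sq_nonneg _

lemma sqDist_comm (θ θ' : α → σ → ℝ) : sqDist θ θ' = sqDist θ' θ := by
  simp only [sqDist, sub_sq_comm]

lemma sqDist_le_two {P : α → Matrix σ σ ℝ} {θ θ' : α → σ → ℝ}
    (h : θ ∈ stateActionPolyhedron P) (h' : θ' ∈ stateActionPolyhedron P) : sqDist θ θ' ≤ 2 := by
  calc sqDist θ θ' ≤ ∑ a, ∑ s, (|θ a s| + |θ' a s|) :=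
        Finset.sum_le_sum fun a _ => Finset.sum_le_sum fun s _ => by
          have h1 := h.1 a s
          have h2 := h'.1 a s
          have h3 := stateActionPolyhedron.le_one h a s
          have h4 := stateActionPolyhedron.le_one h' a s
          rw [abs_of_nonneg h1, abs_of_nonneg h2]
          nlinarith [mul_nonneg h1 h2]
    _ = 2 := by
        simp only [Finset.sum_add_distrib, stateActionPolyhedron.sum_abs_eq_one h,
          stateActionPolyhedron.sum_abs_eq_one h']
        norm_num

/-- The difference of squares factors entrywise with `θ + θ' - 2z`, which lies in `[-2, 2]` because
all entries lie in `[0, 1]`. -/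
lemma abs_sqDist_sub_le {P : α → Matrix σ σ ℝ} {z θ θ' : α → σ → ℝ}
    (hz : z ∈ stateActionPolyhedron P) (h : θ ∈ stateActionPolyhedron P)
    (h' : θ' ∈ stateActionPolyhedron P) :
    |sqDist z θ - sqDist z θ'| ≤ 2 * ∑ a, ∑ s, |θ a s - θ' a s| := by
  simp only [sqDist, ← Finset.sum_sub_distrib, Finset.mul_sum]
  refine (Finset.abs_sum_le_sum_abs _ _).trans (Finset.sum_le_sum fun a _ => ?_)
  refine (Finset.abs_sum_le_sum_abs _ _).trans (Finset.sum_le_sum fun s _ => ?_)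
  have e : (z a s - θ a s) ^ 2 - (z a s - θ' a s) ^ 2 =
      (θ a s + θ' a s - 2 * z a s) * (θ a s - θ' a s) := by ring
  rw [e, abs_mul]
  refine mul_le_mul_of_nonneg_right ?_ (abs_nonneg _)
  have h1 := h.1 a s
  have h2 := h'.1 a s
  have h3 := stateActionPolyhedron.le_one h a s
  have h4 := stateActionPolyhedron.le_one h' a s
  have h5 := hz.1 a s
  have h6 := stateActionPolyhedron.le_one hz a s
  rw [abs_le]
  constructor <;> linarith

/-- Cauchy–Schwarz. -/
lemma sq_sum_abs_sub_le (θ θ' : α → σ → ℝ) :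
    (∑ a, ∑ s, |θ a s - θ' a s|) ^ 2 ≤
      (Fintype.card α * Fintype.card σ : ℝ) * sqDist θ θ' := by
  have := sq_sum_le_card_mul_sum_sq (s := (Finset.univ : Finset (α × σ)))
    (f := fun p => |θ p.1 p.2 - θ' p.1 p.2|)
  simpa [Fintype.sum_prod_type, sqDist] using this

lemma convex_stateActionPolyhedron (P : α → Matrix σ σ ℝ) : Convex ℝ (stateActionPolyhedron P) := by
  intro x hx y hy a b ha hb hab
  refine ⟨fun i j => ?_, ?_, fun s' => ?_⟩
  · have h1 := mul_nonneg ha (hx.1 i j)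
    have h2 := mul_nonneg hb (hy.1 i j)
    simpa using add_nonneg h1 h2
  · have h1 := hx.2.1
    have h2 := hy.2.1
    simp only [Pi.add_apply, Pi.smul_apply, smul_eq_mul, Finset.sum_add_distrib, ← Finset.mul_sum,
      h1, h2, mul_one, hab]
  · have h1 := hx.2.2 s'
    have h2 := hy.2.2 s'
    simp only [Pi.add_apply, Pi.smul_apply, smul_eq_mul, Finset.sum_add_distrib, ← Finset.mul_sum,
      add_mul, mul_assoc, h1, h2]

end Pairing

/-! ### The proximal step: optimality, step length, Lipschitz dependence, measurability -/

section Argmin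

variable {σ α : Type*} [Fintype σ] [Fintype α]

/-- First order optimality condition of the proximal step. -/
lemma IsMinOn.pairing_nonneg {C : Set (α → σ → ℝ)} (hC : Convex ℝ C) {h θ' θ z : α → σ → ℝ}
    {c : ℝ} (hmin : IsMinOn (fun θ => pairing h θ + c * sqDist θ θ') C θ) (hθ : θ ∈ C)
    (hz : z ∈ C) : 0 ≤ pairing (fun a s => h a s + 2 * c * (θ a s - θ' a s)) (z - θ) := by
  set L := pairing (fun a s => h a s + 2 * c * (θ a s - θ' a s)) (z - θ) with hL
  have key : ∀ ε : ℝ, 0 < ε → ε ≤ 1 → 0 ≤ L + ε * (c * sqDist z θ) := by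
    intro ε hε hε1
    have hmem : (1 - ε) • θ + ε • z ∈ C := hC hθ hz (by linarith) hε.le (by ring)
    have h1 := hmin hmem
    simp only [Set.mem_ofPred_eq] at h1
    -- The objective is quadratic along the segment from `θ` to `z`. Its increase is nonnegative;
    -- dividing by `ε` and letting `ε` tend to `0` leaves the slope `L`.
    have e : pairing h ((1 - ε) • θ + ε • z) + c * sqDist ((1 - ε) • θ + ε • z) θ' =
        pairing h θ + c * sqDist θ θ' + ε * (L + ε * (c * sqDist z θ)) := by
      simp only [hL, pairing, sqDist, Finset.mul_sum, ← Finset.sum_add_distrib]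
      refine Finset.sum_congr rfl fun a _ => Finset.sum_congr rfl fun s _ => ?_
      simp only [Pi.add_apply, Pi.smul_apply, smul_eq_mul, Pi.sub_apply]
      ring
    rw [e] at h1
    exact nonneg_of_mul_nonneg_right (by linarith) hε
  have hlim : Filter.Tendsto (fun ε : ℝ => L + ε * (c * sqDist z θ))
      (nhdsWithin 0 (Set.Ioi 0)) (nhds (L + 0 * (c * sqDist z θ))) :=
    ((continuous_const.add (continuous_id.mul continuous_const)).tendsto 0).mono_left
      nhdsWithin_le_nhds
  rw [zero_mul, add_zero] at hlim
  refine ge_of_tendsto hlim ?_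
  filter_upwards [Ioc_mem_nhdsGT (zero_lt_one' ℝ)] with ε hε using key ε hε.1 hε.2

/-- The proximal step beats every competitor by the squared distance to it. -/
lemma IsMinOn.add_sqDist_le {C : Set (α → σ → ℝ)} (hC : Convex ℝ C) {h θ' θ z : α → σ → ℝ}
    {c : ℝ} (hmin : IsMinOn (fun θ => pairing h θ + c * sqDist θ θ') C θ) (hθ : θ ∈ C)
    (hz : z ∈ C) :
    pairing h θ + c * sqDist θ θ' + c * sqDist z θ ≤ pairing h z + c * sqDist z θ' := by
  have h1 := IsMinOn.pairing_nonneg hC hmin hθ hz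
  -- Exact second-order expansion of the objective at `θ`: the last term is the directional
  -- derivative towards `z`.
  have e : pairing h z + c * sqDist z θ' = pairing h θ + c * sqDist θ θ' + c * sqDist z θ +
      pairing (fun a s => h a s + 2 * c * (θ a s - θ' a s)) (z - θ) := by
    simp only [pairing, sqDist, Finset.mul_sum, ← Finset.sum_add_distrib]
    refine Finset.sum_congr rfl fun a _ => Finset.sum_congr rfl fun s _ => ?_
    simp only [Pi.sub_apply]
    ring
  linarith

/-- The proximal step moves by at most a multiple of the size of the linear term. -/
lemma IsMinOn.sum_abs_sub_le {C : Set (α → σ → ℝ)} (hC : Convex ℝ C) {h θ' θ : α → σ → ℝ}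
    {c H : ℝ} (hc : 0 < c) (hH : ∀ a s, |h a s| ≤ H)
    (hmin : IsMinOn (fun θ => pairing h θ + c * sqDist θ θ') C θ) (hθ : θ ∈ C) (hθ' : θ' ∈ C) :
    2 * c * ∑ a, ∑ s, |θ a s - θ' a s| ≤ (Fintype.card α * Fintype.card σ : ℝ) * H := by
  set D := ∑ a, ∑ s, |θ a s - θ' a s| with hD
  set n : ℝ := (Fintype.card α * Fintype.card σ : ℝ) with hn
  have hn0 : 0 ≤ n := by positivity
  -- The competitor is the previous point `θ'`. It yields `2c‖θ - θ'‖₂² ≤ H‖θ - θ'‖₁`, which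
  -- Cauchy–Schwarz turns into a bound on the `ℓ¹` norm after division by it.
  have h1 := IsMinOn.add_sqDist_le hC hmin hθ hθ'
  have h0 : sqDist θ' θ' = 0 := by simp [sqDist]
  have h2 := abs_pairing_le hH (θ' - θ)
  rw [pairing_sub] at h2
  have h3 : ∑ a, ∑ s, |(θ' - θ) a s| = D := by
    simp only [hD, Pi.sub_apply, abs_sub_comm]
  rw [h3] at h2
  have h4 := (le_abs_self _).trans h2
  rw [h0, sqDist_comm θ' θ] at h1
  have h5 : D ^ 2 ≤ n * sqDist θ θ' := sq_sum_abs_sub_le θ θ'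
  have hD0 : 0 ≤ D := Finset.sum_nonneg fun _ _ => Finset.sum_nonneg fun _ _ => abs_nonneg _
  have h6 : D * (2 * c * D) ≤ D * (n * H) := by
    nlinarith [mul_le_mul_of_nonneg_left h5 hc.le,
      mul_le_mul_of_nonneg_left (show 2 * c * sqDist θ θ' ≤ H * D by linarith) hn0]
  rcases hD0.eq_or_lt with hD1 | hD1
  · rw [← hD1, mul_zero]
    rcases isEmpty_or_nonempty (α × σ) with he | ⟨⟨a, s⟩⟩
    · have : n = 0 := by
        have := Fintype.card_eq_zero_iff.2 he
        rw [Fintype.card_prod] at this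
        rw [hn]; exact_mod_cast this
      rw [this, zero_mul]
    · exact mul_nonneg hn0 ((abs_nonneg _).trans (hH a s))
  · exact le_of_mul_le_mul_left h6 hD1

/-- The proximal step depends in a Lipschitz way on the data. -/
lemma IsMinOn.sqDist_le {C : Set (α → σ → ℝ)} (hC : Convex ℝ C)
    {h₁ h₂ p₁ p₂ θ₁ θ₂ : α → σ → ℝ} {c : ℝ} (hc : 0 < c)
    (hmin₁ : IsMinOn (fun θ => pairing h₁ θ + c * sqDist θ p₁) C θ₁) (hθ₁ : θ₁ ∈ C)
    (hmin₂ : IsMinOn (fun θ => pairing h₂ θ + c * sqDist θ p₂) C θ₂) (hθ₂ : θ₂ ∈ C) :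
    sqDist θ₁ θ₂ ≤
      sqDist (fun a s => p₁ a s - h₁ a s / (2 * c)) (fun a s => p₂ a s - h₂ a s / (2 * c)) := by
  have k₁ := IsMinOn.pairing_nonneg hC hmin₁ hθ₁ hθ₂
  have k₂ := IsMinOn.pairing_nonneg hC hmin₂ hθ₂ hθ₁
  -- The step is the Euclidean projection of `p - h / (2c)` onto `C`, and projections are
  -- nonexpansive: the sum of the two variational inequalities differs from the claim by a square.
  have h : 0 ≤ c * (sqDist (fun a s => p₁ a s - h₁ a s / (2 * c))
      (fun a s => p₂ a s - h₂ a s / (2 * c)) - sqDist θ₁ θ₂) := by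
    refine (add_nonneg k₁ k₂).trans ?_
    simp only [pairing, sqDist, ← Finset.sum_sub_distrib, Finset.mul_sum, ← Finset.sum_add_distrib]
    refine Finset.sum_le_sum fun a _ => Finset.sum_le_sum fun s _ => ?_
    simp only [Pi.sub_apply]
    have e : ∀ q : ℝ, q = 2 * c * (q / (2 * c)) := fun q => by field_simp
    rw [e (h₁ a s), e (h₂ a s)]
    simp only [mul_div_cancel_left₀ _ (show 2 * c ≠ 0 by positivity)]
    generalize h₁ a s / (2 * c) = u₁
    generalize h₂ a s / (2 * c) = u₂
    nlinarith [mul_nonneg hc.le (sq_nonneg ((p₁ a s - u₁ - (p₂ a s - u₂)) -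
      (θ₁ a s - θ₂ a s)))]
  exact sub_nonneg.1 (nonneg_of_mul_nonneg_right h hc)

/-- A real function that is Lipschitz in measurable data is measurable. -/
lemma measurable_of_sq_le_sum_sq {Ω ι : Type*} [Fintype ι] {m : MeasurableSpace Ω} {f : Ω → ℝ}
    {p : ι → Ω → ℝ} (hp : ∀ i, Measurable (p i))
    (h : ∀ x y, (f x - f y) ^ 2 ≤ ∑ i, (p i x - p i y) ^ 2) : Measurable f := by
  let q : Ω → EuclideanSpace ℝ ι := fun x => WithLp.toLp 2 fun i => p i x
  have hq : Measurable q :=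
    (PiLp.continuous_toLp 2 _).measurable.comp (measurable_pi_lambda _ hp)
  have hd : ∀ x y, |f x - f y| ≤ dist (q x) (q y) := fun x y => by
    rw [EuclideanSpace.dist_eq]
    refine Real.le_sqrt_of_sq_le ?_
    rw [sq_abs]
    simpa [q, Real.dist_eq, sq_abs] using h x y
  have hfac : ∀ x y, q x = q y → f x = f y := fun x y hxy => by
    have := hd x y
    rw [hxy, dist_self] at this
    exact sub_eq_zero.1 (abs_nonpos_iff.1 this)
  rcases isEmpty_or_nonempty Ω with hΩ | hΩ
  · exact measurable_of_empty f
  -- The hypothesis makes `f` a 1-Lipschitz function of the data vector on its range. Extending it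
  -- to the whole Euclidean space avoids any question about measurability of the range.
  let g : EuclideanSpace ℝ ι → ℝ := fun y => f (Function.invFun q y)
  have hg : ∀ x, g (q x) = f x := fun x => hfac _ _ (Function.invFun_eq ⟨x, rfl⟩)
  have hlip : LipschitzOnWith 1 g (Set.range q) := by
    refine LipschitzOnWith.of_dist_le_mul ?_
    rintro _ ⟨x, rfl⟩ _ ⟨y, rfl⟩
    rw [hg, hg, Real.dist_eq, NNReal.coe_one, one_mul]
    exact hd x y
  obtain ⟨g', hg', hgg'⟩ := hlip.extend_real
  have : f = g' ∘ q := by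
    ext x
    rw [← hg x]
    exact hgg' ⟨x, rfl⟩
  rw [this]
  exact hg'.continuous.measurable.comp hq

end Argmin

/-! ### Marginals of joint laws and the product MDP -/

section Marginal

open Matrix

variable {K m : ℕ} {S A : Fin K → Type*} [∀ k, Fintype (S k)] [∀ k, DecidableEq (S k)]
  [∀ k, Fintype (A k)] {E : Type*} [MeasurableSpace E]

-- Under a product weight, a function of one coordinate sees only that coordinate's factor: `φ` is
-- put into factor `k`, the sum of products becomes a product of sums, and the other sums are `1`.
omit [∀ k, DecidableEq (S k)] in
lemma sum_pi_mul_prod {q : ∀ k, S k → ℝ} (hq : ∀ k, ∑ s, q k s = 1) (k : Fin K) (φ : S k → ℝ) :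
    ∑ f : ∀ k, S k, φ (f k) * ∏ j, q j (f j) = ∑ s, φ s * q k s := by
  classical
  let w : ∀ j, S j → ℝ := Function.update (fun _ _ => 1) k φ
  have hwk : w k = φ := Function.update_self ..
  have hw : ∀ j, j ≠ k → w j = fun _ => 1 := fun j hj => Function.update_of_ne hj ..
  have h1 : ∀ f : ∀ k, S k, φ (f k) * ∏ j, q j (f j) = ∏ j, w j (f j) * q j (f j) := fun f => by
    rw [Finset.prod_mul_distrib]
    congr 1
    rw [Finset.prod_eq_single k (fun j _ hj => by rw [hw j hj]) (by simp), hwk]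
  simp only [h1]
  rw [← Fintype.prod_sum (fun j s => w j s * q j s), Finset.prod_eq_single k _ (by simp), hwk]
  intro j _ hj
  simp [hw j hj, hq j]

/-- The law of the state of MDP `k` when `d` is the law of the joint state. -/
def stateMarginal (d : (∀ k, S k) → ℝ) (k : Fin K) : S k → ℝ :=
  fun y => ∑ s, if s k = y then d s else 0

open Classical in
/-- The law of the action and the state of MDP `k` when `o s a` is the law of the joint state and
the joint action. -/
noncomputable def occupancyMarginal (o : (∀ k, S k) → (∀ k, A k) → ℝ) (k : Fin K) :
    A k → S k → ℝ :=
  fun b y => ∑ s, ∑ a, if a k = b ∧ s k = y then o s a else 0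

lemma pairing_occupancyMarginal (o : (∀ k, S k) → (∀ k, A k) → ℝ) (k : Fin K)
    (h : A k → S k → ℝ) :
    pairing h (occupancyMarginal o k) = ∑ s, ∑ a, h (a k) (s k) * o s a := by
  classical
  simp only [pairing, occupancyMarginal, Finset.mul_sum]
  have e : ∀ b : A k, ∑ y, ∑ s : ∀ k, S k, ∑ a : ∀ k, A k,
      h b y * (if a k = b ∧ s k = y then o s a else 0) =
      ∑ s : ∀ k, S k, ∑ a : ∀ k, A k, ∑ y, h b y * (if a k = b ∧ s k = y then o s a else 0) :=
    fun b => by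
      rw [Finset.sum_comm]
      exact Finset.sum_congr rfl fun s _ => Finset.sum_comm
  simp only [e]
  rw [Finset.sum_comm]
  refine Finset.sum_congr rfl fun s _ => ?_
  rw [Finset.sum_comm]
  refine Finset.sum_congr rfl fun a _ => ?_
  simp [ite_and]

lemma sum_mul_stateMarginal (d : (∀ k, S k) → ℝ) (k : Fin K) (φ : S k → ℝ) :
    ∑ y, φ y * stateMarginal d k y = ∑ s, φ (s k) * d s := by
  simp only [stateMarginal, Finset.mul_sum]
  rw [Finset.sum_comm]
  exact Finset.sum_congr rfl fun s _ => by simp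

lemma IsProbVector.stateMarginal {d : (∀ k, S k) → ℝ} (hd : IsProbVector d) (k : Fin K) :
    IsProbVector (stateMarginal d k) := by
  refine ⟨fun y => Finset.sum_nonneg fun s _ => ?_, ?_⟩
  · split_ifs
    exacts [hd.1 s, le_rfl]
  · simpa [hd.2] using sum_mul_stateMarginal d k fun _ => 1

omit [∀ k, Fintype (A k)] in
lemma Model.jointP_mem_rowStochastic (M : Model K m S A E) (a : ∀ k, A k) :
    M.jointP a ∈ rowStochastic ℝ (∀ k, S k) := by
  refine mem_rowStochastic_iff_sum.2 ⟨fun s s' => Finset.prod_nonneg fun k _ => M.P_nonneg _ _ _ _,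
    fun s => ?_⟩
  simp only [Model.jointP]
  rw [← Fintype.prod_sum fun k y => M.P k (a k) (s k) y]
  simp [M.P_row_sum]

omit [∀ k, Fintype (S k)] [∀ k, DecidableEq (S k)] in
lemma separable_isRandomizedPolicy {π : ∀ k, S k → A k → ℝ} (hπ : ∀ k, IsRandomizedPolicy (π k)) :
    IsRandomizedPolicy (separable π) := by
  refine fun s => ⟨fun a => Finset.prod_nonneg fun k _ => (hπ k _).1 _, ?_⟩
  simp only [separable]
  rw [← Fintype.prod_sum fun k b => π k (s k) b]
  simp [(hπ _ _).2]

omit [∀ k, Fintype (A k)] in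
lemma Model.sum_ite_jointP (M : Model K m S A E) (a : ∀ k, A k) (s : ∀ k, S k) (k : Fin K)
    (y : S k) : ∑ s', (if s' k = y then M.jointP a s s' else 0) = M.P k (a k) (s k) y := by
  have := sum_pi_mul_prod (q := fun j => M.P j (a j) (s j)) (fun j => M.P_row_sum _ _ _) k
    (fun y' => if y' = y then 1 else 0)
  simpa [Model.jointP, ite_mul] using this

/-- The next state of MDP `k` depends on the current joint law only through its marginal. -/
lemma Model.stateMarginal_vecMul (M : Model K m S A E) (d : (∀ k, S k) → ℝ)
    (pol : (∀ k, S k) → (∀ k, A k) → ℝ) (k : Fin K) (y : S k) :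
    stateMarginal (d ᵥ* policyMatrix M.jointP pol) k y =
      pairing (fun b y' => M.P k b y' y) (occupancyMarginal (fun s a => d s * pol s a) k) := by
  rw [pairing_occupancyMarginal]
  simp only [← M.sum_ite_jointP, stateMarginal, Matrix.vecMul, dotProduct, policyMatrix,
    Finset.mul_sum, Finset.sum_mul]
  have e : ∀ s' : ∀ k, S k, (if s' k = y then
      ∑ s, ∑ a, d s * (pol s a * M.jointP a s s') else 0) =
      ∑ s, ∑ a, (if s' k = y then M.jointP a s s' else 0) * (d s * pol s a) := fun s' => by
    split_ifs
    · exact Finset.sum_congr rfl fun s _ => Finset.sum_congr rfl fun a _ => by ring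
    · simp
  simp only [e]
  rw [Finset.sum_comm]
  exact Finset.sum_congr rfl fun s _ => Finset.sum_comm

lemma sum_occupancyMarginal {d : (∀ k, S k) → ℝ} {pol : (∀ k, S k) → (∀ k, A k) → ℝ}
    (hpol : IsRandomizedPolicy pol) (k : Fin K) (y : S k) :
    ∑ b, occupancyMarginal (fun s a => d s * pol s a) k b y = stateMarginal d k y := by
  have h := pairing_occupancyMarginal (fun s a => d s * pol s a) k
    (fun _ y' => if y' = y then 1 else 0)
  simp only [pairing, ite_mul, one_mul, zero_mul, Finset.sum_ite_eq', Finset.mem_univ,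
    if_true] at h
  rw [h, stateMarginal]
  refine Finset.sum_congr rfl fun s _ => ?_
  split_ifs
  · rw [← Finset.mul_sum, (hpol s).2, mul_one]
  · simp

/-- A stationary joint policy has its marginals in the state-action polyhedra. -/
lemma Model.occupancyMarginal_mem (M : Model K m S A E) {d : (∀ k, S k) → ℝ}
    {pol : (∀ k, S k) → (∀ k, A k) → ℝ} (hpol : IsRandomizedPolicy pol)
    (hd : IsStationary (policyMatrix M.jointP pol) d) (k : Fin K) :
    occupancyMarginal (fun s a => d s * pol s a) k ∈ stateActionPolyhedron (M.P k) := by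
  refine ⟨fun b y => Finset.sum_nonneg fun s _ => Finset.sum_nonneg fun a _ => ?_, ?_,
    fun y => ?_⟩
  · split_ifs
    exacts [mul_nonneg (hd.1.1 s) ((hpol s).1 a), le_rfl]
  · simp only [sum_occupancyMarginal hpol]
    exact (hd.1.stateMarginal k).2
  · rw [sum_occupancyMarginal hpol, ← hd.2, M.stateMarginal_vecMul, hd.2, pairing, Finset.sum_comm]
    simp only [mul_comm]

/-- The other actions sum out, and `π k` looks only at its own state. Arbitrary dependence between
the states of the MDPs is therefore harmless, and each MDP can be treated as a chain of its own. -/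
lemma occupancyMarginal_separable {π : ∀ k, S k → A k → ℝ} (hπ : ∀ k, IsRandomizedPolicy (π k))
    (d : (∀ k, S k) → ℝ) (k : Fin K) (b : A k) (y : S k) :
    occupancyMarginal (fun s a => d s * separable π s a) k b y =
      stateMarginal d k y * π k y b := by
  classical
  have h : ∀ s : ∀ k, S k, ∑ a : ∀ k, A k, (if a k = b then separable π s a else 0) =
      π k (s k) b := fun s => by
    have := sum_pi_mul_prod (S := A) (q := fun j => π j (s j)) (fun j => (hπ j _).2) k
      (fun b' => if b' = b then 1 else 0)
    simpa [separable, ite_mul] using this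
  simp only [occupancyMarginal, stateMarginal, Finset.sum_mul]
  refine Finset.sum_congr rfl fun s _ => ?_
  split_ifs with hs
  · subst hs
    rw [← h s, Finset.mul_sum]
    exact Finset.sum_congr rfl fun a _ => by simp [mul_ite]
  · simp [hs]

/-- Under a separable policy the marginal law of MDP `k` evolves by its own transition matrix. -/
lemma Model.stateMarginal_vecMul_separable (M : Model K m S A E) {π : ∀ k, S k → A k → ℝ}
    (hπ : ∀ k, IsRandomizedPolicy (π k)) (d : (∀ k, S k) → ℝ) (k : Fin K) :
    stateMarginal (d ᵥ* policyMatrix M.jointP (separable π)) k =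
      stateMarginal d k ᵥ* policyMatrix (M.P k) (π k) := by
  ext y
  rw [M.stateMarginal_vecMul, pairing, Finset.sum_comm]
  simp only [occupancyMarginal_separable hπ, Matrix.vecMul, dotProduct, policyMatrix,
    Finset.mul_sum]
  exact Finset.sum_congr rfl fun s _ => Finset.sum_congr rfl fun a _ => by ring

end Marginal

/-! ### Bounded measurable functions -/

section BoundedMeasurable

variable {Ω : Type*}

/-- `f` is a bounded `m`-measurable function. -/
def IsBddMeasurable (m : MeasurableSpace Ω) (f : Ω → ℝ) : Prop :=
  Measurable[m] f ∧ ∃ c, ∀ x, |f x| ≤ c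

namespace IsBddMeasurable

variable {m m' : MeasurableSpace Ω} {f g : Ω → ℝ}

lemma mono (hf : IsBddMeasurable m f) (h : m ≤ m') : IsBddMeasurable m' f :=
  ⟨hf.1.mono h le_rfl, hf.2⟩

lemma const (m : MeasurableSpace Ω) (c : ℝ) : IsBddMeasurable m fun _ => c :=
  ⟨measurable_const, |c|, fun _ => le_rfl⟩

lemma add (hf : IsBddMeasurable m f) (hg : IsBddMeasurable m g) :
    IsBddMeasurable m fun x => f x + g x := by
  obtain ⟨hf, c, hc⟩ := hf
  obtain ⟨hg, c', hc'⟩ := hg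
  exact ⟨hf.add hg, c + c', fun x => (abs_add_le _ _).trans (add_le_add (hc x) (hc' x))⟩

lemma mul (hf : IsBddMeasurable m f) (hg : IsBddMeasurable m g) :
    IsBddMeasurable m fun x => f x * g x := by
  obtain ⟨hf, c, hc⟩ := hf
  obtain ⟨hg, c', hc'⟩ := hg
  refine ⟨hf.mul hg, c * c', fun x => ?_⟩
  rw [abs_mul]
  exact mul_le_mul (hc x) (hc' x) (abs_nonneg _) ((abs_nonneg _).trans (hc x))

lemma neg (hf : IsBddMeasurable m f) : IsBddMeasurable m fun x => -f x :=
  ⟨hf.1.neg, hf.2.imp fun c hc x => by rw [abs_neg]; exact hc x⟩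

lemma sub (hf : IsBddMeasurable m f) (hg : IsBddMeasurable m g) :
    IsBddMeasurable m fun x => f x - g x := by
  simpa only [sub_eq_add_neg] using hf.add hg.neg

lemma const_mul (c : ℝ) (hf : IsBddMeasurable m f) : IsBddMeasurable m fun x => c * f x :=
  (const m c).mul hf

lemma pow (hf : IsBddMeasurable m f) (n : ℕ) : IsBddMeasurable m fun x => f x ^ n := by
  induction n with
  | zero => simpa using const m 1
  | succ n ih => simpa only [pow_succ] using ih.mul hf

lemma abs (hf : IsBddMeasurable m f) : IsBddMeasurable m fun x => |f x| :=
  ⟨hf.1.abs, hf.2.imp fun c hc x => by rw [abs_abs]; exact hc x⟩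

lemma max_zero (hf : IsBddMeasurable m f) : IsBddMeasurable m fun x => max (f x) 0 :=
  ⟨hf.1.max measurable_const, hf.2.imp fun c hc x => by
    rw [abs_of_nonneg (le_max_right _ _)]
    exact max_le ((le_abs_self _).trans (hc x)) ((abs_nonneg _).trans (hc x))⟩

lemma sqrt (hf : IsBddMeasurable m f) : IsBddMeasurable m fun x => √(f x) :=
  ⟨hf.1.sqrt, hf.2.elim fun c hc => ⟨√c, fun x => by
    rw [abs_of_nonneg (Real.sqrt_nonneg _)]
    exact Real.sqrt_le_sqrt ((le_abs_self _).trans (hc x))⟩⟩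

lemma sum {ι : Type*} (s : Finset ι) {f : ι → Ω → ℝ} (hf : ∀ i ∈ s, IsBddMeasurable m (f i)) :
    IsBddMeasurable m fun x => ∑ i ∈ s, f i x := by
  classical
  induction s using Finset.induction_on with
  | empty => simpa using const m 0
  | insert i s hi ih =>
    simp only [Finset.sum_insert hi]
    exact (hf i (Finset.mem_insert_self i s)).add
      (ih fun j hj => hf j (Finset.mem_insert_of_mem hj))

lemma prod {ι : Type*} (s : Finset ι) {f : ι → Ω → ℝ} (hf : ∀ i ∈ s, IsBddMeasurable m (f i)) :
    IsBddMeasurable m fun x => ∏ i ∈ s, f i x := by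
  classical
  induction s using Finset.induction_on with
  | empty => simpa using const m 1
  | insert i s hi ih =>
    simp only [Finset.prod_insert hi]
    exact (hf i (Finset.mem_insert_self i s)).mul
      (ih fun j hj => hf j (Finset.mem_insert_of_mem hj))

/-- A random index with finitely many values is handled by expanding over indicators of its values.
-/
lemma comp_discrete {β : Type*} [Fintype β] {X : Ω → β} (hX : Measurable[m, ⊤] X)
    {F : β → Ω → ℝ} (hF : ∀ y, IsBddMeasurable m (F y)) : IsBddMeasurable m fun x => F (X x) x := by
  classical
  have e : (fun x => F (X x) x) = fun x => ∑ y, (if X x = y then 1 else 0) * F y x := by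
    ext x; simp
  rw [e]
  refine sum _ fun y _ => mul ⟨?_, 1, fun x => by simp only; split_ifs <;> simp⟩ (hF y)
  let _ : MeasurableSpace β := ⊤
  exact (measurable_from_top (f := fun z => if z = y then (1 : ℝ) else 0)).comp hX

lemma integrable {m : MeasurableSpace Ω} {f : Ω → ℝ} (hf : IsBddMeasurable m f) (Pr : Measure Ω)
    [IsFiniteMeasure Pr] : Integrable f Pr := by
  obtain ⟨h, c, hc⟩ := hf
  exact Integrable.of_bound h.aestronglyMeasurable c (Filter.Eventually.of_forall hc)

end IsBddMeasurable

/-- The pull-out property, integrated. It converts the conditional laws defining a trajectory into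
identities tested against bounded functions `φ`. -/
lemma integral_mul_indicator_eq {m m₀ : MeasurableSpace Ω} {Pr : Measure Ω} [IsFiniteMeasure Pr]
    (hm : m ≤ m₀) {B : Set Ω} (hB : MeasurableSet B) {φ g : Ω → ℝ} (hφ : IsBddMeasurable m φ)
    (h : Pr⟦B | m⟧ =ᵐ[Pr] g) :
    ∫ x, φ x * B.indicator (fun _ => 1) x ∂Pr = ∫ x, φ x * g x ∂Pr := by
  have hint : Integrable (B.indicator fun _ => (1 : ℝ)) Pr :=
    (integrable_const (1 : ℝ)).indicator hB
  obtain ⟨c, hc⟩ := hφ.2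
  have h1 := condExp_stronglyMeasurable_mul_of_bound hm (μ := Pr) hφ.1.stronglyMeasurable hint c
    (Filter.Eventually.of_forall hc)
  calc ∫ x, φ x * B.indicator (fun _ => 1) x ∂Pr
      = ∫ x, (Pr[φ * B.indicator (fun _ => (1 : ℝ)) | m]) x ∂Pr := (integral_condExp hm).symm
    _ = ∫ x, φ x * g x ∂Pr := integral_congr_ae (h1.trans (by
        filter_upwards [h] with x hx
        simp only [Pi.mul_apply]
        rw [← hx]))

end BoundedMeasurable

/-! ### The law of the trajectory given the noise -/

section Trajectory

open Matrix

variable {K m : ℕ} {S A : Fin K → Type*} [∀ k, Fintype (S k)] [∀ k, DecidableEq (S k)]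
  [∀ k, Fintype (A k)] {E : Type*} [MeasurableSpace E]

/-- Law of the joint state at slot `t` when the actions are drawn from `p 0, p 1, …`. -/
def Model.stateLaw (M : Model K m S A E) (d₀ : (∀ k, S k) → ℝ)
    (p : ℕ → (∀ k, S k) → (∀ k, A k) → ℝ) : ℕ → (∀ k, S k) → ℝ
  | 0 => d₀
  | t + 1 => M.stateLaw d₀ p t ᵥ* policyMatrix M.jointP (p t)

omit [∀ k, DecidableEq (S k)] in
lemma Model.stateLaw_eq_of_isStationary (M : Model K m S A E) {d : (∀ k, S k) → ℝ}
    {pol : (∀ k, S k) → (∀ k, A k) → ℝ} (hd : IsStationary (policyMatrix M.jointP pol) d) (t : ℕ) :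
    M.stateLaw d (fun _ => pol) t = d := by
  induction t with
  | zero => rfl
  | succ t ih => rw [Model.stateLaw, ih, hd.2]

variable {Ω : Type*} [mΩ : MeasurableSpace Ω] {Pr : Measure Ω} {ω μ : ℕ → Ω → E}

lemma IsEnvironment.sigmaEnv_le (h : IsEnvironment Pr ω μ) : sigmaEnv ω μ ≤ mΩ :=
  sup_le (iSup_le fun t => (h.measurable_ω t).comap_le)
    (iSup_le fun t => (h.measurable_μ t).comap_le)

lemma comap_top_le {β : Type*} [Finite β] {X : Ω → β} (hX : ∀ y, MeasurableSet (X ⁻¹' {y})) :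
    MeasurableSpace.comap X ⊤ ≤ mΩ := by
  rintro _ ⟨B, -, rfl⟩
  rw [← Set.biUnion_of_singleton B, Set.preimage_iUnion₂]
  exact MeasurableSet.biUnion B.toFinite.countable fun y _ => hX y

lemma sigmaBefore_le {β : Type*} [Finite β] {X : ℕ → Ω → β}
    (hX : ∀ t y, MeasurableSet (X t ⁻¹' {y})) (n : ℕ) : sigmaBefore X n ≤ mΩ :=
  iSup₂_le fun j _ => comap_top_le (hX j)

omit mΩ in
lemma measurable_sigmaBefore {β : Type*} {X : ℕ → Ω → β} {j n : ℕ} (h : j < n) :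
    Measurable[sigmaBefore X n, ⊤] (X j) :=
  Measurable.mono (comap_measurable (m := ⊤) (X j))
    (le_iSup₂_of_le (f := fun j (_ : j < n) => MeasurableSpace.comap (X j) ⊤) j h le_rfl) le_rfl

variable {M : Model K m S A E} {d₀ : (∀ k, S k) → ℝ}
  {p : ℕ → Ω → (∀ k, S k) → (∀ k, A k) → ℝ}
  {s : ℕ → Ω → ∀ k, S k} {a : ℕ → Ω → ∀ k, A k} [IsProbabilityMeasure Pr]

/-- The σ-algebra of the noise and of the states and actions up to slot `t`. -/
@[reducible] def sigmaPast (ω μ : ℕ → Ω → E) (s : ℕ → Ω → ∀ k, S k) (a : ℕ → Ω → ∀ k, A k)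
    (t : ℕ) : MeasurableSpace Ω :=
  sigmaBefore s (t + 1) ⊔ sigmaBefore a (t + 1) ⊔ sigmaEnv ω μ

namespace Model.IsTrajectory

/-- The components of the next joint state are independent given the past. -/
lemma integral_mul_prod_next_state (h : M.IsTrajectory Pr ω μ d₀ p s a)
    (henv : IsEnvironment Pr ω μ) (t : ℕ) (y : ∀ k, S k) (J : Finset (Fin K)) {φ : Ω → ℝ}
    (hφ : IsBddMeasurable (sigmaPast ω μ s a t) φ) :
    ∫ x, φ x * ∏ k ∈ J, (if s (t + 1) x k = y k then 1 else 0) ∂Pr =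
      ∫ x, φ x * ∏ k ∈ J, M.P k (a t x k) (s t x k) (y k) ∂Pr := by
  induction J using Finset.induction_on generalizing φ with
  | empty => rfl
  | insert k J hk ih =>
    have hs : Measurable[sigmaPast ω μ s a t, ⊤] (s t) :=
      (measurable_sigmaBefore (Nat.lt_succ_self t)).mono (le_sup_left.trans le_sup_left) le_rfl
    have ha : Measurable[sigmaPast ω μ s a t, ⊤] (a t) :=
      (measurable_sigmaBefore (Nat.lt_succ_self t)).mono (le_sup_right.trans le_sup_left) le_rfl
    have hP : IsBddMeasurable (sigmaPast ω μ s a t) fun x => M.P k (a t x k) (s t x k) (y k) :=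
      IsBddMeasurable.comp_discrete hs (F := fun σ x => M.P k (a t x k) (σ k) (y k)) fun σ =>
        IsBddMeasurable.comp_discrete ha (F := fun b _ => M.P k (b k) (σ k) (y k)) fun b =>
          IsBddMeasurable.const _ _
    have hcoord : ∀ j, ∀ z : S j, MeasurableSet ((fun x => s (t + 1) x j) ⁻¹' {z}) := fun j z => by
      have : (fun x => s (t + 1) x j) ⁻¹' {z} = ⋃ σ ∈ {σ : ∀ k, S k | σ j = z},
          s (t + 1) ⁻¹' {σ} := by ext x; simp
      rw [this]
      exact MeasurableSet.biUnion (Set.toFinite _).countable fun σ _ => h.measurable_state _ _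
    have hle : sigmaPast ω μ s a t ⊔ ⨆ j, ⨆ _ : j ≠ k,
        MeasurableSpace.comap (fun x => s (t + 1) x j) ⊤ ≤ mΩ :=
      sup_le (sup_le (sup_le (sigmaBefore_le h.measurable_state _)
        (sigmaBefore_le h.measurable_action _)) henv.sigmaEnv_le)
        (iSup₂_le fun j _ => comap_top_le (hcoord j))
    -- The transition law of component `k` is conditional on the past and on the other next states,
    -- so all factors from `J` may serve as test functions. The kernel that replaces component `k`
    -- depends on the past only and is absorbed into `φ` for the induction hypothesis.
    have hJ : IsBddMeasurable (sigmaPast ω μ s a t ⊔ ⨆ j, ⨆ _ : j ≠ k,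
        MeasurableSpace.comap (fun x => s (t + 1) x j) ⊤)
        fun x => φ x * ∏ j ∈ J, (if s (t + 1) x j = y j then 1 else 0) := by
      refine (hφ.mono le_sup_left).mul (IsBddMeasurable.prod _ fun j hj => ?_)
      refine IsBddMeasurable.mono (m := MeasurableSpace.comap (fun x => s (t + 1) x j) ⊤) ?_
        (le_sup_of_le_right (le_iSup₂_of_le (f := fun j (_ : j ≠ k) =>
          MeasurableSpace.comap (fun x => s (t + 1) x j) ⊤) j
          (fun hjk => hk (hjk ▸ hj)) le_rfl))
      exact IsBddMeasurable.comp_discrete (comap_measurable (m := ⊤) _)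
        (F := fun z _ => if z = y j then 1 else 0) fun z => IsBddMeasurable.const _ _
    have h1 := integral_mul_indicator_eq hle (hcoord k (y k)) hJ (h.transition t k (y k))
    have h2 := ih (hφ.mul hP)
    simp only [Finset.prod_insert hk]
    calc _ = ∫ x, (φ x * ∏ j ∈ J, (if s (t + 1) x j = y j then 1 else 0)) *
          ((fun x => s (t + 1) x k) ⁻¹' {y k}).indicator (fun _ => 1) x ∂Pr := by
          refine integral_congr_ae (Filter.Eventually.of_forall fun x => ?_)
          by_cases hx : s (t + 1) x k = y k <;> simp [Set.indicator, hx]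
      _ = _ := h1
      _ = _ := by
          refine (integral_congr_ae (Filter.Eventually.of_forall fun x => ?_)).trans
            (h2.trans (integral_congr_ae (Filter.Eventually.of_forall fun x => ?_))) <;>
          · beta_reduce
            ring

variable (hp : ∀ t σ b, IsBddMeasurable (sigmaEnv ω μ) fun x => p t x σ b)
  (hv : ∀ t σ, IsBddMeasurable (sigmaEnv ω μ) fun x => M.stateLaw d₀ (fun t => p t x) t σ)

include hp in
open Classical in
/-- Joint law of state and action at slot `t`, given the law of the state. -/
lemma integral_mul_action (h : M.IsTrajectory Pr ω μ d₀ p s a) (henv : IsEnvironment Pr ω μ)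
    {t : ℕ} {σ : ∀ k, S k} {w : Ω → ℝ}
    (hw : ∀ φ, IsBddMeasurable (sigmaEnv ω μ) φ →
      ∫ x, φ x * (if s t x = σ then 1 else 0) ∂Pr = ∫ x, φ x * w x ∂Pr)
    (b : ∀ k, A k) {φ : Ω → ℝ} (hφ : IsBddMeasurable (sigmaEnv ω μ) φ) :
    ∫ x, φ x * (if s t x = σ then 1 else 0) * (if a t x = b then 1 else 0) ∂Pr =
      ∫ x, φ x * (w x * p t x σ b) ∂Pr := by
  have hle : sigmaBefore s (t + 1) ⊔ sigmaBefore a t ⊔ sigmaEnv ω μ ≤ mΩ :=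
    sup_le (sup_le (sigmaBefore_le h.measurable_state _) (sigmaBefore_le h.measurable_action _))
      henv.sigmaEnv_le
  have hφ' : IsBddMeasurable (sigmaBefore s (t + 1) ⊔ sigmaBefore a t ⊔ sigmaEnv ω μ)
      fun x => φ x * (if s t x = σ then 1 else 0) :=
    (hφ.mono le_sup_right).mul (IsBddMeasurable.comp_discrete
      ((measurable_sigmaBefore (Nat.lt_succ_self t)).mono (le_sup_left.trans le_sup_left) le_rfl)
      (F := fun z _ => if z = σ then 1 else 0) fun z => IsBddMeasurable.const _ _)
  have h1 := integral_mul_indicator_eq hle (h.measurable_action t b) hφ' (h.action t b)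
  -- On the event that the state is `σ`, the action probability is the noise-measurable `p t x σ b`,
  -- which can join the test function.
  have h2 := hw _ (hφ.mul (hp t σ b))
  calc _ = ∫ x, φ x * (if s t x = σ then 1 else 0) *
        (a t ⁻¹' {b}).indicator (fun _ => 1) x ∂Pr := by
        refine integral_congr_ae (Filter.Eventually.of_forall fun x => ?_)
        simp only [Set.indicator_apply, Set.mem_preimage, Set.mem_singleton_iff]
    _ = _ := h1
    _ = ∫ x, φ x * p t x σ b * (if s t x = σ then 1 else 0) ∂Pr := by
        refine integral_congr_ae (Filter.Eventually.of_forall fun x => ?_)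
        simp only
        split_ifs with hx
        · rw [hx]; ring
        · ring
    _ = _ := by
        rw [h2]
        refine integral_congr_ae (Filter.Eventually.of_forall fun x => ?_)
        simp only
        ring

include hp hv in
/-- Given the noise, the joint state at slot `t` has law `stateLaw`. -/
lemma integral_mul_state (h : M.IsTrajectory Pr ω μ d₀ p s a) (henv : IsEnvironment Pr ω μ)
    (t : ℕ) (σ : ∀ k, S k) {φ : Ω → ℝ} (hφ : IsBddMeasurable (sigmaEnv ω μ) φ) :
    ∫ x, φ x * (if s t x = σ then 1 else 0) ∂Pr =
      ∫ x, φ x * M.stateLaw d₀ (fun t => p t x) t σ ∂Pr := by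
  classical
  induction t generalizing σ φ with
  | zero =>
    have h1 := integral_mul_indicator_eq henv.sigmaEnv_le (h.measurable_state 0 σ) hφ (h.initial σ)
    refine Eq.trans (integral_congr_ae (Filter.Eventually.of_forall fun x => ?_)) h1
    simp only [Set.indicator_apply, Set.mem_preimage, Set.mem_singleton_iff]
  | succ t ih =>
    -- With all components the product of kernels is the joint transition matrix; splitting over the
    -- values of state and action at `t` then gives the recursion that defines `stateLaw`.
    have h1 := h.integral_mul_prod_next_state henv t σ Finset.univ (hφ.mono le_sup_right)
    have hs : Measurable[mΩ, ⊤] (s t) := (measurable_sigmaBefore (Nat.lt_succ_self t)).mono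
      (sigmaBefore_le h.measurable_state (t + 1)) le_rfl
    have ha : Measurable[mΩ, ⊤] (a t) := (measurable_sigmaBefore (Nat.lt_succ_self t)).mono
      (sigmaBefore_le h.measurable_action (t + 1)) le_rfl
    have hφ' := hφ.mono henv.sigmaEnv_le
    have hs1 : ∀ σ' : ∀ k, S k, IsBddMeasurable mΩ fun x => if s t x = σ' then (1 : ℝ) else 0 :=
      fun σ' => IsBddMeasurable.comp_discrete hs (F := fun z _ => if z = σ' then 1 else 0)
        fun z => IsBddMeasurable.const _ _
    have ha1 : ∀ b : ∀ k, A k, IsBddMeasurable mΩ fun x => if a t x = b then (1 : ℝ) else 0 :=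
      fun b => IsBddMeasurable.comp_discrete ha (F := fun z _ => if z = b then 1 else 0)
        fun z => IsBddMeasurable.const _ _
    calc _ = ∫ x, φ x * ∏ k, (if s (t + 1) x k = σ k then 1 else 0) ∂Pr := by
          refine integral_congr_ae (Filter.Eventually.of_forall fun x => ?_)
          simp only [Finset.prod_ite_zero, Finset.prod_const_one, funext_iff, Finset.mem_univ,
            true_imp_iff]
      _ = _ := h1
      _ = ∫ x, ∑ σ', ∑ b, M.jointP b σ' σ *
            (φ x * (if s t x = σ' then 1 else 0) * (if a t x = b then 1 else 0)) ∂Pr := by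
          refine integral_congr_ae (Filter.Eventually.of_forall fun x => ?_)
          simp [Model.jointP, mul_comm]
      _ = ∑ σ', ∑ b, M.jointP b σ' σ *
            ∫ x, φ x * (if s t x = σ' then 1 else 0) * (if a t x = b then 1 else 0) ∂Pr := by
          rw [integral_finsetSum _ fun σ' _ => (IsBddMeasurable.sum _ fun b _ =>
            ((hφ'.mul (hs1 σ')).mul (ha1 b)).const_mul _).integrable Pr]
          refine Finset.sum_congr rfl fun σ' _ => ?_
          rw [integral_finsetSum _ fun b _ =>
            (((hφ'.mul (hs1 σ')).mul (ha1 b)).const_mul _).integrable Pr]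
          simp only [integral_const_mul]
      _ = ∑ σ', ∑ b, M.jointP b σ' σ *
            ∫ x, φ x * (M.stateLaw d₀ (fun t => p t x) t σ' * p t x σ' b) ∂Pr := by
          refine Finset.sum_congr rfl fun σ' _ => Finset.sum_congr rfl fun b _ => ?_
          rw [h.integral_mul_action hp henv (fun φ hφ => ih σ' hφ) b hφ]
      _ = ∫ x, ∑ σ', ∑ b, M.jointP b σ' σ *
            (φ x * (M.stateLaw d₀ (fun t => p t x) t σ' * p t x σ' b)) ∂Pr := by
          have hint : ∀ σ' b, IsBddMeasurable mΩ fun x => M.jointP b σ' σ *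
              (φ x * (M.stateLaw d₀ (fun t => p t x) t σ' * p t x σ' b)) := fun σ' b =>
            ((hφ.mul ((hv t σ').mul (hp t σ' b))).mono henv.sigmaEnv_le).const_mul _
          rw [integral_finsetSum _ fun σ' _ => (IsBddMeasurable.sum _ fun b _ =>
            hint σ' b).integrable Pr]
          refine Finset.sum_congr rfl fun σ' _ => ?_
          rw [integral_finsetSum _ fun b _ => (hint σ' b).integrable Pr]
          simp only [integral_const_mul]
      _ = _ := by
          refine integral_congr_ae (Filter.Eventually.of_forall fun x => ?_)
          simp only [Model.stateLaw, Matrix.vecMul, dotProduct, policyMatrix, Finset.mul_sum]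
          exact Finset.sum_congr rfl fun σ' _ => Finset.sum_congr rfl fun b _ => by ring

include hp hv in
/-- Expected one-slot value of a function of the action, the state and the noise. -/
lemma integral_eq_integral_pairing (h : M.IsTrajectory Pr ω μ d₀ p s a)
    (henv : IsEnvironment Pr ω μ) (t : ℕ) (k : Fin K) {φ : A k → S k → Ω → ℝ}
    (hφ : ∀ b y, IsBddMeasurable (sigmaEnv ω μ) (φ b y)) :
    ∫ x, φ (a t x k) (s t x k) x ∂Pr =
      ∫ x, pairing (fun b y => φ b y x) (occupancyMarginal
        (fun σ b => M.stateLaw d₀ (fun t => p t x) t σ * p t x σ b) k) ∂Pr := by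
  classical
  have hs : Measurable[mΩ, ⊤] (s t) := (measurable_sigmaBefore (Nat.lt_succ_self t)).mono
    (sigmaBefore_le h.measurable_state (t + 1)) le_rfl
  have ha : Measurable[mΩ, ⊤] (a t) := (measurable_sigmaBefore (Nat.lt_succ_self t)).mono
    (sigmaBefore_le h.measurable_action (t + 1)) le_rfl
  have hs1 : ∀ σ' : ∀ k, S k, IsBddMeasurable mΩ fun x => if s t x = σ' then (1 : ℝ) else 0 :=
    fun σ' => IsBddMeasurable.comp_discrete hs (F := fun z _ => if z = σ' then 1 else 0)
      fun z => IsBddMeasurable.const _ _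
  have ha1 : ∀ b : ∀ k, A k, IsBddMeasurable mΩ fun x => if a t x = b then (1 : ℝ) else 0 :=
    fun b => IsBddMeasurable.comp_discrete ha (F := fun z _ => if z = b then 1 else 0)
      fun z => IsBddMeasurable.const _ _
  have hφ' := fun b y => (hφ b y).mono henv.sigmaEnv_le
  have hint : ∀ (σ : ∀ k, S k) (b : ∀ k, A k), IsBddMeasurable mΩ fun x => φ (b k) (σ k) x *
      (M.stateLaw d₀ (fun t => p t x) t σ * p t x σ b) := fun σ b =>
    ((hφ _ _).mul ((hv t σ).mul (hp t σ b))).mono henv.sigmaEnv_le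
  simp only [pairing_occupancyMarginal]
  calc _ = ∫ x, ∑ σ, ∑ b, φ (b k) (σ k) x * (if s t x = σ then 1 else 0) *
        (if a t x = b then 1 else 0) ∂Pr := by
        refine integral_congr_ae (Filter.Eventually.of_forall fun x => ?_)
        simp
    _ = ∑ σ, ∑ b, ∫ x, φ (b k) (σ k) x * (if s t x = σ then 1 else 0) *
        (if a t x = b then 1 else 0) ∂Pr := by
        rw [integral_finsetSum _ fun σ' _ => (IsBddMeasurable.sum _ fun b _ =>
          (((hφ' _ _).mul (hs1 σ')).mul (ha1 b))).integrable Pr]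
        refine Finset.sum_congr rfl fun σ' _ => ?_
        rw [integral_finsetSum _ fun b _ =>
          (((hφ' _ _).mul (hs1 σ')).mul (ha1 b)).integrable Pr]
    _ = ∑ σ, ∑ b, ∫ x, φ (b k) (σ k) x *
        (M.stateLaw d₀ (fun t => p t x) t σ * p t x σ b) ∂Pr :=
        Finset.sum_congr rfl fun σ' _ => Finset.sum_congr rfl fun b _ =>
          h.integral_mul_action hp henv (fun φ hφ => h.integral_mul_state hp hv henv t σ' hφ) b
            (hφ _ _)
    _ = _ := by
        rw [integral_finsetSum _ fun σ' _ => (IsBddMeasurable.sum _ fun b _ =>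
          hint σ' b).integrable Pr]
        refine Finset.sum_congr rfl fun σ' _ => ?_
        rw [integral_finsetSum _ fun b _ => (hint σ' b).integrable Pr]

end Model.IsTrajectory

end Trajectory

/-! ### One-slot values, distances and feasibility over all MDPs -/

section Slot

variable {K m : ℕ} {S A : Fin K → Type*} [∀ k, Fintype (S k)] [∀ k, Fintype (A k)]
  {E : Type*} [MeasurableSpace E]

/-- One-slot penalty of the state-action vectors `z` when the noise is `e`. -/
def Model.slotPenalty (M : Model K m S A E) (e : E) (z : ∀ k, A k → S k → ℝ) : ℝ :=
  ∑ k, pairing (fun a s => M.fhat k a s e) (z k)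

/-- One-slot value of constraint `i` of the state-action vectors `z` when the noise is `e`. -/
def Model.slotConstraint (M : Model K m S A E) (i : Fin m) (e : E) (z : ∀ k, A k → S k → ℝ) : ℝ :=
  ∑ k, pairing (fun a s => M.ghat i k a s e) (z k)

/-- Sum over the MDPs of the squared Euclidean distances. -/
def totalSqDist (z z' : ∀ k, A k → S k → ℝ) : ℝ := ∑ k, sqDist (z k) (z' k)

/-- Sum over the MDPs of the `ℓ¹` distances. -/
def totalDist (z z' : ∀ k, A k → S k → ℝ) : ℝ := ∑ k, ∑ a, ∑ s, |z k a s - z' k a s|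

/-- Every component of `z` lies in the state-action polyhedron of its MDP. -/
def Model.Feasible (M : Model K m S A E) (z : ∀ k, A k → S k → ℝ) : Prop :=
  ∀ k, z k ∈ stateActionPolyhedron (M.P k)

/-- The total number of state-action pairs. -/
def totalCard {K : ℕ} (S A : Fin K → Type*) [∀ k, Fintype (S k)] [∀ k, Fintype (A k)] : ℝ :=
  ∑ k, (Fintype.card (A k) : ℝ) * Fintype.card (S k)

lemma totalSqDist_nonneg (z z' : ∀ k, A k → S k → ℝ) : 0 ≤ totalSqDist z z' :=
  Finset.sum_nonneg fun _ _ => sqDist_nonneg _ _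

lemma totalDist_nonneg (z z' : ∀ k, A k → S k → ℝ) : 0 ≤ totalDist z z' :=
  Finset.sum_nonneg fun _ _ => Finset.sum_nonneg fun _ _ => Finset.sum_nonneg fun _ _ =>
    abs_nonneg _

variable {M : Model K m S A E} {z z' y : ∀ k, A k → S k → ℝ}

lemma Model.Feasible.totalSqDist_le (hz : M.Feasible z) (hz' : M.Feasible z') :
    totalSqDist z z' ≤ 2 * K := by
  refine (Finset.sum_le_sum fun k _ => sqDist_le_two (hz k) (hz' k)).trans ?_
  simp [mul_comm]

lemma Model.Feasible.abs_totalSqDist_sub_le (hy : M.Feasible y) (hz : M.Feasible z)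
    (hz' : M.Feasible z') : |totalSqDist y z - totalSqDist y z'| ≤ 2 * totalDist z z' := by
  simp only [totalSqDist, totalDist, ← Finset.sum_sub_distrib]
  rw [Finset.mul_sum]
  exact (Finset.abs_sum_le_sum_abs _ _).trans
    (Finset.sum_le_sum fun k _ => abs_sqDist_sub_le (hy k) (hz k) (hz' k))

lemma Model.Feasible.abs_slotConstraint_le (hz : M.Feasible z) (i : Fin m) (e : E) :
    |M.slotConstraint i e z| ≤ K * M.Ψ := by
  refine (Finset.abs_sum_le_sum_abs _ _).trans ((Finset.sum_le_sum fun k _ =>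
    stateActionPolyhedron.abs_pairing_le (hz k) fun a s => M.ghat_bound i k a s e).trans ?_)
  simp

lemma Model.Feasible.abs_slotPenalty_le (hz : M.Feasible z) (e : E) :
    |M.slotPenalty e z| ≤ K * M.Ψ := by
  refine (Finset.abs_sum_le_sum_abs _ _).trans ((Finset.sum_le_sum fun k _ =>
    stateActionPolyhedron.abs_pairing_le (hz k) fun a s => M.fhat_bound k a s e).trans ?_)
  simp

lemma Model.abs_slotConstraint_sub_le (M : Model K m S A E) (i : Fin m) (e : E)
    (z z' : ∀ k, A k → S k → ℝ) :
    |M.slotConstraint i e z - M.slotConstraint i e z'| ≤ M.Ψ * totalDist z z' := by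
  simp only [Model.slotConstraint, totalDist, ← Finset.sum_sub_distrib, ← pairing_sub]
  rw [Finset.mul_sum]
  exact (Finset.abs_sum_le_sum_abs _ _).trans
    (Finset.sum_le_sum fun k _ => abs_pairing_le (fun a s => M.ghat_bound i k a s e) _)

lemma Model.abs_slotPenalty_sub_le (M : Model K m S A E) (e : E) (z z' : ∀ k, A k → S k → ℝ) :
    |M.slotPenalty e z - M.slotPenalty e z'| ≤ M.Ψ * totalDist z z' := by
  simp only [Model.slotPenalty, totalDist, ← Finset.sum_sub_distrib, ← pairing_sub]
  rw [Finset.mul_sum]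
  exact (Finset.abs_sum_le_sum_abs _ _).trans
    (Finset.sum_le_sum fun k _ => abs_pairing_le (fun a s => M.fhat_bound k a s e) _)

/-- Young's inequality for a penalty difference. -/
lemma Model.mul_slotPenalty_sub_le (M : Model K m S A E) (e : E) (z z' : ∀ k, A k → S k → ℝ)
    {V c : ℝ} (hV : 0 ≤ V) (hc : 0 < c) :
    V * (M.slotPenalty e z - M.slotPenalty e z') ≤
      c * totalSqDist z z' + V ^ 2 * M.Ψ ^ 2 * totalCard S A / (4 * c) := by
  simp only [Model.slotPenalty, totalSqDist, totalCard, ← Finset.sum_sub_distrib, Finset.mul_sum,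
    ← pairing_sub, Finset.sum_div, ← Finset.sum_add_distrib]
  refine Finset.sum_le_sum fun k _ => ?_
  set D := ∑ a, ∑ s, |(z k - z' k) a s| with hD
  have h1 : V * pairing (fun a s => M.fhat k a s e) (z k - z' k) ≤ V * (M.Ψ * D) :=
    mul_le_mul_of_nonneg_left ((le_abs_self _).trans
      (abs_pairing_le (fun a s => M.fhat_bound k a s e) _)) hV
  refine h1.trans ?_
  have h2 : D ^ 2 ≤ (Fintype.card (A k) * Fintype.card (S k) : ℝ) * sqDist (z k) (z' k) :=
    sq_sum_abs_sub_le _ _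
  set n : ℝ := (Fintype.card (A k) * Fintype.card (S k) : ℝ) with hn
  have hn0 : 0 ≤ n := by positivity
  rcases hn0.eq_or_lt with h0 | hn1
  · have hD0 : D = 0 := by
      rw [← h0, zero_mul] at h2
      exact pow_eq_zero_iff two_ne_zero |>.1 (le_antisymm h2 (sq_nonneg _))
    rw [hD0, ← h0]
    have := mul_nonneg hc.le (sqDist_nonneg (z k) (z' k))
    simpa using this
  · have h3 : D ^ 2 / n ≤ sqDist (z k) (z' k) := by
      rw [div_le_iff₀ hn1]; linarith
    -- Completion of the square. Cauchy–Schwarz has cost a factor `n`, the number of state-action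
    -- pairs of MDP `k`; this is where the total number of pairs enters the regret.
    have h4 : V * (M.Ψ * D) ≤ c * (D ^ 2 / n) + V ^ 2 * M.Ψ ^ 2 * n / (4 * c) := by
      have e : c * (D ^ 2 / n) + V ^ 2 * M.Ψ ^ 2 * n / (4 * c) - V * (M.Ψ * D) =
          (2 * c * D - V * M.Ψ * n) ^ 2 / (4 * c * n) := by
        field_simp
        ring
      have : 0 ≤ (2 * c * D - V * M.Ψ * n) ^ 2 / (4 * c * n) := by positivity
      linarith
    linarith [mul_le_mul_of_nonneg_left h3 hc.le]

end Slot

/-! ### Pathwise estimates for the algorithm -/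

section Run

variable {K m : ℕ} {S A : Fin K → Type*} [∀ k, Fintype (S k)]
  [∀ k, Fintype (A k)] {E : Type*} [MeasurableSpace E] {Ω : Type*}
  {M : Model K m S A E} {V α : ℝ} {ω μ : ℕ → Ω → E} {θ : ℕ → Ω → ∀ k, A k → S k → ℝ}
  {Q : ℕ → Ω → Fin m → ℝ}

namespace Model.IsAlgorithmRun

lemma feasible (h : M.IsAlgorithmRun V α ω μ θ Q) (t : ℕ) (x : Ω) : M.Feasible (θ t x) := by
  intro k
  cases t with
  | succ t => exact h.theta_mem t x k
  | zero =>
    obtain ⟨π, d, hπ, ⟨hd, hd'⟩, hθ⟩ := h.theta_zero k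
    refine ⟨fun a s => ?_, ?_, fun s' => ?_⟩
    · rw [hθ]; exact mul_nonneg (hd.1 s) ((hπ s).1 a)
    · simp only [hθ, ← Finset.mul_sum, (hπ _).2, mul_one, hd.2]
    · simp only [hθ, ← Finset.mul_sum, (hπ _).2, mul_one]
      rw [← congrFun hd' s']
      simp only [Matrix.vecMul, dotProduct, policyMatrix, Finset.mul_sum, mul_assoc]

lemma queue_nonneg (h : M.IsAlgorithmRun V α ω μ θ Q) (t : ℕ) (x : Ω) (i : Fin m) :
    0 ≤ Q t x i := by
  match t with
  | 0 => exact (h.queue_zero x i).ge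
  | 1 => exact (h.queue_one x i).ge
  | t + 2 => rw [h.queue_succ]; exact le_max_right _ _

lemma queue_succ' (h : M.IsAlgorithmRun V α ω μ θ Q) (t : ℕ) (x : Ω) (i : Fin m) :
    Q (t + 2) x i = max (Q (t + 1) x i + M.slotConstraint i (ω t x) (θ (t + 1) x)) 0 :=
  h.queue_succ t x i

lemma abs_queue_sub_le (h : M.IsAlgorithmRun V α ω μ θ Q) (t : ℕ) (x : Ω) (i : Fin m) :
    |Q (t + 2) x i - Q (t + 1) x i| ≤ K * M.Ψ := by
  have h1 := (h.feasible (t + 1) x).abs_slotConstraint_le i (ω t x)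
  have h2 := h.queue_nonneg (t + 1) x i
  rw [h.queue_succ', abs_le] at *
  constructor
  · linarith [le_max_left (Q (t + 1) x i + M.slotConstraint i (ω t x) (θ (t + 1) x)) 0]
  · have : max (Q (t + 1) x i + M.slotConstraint i (ω t x) (θ (t + 1) x)) 0 ≤
        Q (t + 1) x i + K * M.Ψ := max_le (by linarith) (by linarith)
    linarith

/-- Truncation at zero does not increase the square before truncation, and the second-order term is
bounded by `(K Ψ)²` per queue. -/
lemma sum_queue_sq_le (h : M.IsAlgorithmRun V α ω μ θ Q) (t : ℕ) (x : Ω) :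
    ∑ i, Q (t + 2) x i ^ 2 ≤ ∑ i, Q (t + 1) x i ^ 2 +
      2 * ∑ i, Q (t + 1) x i * M.slotConstraint i (ω t x) (θ (t + 1) x) +
      m * (K * M.Ψ) ^ 2 := by
  have e : (m : ℝ) * (K * M.Ψ) ^ 2 = ∑ _i : Fin m, (K * M.Ψ) ^ 2 := by simp
  rw [e, Finset.mul_sum, ← Finset.sum_add_distrib, ← Finset.sum_add_distrib]
  refine Finset.sum_le_sum fun i _ => ?_
  have h1 := (h.feasible (t + 1) x).abs_slotConstraint_le i (ω t x)
  rw [h.queue_succ']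
  set c := M.slotConstraint i (ω t x) (θ (t + 1) x)
  have h2 : c ^ 2 ≤ (K * M.Ψ) ^ 2 := sq_le_sq' (abs_le.1 h1).1 (abs_le.1 h1).2
  have h3 : max (Q (t + 1) x i + c) 0 ^ 2 ≤ (Q (t + 1) x i + c) ^ 2 := by
    rcases max_cases (Q (t + 1) x i + c) 0 with ⟨e, -⟩ | ⟨e, -⟩ <;> rw [e]
    simpa using sq_nonneg (Q (t + 1) x i + c)
  nlinarith

/-- Truncation only raises a queue, so the final queue dominates the accumulated constraint values.
Note the shift: the noise of slot `t` is paired with `θ (t + 1)`. -/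
lemma sum_slotConstraint_le_queue (h : M.IsAlgorithmRun V α ω μ θ Q) (T : ℕ) (x : Ω) (i : Fin m) :
    ∑ t ∈ Finset.range T, M.slotConstraint i (ω t x) (θ (t + 1) x) ≤ Q (T + 1) x i := by
  induction T with
  | zero => simpa using h.queue_nonneg 1 x i
  | succ T ih =>
    rw [Finset.sum_range_succ, h.queue_succ']
    exact le_max_of_le_left (by linarith)

lemma isMinOn (h : M.IsAlgorithmRun V α ω μ θ Q) (t : ℕ) (x : Ω) (k : Fin K) :
    IsMinOn (fun z => pairing (fun a s => V * M.fhat k a s (μ t x) +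
      ∑ i, Q (t + 1) x i * M.ghat i k a s (ω t x)) z + α * sqDist z (θ t x k))
      (stateActionPolyhedron (M.P k)) (θ (t + 1) x k) := h.theta_min t x k

/-- Drift-plus-penalty comparison with an arbitrary feasible point. -/
lemma drift_plus_penalty_le (h : M.IsAlgorithmRun V α ω μ θ Q) (t : ℕ) (x : Ω)
    {z : ∀ k, A k → S k → ℝ} (hz : M.Feasible z) :
    V * M.slotPenalty (μ t x) (θ (t + 1) x) +
        ∑ i, Q (t + 1) x i * M.slotConstraint i (ω t x) (θ (t + 1) x) +
        α * totalSqDist (θ (t + 1) x) (θ t x) + α * totalSqDist z (θ (t + 1) x) ≤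
      V * M.slotPenalty (μ t x) z + ∑ i, Q (t + 1) x i * M.slotConstraint i (ω t x) z +
        α * totalSqDist z (θ t x) := by
  -- The joint objective is the sum of the objectives of the separate subproblems, so the comparison
  -- holds MDP by MDP.
  have e : ∀ y : ∀ k, A k → S k → ℝ, V * M.slotPenalty (μ t x) y +
      ∑ i, Q (t + 1) x i * M.slotConstraint i (ω t x) y =
      ∑ k, pairing (fun a s => V * M.fhat k a s (μ t x) +
        ∑ i, Q (t + 1) x i * M.ghat i k a s (ω t x)) (y k) := fun y => by
    simp only [Model.slotPenalty, Model.slotConstraint, Finset.mul_sum]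
    rw [Finset.sum_comm, ← Finset.sum_add_distrib]
    refine Finset.sum_congr rfl fun k _ => ?_
    simp only [pairing, add_mul, Finset.sum_add_distrib, Finset.mul_sum, Finset.sum_mul, mul_assoc]
    congr 1
    rw [Finset.sum_comm]
    exact Finset.sum_congr rfl fun a _ => Finset.sum_comm
  rw [e, e]
  simp only [totalSqDist, Finset.mul_sum, ← Finset.sum_add_distrib]
  exact Finset.sum_le_sum fun k _ => IsMinOn.add_sqDist_le (convex_stateActionPolyhedron _)
    (h.isMinOn t x k) (h.theta_mem t x k) (hz k)

/-- The coefficients of the linear term are at most `Ψ (V + ∑ Q)`, so the movement per slot is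
controlled by the queues. -/
lemma totalDist_le (h : M.IsAlgorithmRun V α ω μ θ Q) (hα : 0 < α) (hV : 0 ≤ V) (t : ℕ) (x : Ω) :
    2 * α * totalDist (θ (t + 1) x) (θ t x) ≤
      totalCard S A * (M.Ψ * (V + ∑ i, Q (t + 1) x i)) := by
  simp only [totalDist, totalCard]
  rw [Finset.mul_sum, Finset.sum_mul]
  refine Finset.sum_le_sum fun k _ => IsMinOn.sum_abs_sub_le (convex_stateActionPolyhedron _) hα
    (fun a s => ?_) (h.isMinOn t x k) (h.theta_mem t x k) (h.feasible t x k)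
  refine (abs_add_le _ _).trans ?_
  rw [abs_mul, abs_of_nonneg hV, mul_add, mul_comm M.Ψ V, mul_comm M.Ψ, Finset.sum_mul]
  refine add_le_add (mul_le_mul_of_nonneg_left (M.fhat_bound _ _ _ _) hV) ?_
  refine (Finset.abs_sum_le_sum_abs _ _).trans (Finset.sum_le_sum fun i _ => ?_)
  rw [abs_mul, abs_of_nonneg (h.queue_nonneg _ _ _)]
  exact mul_le_mul_of_nonneg_left (M.ghat_bound _ _ _ _ _) (h.queue_nonneg _ _ _)

end Model.IsAlgorithmRun

end Run

/-! ### Measurability of the state-action vectors and queues -/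

section Measurability

variable {K m : ℕ} {S A : Fin K → Type*} [∀ k, Fintype (S k)]
  [∀ k, Fintype (A k)] {E : Type*} [mE : MeasurableSpace E] {Ω : Type*}

/-- The σ-algebra of `ω 0, …, ω (n-1)` and of the whole process `μ`. -/
@[reducible] def sigmaHistory (ω μ : ℕ → Ω → E) (n : ℕ) : MeasurableSpace Ω :=
  (⨆ j, ⨆ _ : j < n, MeasurableSpace.comap (ω j) mE) ⊔ ⨆ t, MeasurableSpace.comap (μ t) mE

variable {ω μ : ℕ → Ω → E}

lemma sigmaHistory_mono : Monotone (sigmaHistory ω μ) := fun _ _ h =>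
  sup_le_sup_right (iSup₂_le fun j hj => le_iSup₂_of_le
    (f := fun j _ => MeasurableSpace.comap (ω j) mE) j (hj.trans_le h) le_rfl) _

lemma sigmaHistory_le_sigmaEnv (n : ℕ) : sigmaHistory ω μ n ≤ sigmaEnv ω μ :=
  sup_le_sup_right (iSup₂_le fun j _ => le_iSup (fun t => MeasurableSpace.comap (ω t) mE) j) _

lemma comap_le_sigmaHistory_left {j n : ℕ} (h : j < n) :
    MeasurableSpace.comap (ω j) mE ≤ sigmaHistory ω μ n :=
  le_sup_of_le_left (le_iSup₂_of_le (f := fun j _ => MeasurableSpace.comap (ω j) mE) j h le_rfl)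

lemma comap_le_sigmaHistory_right (j n : ℕ) :
    MeasurableSpace.comap (μ j) mE ≤ sigmaHistory ω μ n :=
  le_sup_of_le_right (le_iSup (fun t => MeasurableSpace.comap (μ t) mE) j)

variable {M : Model K m S A E} {V α : ℝ} {θ : ℕ → Ω → ∀ k, A k → S k → ℝ}
  {Q : ℕ → Ω → Fin m → ℝ}

omit [∀ k, Fintype (A k)] in
lemma Model.isBddMeasurable_fhat (M : Model K m S A E) (X : Ω → E) (k : Fin K) (a : A k)
    (s : S k) : IsBddMeasurable (MeasurableSpace.comap X mE) fun x => M.fhat k a s (X x) :=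
  ⟨(M.fhat_measurable k a s).comp (comap_measurable X), M.Ψ, fun _ => M.fhat_bound _ _ _ _⟩

omit [∀ k, Fintype (A k)] in
lemma Model.isBddMeasurable_ghat (M : Model K m S A E) (X : Ω → E) (i : Fin m) (k : Fin K)
    (a : A k) (s : S k) :
    IsBddMeasurable (MeasurableSpace.comap X mE) fun x => M.ghat i k a s (X x) :=
  ⟨(M.ghat_measurable i k a s).comp (comap_measurable X), M.Ψ, fun _ => M.ghat_bound _ _ _ _ _⟩

lemma IsBddMeasurable.slotConstraint {mΩ : MeasurableSpace Ω} {X : Ω → E}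
    (hX : MeasurableSpace.comap X mE ≤ mΩ) {z : Ω → ∀ k, A k → S k → ℝ}
    (hz : ∀ k a s, IsBddMeasurable mΩ fun x => z x k a s) (i : Fin m) :
    IsBddMeasurable mΩ fun x => M.slotConstraint i (X x) (z x) :=
  .sum _ fun k _ => .sum _ fun a _ => .sum _ fun s _ =>
    ((M.isBddMeasurable_ghat X i k a s).mono hX).mul (hz k a s)

lemma IsBddMeasurable.slotPenalty {mΩ : MeasurableSpace Ω} {X : Ω → E}
    (hX : MeasurableSpace.comap X mE ≤ mΩ) {z : Ω → ∀ k, A k → S k → ℝ}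
    (hz : ∀ k a s, IsBddMeasurable mΩ fun x => z x k a s) :
    IsBddMeasurable mΩ fun x => M.slotPenalty (X x) (z x) :=
  .sum _ fun k _ => .sum _ fun a _ => .sum _ fun s _ =>
    ((M.isBddMeasurable_fhat X k a s).mono hX).mul (hz k a s)

lemma IsBddMeasurable.totalSqDist {mΩ : MeasurableSpace Ω} {z z' : Ω → ∀ k, A k → S k → ℝ}
    (hz : ∀ k a s, IsBddMeasurable mΩ fun x => z x k a s)
    (hz' : ∀ k a s, IsBddMeasurable mΩ fun x => z' x k a s) :
    IsBddMeasurable mΩ fun x => totalSqDist (z x) (z' x) :=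
  .sum _ fun k _ => .sum _ fun a _ => .sum _ fun s _ => ((hz k a s).sub (hz' k a s)).pow 2

lemma IsBddMeasurable.totalDist {mΩ : MeasurableSpace Ω} {z z' : Ω → ∀ k, A k → S k → ℝ}
    (hz : ∀ k a s, IsBddMeasurable mΩ fun x => z x k a s)
    (hz' : ∀ k a s, IsBddMeasurable mΩ fun x => z' x k a s) :
    IsBddMeasurable mΩ fun x => totalDist (z x) (z' x) :=
  .sum _ fun k _ => .sum _ fun a _ => .sum _ fun s _ => ((hz k a s).sub (hz' k a s)).abs

/-- The run is specified pointwise by minimization, with no measurability assumed. It follows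
because the minimizer is a nonexpansive function of the proximal data. The indices matter: `θ t` and
`Q (t + 1)` do not involve `ω t`. -/
lemma Model.IsAlgorithmRun.isBddMeasurable (h : M.IsAlgorithmRun V α ω μ θ Q) (hα : 0 < α)
    (t : ℕ) : (∀ k a s, IsBddMeasurable (sigmaHistory ω μ t) fun x => θ t x k a s) ∧
      ∀ i, IsBddMeasurable (sigmaHistory ω μ t) fun x => Q (t + 1) x i := by
  induction t with
  | zero =>
    refine ⟨fun k a s => ?_, fun i => ?_⟩
    · obtain ⟨π, d, -, -, hθ⟩ := h.theta_zero k
      simp only [hθ]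
      exact .const _ _
    · simp only [zero_add, h.queue_one]
      exact .const _ _
  | succ t ih =>
    have hω : MeasurableSpace.comap (ω t) mE ≤ sigmaHistory ω μ (t + 1) :=
      comap_le_sigmaHistory_left (Nat.lt_succ_self t)
    have hμ : MeasurableSpace.comap (μ t) mE ≤ sigmaHistory ω μ (t + 1) :=
      comap_le_sigmaHistory_right t (t + 1)
    have hmono := sigmaHistory_mono (ω := ω) (μ := μ) (Nat.le_succ t)
    have hθ : ∀ k a s, IsBddMeasurable (sigmaHistory ω μ (t + 1)) fun x => θ (t + 1) x k a s := by
      intro k a s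
      refine ⟨?_, 1, fun x => ?_⟩
      · have hp : ∀ q : A k × S k, IsBddMeasurable (sigmaHistory ω μ (t + 1)) fun x =>
            θ t x k q.1 q.2 - (1 / (2 * α)) * (V * M.fhat k q.1 q.2 (μ t x) +
              ∑ i, Q (t + 1) x i * M.ghat i k q.1 q.2 (ω t x)) := fun q =>
          ((ih.1 k q.1 q.2).mono hmono).sub (.const_mul _ (.add
            (.const_mul _ ((M.isBddMeasurable_fhat _ _ _ _).mono hμ))
            (.sum _ fun i _ => ((ih.2 i).mono hmono).mul
              ((M.isBddMeasurable_ghat _ _ _ _ _).mono hω))))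
        refine measurable_of_sq_le_sum_sq (fun q => (hp q).1) fun x y => ?_
        have h1 := IsMinOn.sqDist_le (convex_stateActionPolyhedron _) hα (h.isMinOn t x k)
          (h.theta_mem t x k) (h.isMinOn t y k) (h.theta_mem t y k)
        have h2 : (θ (t + 1) x k a s - θ (t + 1) y k a s) ^ 2 ≤
            sqDist (θ (t + 1) x k) (θ (t + 1) y k) := by
          refine le_trans ?_ (Finset.single_le_sum (f := fun a => ∑ s,
            (θ (t + 1) x k a s - θ (t + 1) y k a s) ^ 2)
            (fun a _ => Finset.sum_nonneg fun s _ => sq_nonneg _) (Finset.mem_univ a))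
          exact Finset.single_le_sum (f := fun s => (θ (t + 1) x k a s - θ (t + 1) y k a s) ^ 2)
            (fun s _ => sq_nonneg _) (Finset.mem_univ s)
        refine h2.trans (h1.trans (le_of_eq ?_))
        rw [Fintype.sum_prod_type, sqDist]
        simp only [one_div, inv_mul_eq_div]
      · rw [abs_of_nonneg ((h.feasible _ x k).1 a s)]
        exact stateActionPolyhedron.le_one (h.feasible _ x k) a s
    refine ⟨hθ, fun i => ?_⟩
    simp only [h.queue_succ']
    exact .max_zero (((ih.2 i).mono hmono).add (.slotConstraint hω hθ i))

end Measurability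

/-! ### Independence of the current constraint noise from the history -/

section Independence

/-- Intersections of sets from `m₂` and `m₃` form a π-system generating `m₂ ⊔ m₃`, and on it the two
hypotheses factor the probability. -/
lemma indep_sup_right_of_indep {Ω : Type*} {m₁ m₂ m₃ m₀ : MeasurableSpace Ω} {Pr : Measure Ω}
    [IsProbabilityMeasure Pr] (h₁ : m₁ ≤ m₀) (h₂ : m₂ ≤ m₀) (h₃ : m₃ ≤ m₀)
    (h₁₂ : Indep m₁ m₂ Pr) (h : Indep (m₁ ⊔ m₂) m₃ Pr) : Indep m₁ (m₂ ⊔ m₃) Pr := by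
  let p : Set (Set Ω) := {B | ∃ B₂ B₃, MeasurableSet[m₂] B₂ ∧ MeasurableSet[m₃] B₃ ∧ B = B₂ ∩ B₃}
  have hp : IsPiSystem p := by
    rintro _ ⟨B₂, B₃, hB₂, hB₃, rfl⟩ _ ⟨C₂, C₃, hC₂, hC₃, rfl⟩ -
    exact ⟨B₂ ∩ C₂, B₃ ∩ C₃, hB₂.inter hC₂, hB₃.inter hC₃, Set.inter_inter_inter_comm _ _ _ _⟩
  have hgen : m₂ ⊔ m₃ = MeasurableSpace.generateFrom p := by
    refine le_antisymm (sup_le (fun B hB => ?_) fun B hB => ?_)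
      (MeasurableSpace.generateFrom_le ?_)
    · exact MeasurableSpace.measurableSet_generateFrom
        ⟨B, Set.univ, hB, MeasurableSet.univ, (Set.inter_univ B).symm⟩
    · exact MeasurableSpace.measurableSet_generateFrom
        ⟨Set.univ, B, MeasurableSet.univ, hB, (Set.univ_inter B).symm⟩
    · rintro _ ⟨B₂, B₃, hB₂, hB₃, rfl⟩
      exact MeasurableSet.inter (le_sup_left (a := m₂) (b := m₃) _ hB₂)
        (le_sup_right (a := m₂) (b := m₃) _ hB₃)
  refine IndepSets.indep h₁ (sup_le h₂ h₃) (@MeasurableSpace.isPiSystem_measurableSet Ω m₁) hp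
    (@MeasurableSpace.generateFrom_measurableSet Ω m₁).symm hgen ?_
  rw [IndepSets_iff]
  rintro B _ hB ⟨B₂, B₃, hB₂, hB₃, rfl⟩
  rw [Indep_iff] at h₁₂ h
  have l₁ : m₁ ≤ m₁ ⊔ m₂ := le_sup_left
  have l₂ : m₂ ≤ m₁ ⊔ m₂ := le_sup_right
  rw [← Set.inter_assoc, h _ _ (MeasurableSet.inter (l₁ _ hB) (l₂ _ hB₂)) hB₃, h₁₂ _ _ hB hB₂,
    h _ _ (l₂ _ hB₂) hB₃, mul_assoc]

variable {E : Type*} [mE : MeasurableSpace E] {Ω : Type*} [mΩ : MeasurableSpace Ω]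
  {Pr : Measure Ω} [IsProbabilityMeasure Pr] {ω μ : ℕ → Ω → E}

/-- The constraint noise of slot `n` is independent of the history before slot `n`. -/
lemma IsEnvironment.indep_sigmaHistory (h : IsEnvironment Pr ω μ) (n : ℕ) :
    Indep (MeasurableSpace.comap (ω n) mE) (sigmaHistory ω μ n) Pr := by
  have hω : ∀ t, MeasurableSpace.comap (ω t) mE ≤
      MeasurableSpace.comap (fun x t => ω t x) MeasurableSpace.pi := fun t => by
    rintro _ ⟨B, hB, rfl⟩
    exact ⟨(fun f : ℕ → E => f t) ⁻¹' B, measurable_pi_apply t hB, rfl⟩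
  have hμ : ∀ t, MeasurableSpace.comap (μ t) mE ≤
      MeasurableSpace.comap (fun x t => μ t x) MeasurableSpace.pi := fun t => by
    rintro _ ⟨B, hB, rfl⟩
    exact ⟨(fun f : ℕ → E => f t) ⁻¹' B, measurable_pi_apply t hB, rfl⟩
  -- Two facts are combined: `ω n` is independent of the earlier `ω j`, and all of them together are
  -- independent of the whole process `μ`. Including the future of `μ` is thus free, so `μ` may be
  -- arbitrary.
  refine indep_sup_right_of_indep (h.measurable_ω n).comap_le
    (iSup₂_le fun j _ => (h.measurable_ω j).comap_le)
    (iSup_le fun j => (h.measurable_μ j).comap_le) ?_ ?_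
  · have := indep_iSup_of_disjoint (fun t => (h.measurable_ω t).comap_le) h.indep_ω.iIndep
      (S := {n}) (T := {j | j < n}) (by simp)
    simpa using this
  · exact indep_of_indep_of_le (IndepFun_iff_Indep _ _ _ |>.1 h.indep_ω_μ)
      (sup_le (hω n) (iSup₂_le fun j _ => hω j)) (iSup_le hμ)

lemma IsEnvironment.integral_mul_eq (h : IsEnvironment Pr ω μ) {n : ℕ} {φ ψ : Ω → ℝ}
    (hφ : IsBddMeasurable (sigmaHistory ω μ n) φ)
    (hψ : IsBddMeasurable (MeasurableSpace.comap (ω n) mE) ψ) :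
    ∫ x, φ x * ψ x ∂Pr = (∫ x, φ x ∂Pr) * ∫ x, ψ x ∂Pr := by
  have hind : IndepFun φ ψ Pr := (IndepFun_iff_Indep _ _ _).2
    (indep_of_indep_of_le (h.indep_sigmaHistory n).symm hφ.1.comap_le hψ.1.comap_le)
  exact hind.integral_fun_mul_eq_mul_integral
    (hφ.1.mono ((sigmaHistory_le_sigmaEnv n).trans h.sigmaEnv_le) le_rfl).aestronglyMeasurable
    (hψ.1.mono (h.measurable_ω n).comap_le le_rfl).aestronglyMeasurable

end Independence

/-! ### Squared excess of the root of a potential over a level -/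

section Potential

/-- One step of the squared excess of `√X` over a level `B`. -/
lemma sq_excess_le {X X' B ζ : ℝ} (hX : 0 ≤ X) (hX' : 0 ≤ X') (hB : 0 < B)
    (h : B ≤ max √X √X' → |X' - X| ≤ ζ * (√X + √X')) :
    max (√X' - B) 0 ^ 2 ≤ max (√X - B) 0 ^ 2 + max (√X - B) 0 / √X * (X' - X) + ζ ^ 2 := by
  have eX := Real.mul_self_sqrt hX
  have eX' := Real.mul_self_sqrt hX'
  have hy := Real.sqrt_nonneg X
  have hy' := Real.sqrt_nonneg X'
  set y := √X
  set y' := √X'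
  rcases lt_or_ge (max y y') B with hlt | hge
  · obtain ⟨h1, h2⟩ := max_lt_iff.1 hlt
    rw [max_eq_right (by linarith : y - B ≤ 0), max_eq_right (by linarith : y' - B ≤ 0)]
    simpa using sq_nonneg ζ
  · have hpos : 0 < y + y' := by
      rcases le_max_iff.1 hge with h1 | h1 <;> linarith
    have h1 := h hge
    have e : X' - X = (y' - y) * (y + y') := by rw [← eX, ← eX']; ring
    rw [e, abs_mul, abs_of_pos hpos] at h1
    -- The jump bound on `X` was stated relative to `√X + √X'` precisely to bound the jump of the
    -- square root.
    have h2 : |y' - y| ≤ ζ := le_of_mul_le_mul_right h1 hpos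
    have h3 : (y' - y) ^ 2 ≤ ζ ^ 2 := sq_le_sq' (abs_le.1 h2).1 (abs_le.1 h2).2
    rcases le_or_gt y B with hyB | hyB
    · rw [max_eq_right (by linarith : y - B ≤ 0)]
      have h4 : max (y' - B) 0 ^ 2 ≤ (y' - y) ^ 2 := by
        rcases max_cases (y' - B) 0 with ⟨e, h5⟩ | ⟨e, -⟩ <;> rw [e]
        · exact pow_le_pow_left₀ h5 (by linarith) 2
        · simpa using sq_nonneg (y' - y)
      simp only [zero_div, zero_mul]
      linarith [h4, h3]
    · rw [max_eq_left (by linarith : 0 ≤ y - B)]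
      have h4 : max (y' - B) 0 ^ 2 ≤ (y' - B) ^ 2 := by
        rcases max_cases (y' - B) 0 with ⟨e, -⟩ | ⟨e, -⟩ <;> rw [e]
        simpa using sq_nonneg (y' - B)
      have hy0 : 0 < y := hB.trans hyB
      -- The cross term of `(y' - B)²` is at most the weighted increment of `X`. This puts the
      -- linear drift of `X`, for which conditional information is available, in place of the drift
      -- of `√X`.
      have e2 : (y - B) / y * (X' - X) = 2 * (y - B) * (y' - y) + (y - B) / y * (y' - y) ^ 2 := by
        rw [e]; field_simp; ring
      have h5 : 0 ≤ (y - B) / y * (y' - y) ^ 2 :=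
        mul_nonneg (div_nonneg (by linarith) hy) (sq_nonneg _)
      nlinarith

lemma IsBddMeasurable.excess_weight {Ω : Type*} {m : MeasurableSpace Ω} {Y : Ω → ℝ}
    (hY : IsBddMeasurable m Y) (hY0 : ∀ x, 0 ≤ Y x) {B : ℝ} (hB : 0 ≤ B) :
    IsBddMeasurable m fun x => max (Y x - B) 0 / Y x := by
  refine ⟨(hY.sub (.const m B)).max_zero.1.div hY.1, 1, fun x => ?_⟩
  rw [abs_of_nonneg (div_nonneg (le_max_right _ _) (hY0 x))]
  exact div_le_one_of_le₀ (max_le (by linarith) (hY0 x)) (hY0 x)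

end Potential

/-! ### Drift of the potential -/

section Drift

variable {K m : ℕ} {S A : Fin K → Type*} [∀ k, Fintype (S k)]
  [∀ k, Fintype (A k)] {E : Type*} [mE : MeasurableSpace E] {Ω : Type*}
  {M : Model K m S A E} {V α : ℝ} {ω μ : ℕ → Ω → E} {θ : ℕ → Ω → ∀ k, A k → S k → ℝ}
  {Q : ℕ → Ω → Fin m → ℝ} {z : ∀ k, A k → S k → ℝ}

/-- Squared queue lengths plus the weighted squared distance of the state-action vectors to `z`. -/
def potential (α : ℝ) (θ : ℕ → Ω → ∀ k, A k → S k → ℝ) (Q : ℕ → Ω → Fin m → ℝ)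
    (z : ∀ k, A k → S k → ℝ) (t : ℕ) (x : Ω) : ℝ :=
  ∑ i, Q (t + 1) x i ^ 2 + 2 * α * totalSqDist z (θ t x)

lemma potential_nonneg (hα : 0 ≤ α) (t : ℕ) (x : Ω) : 0 ≤ potential α θ Q z t x :=
  add_nonneg (Finset.sum_nonneg fun _ _ => sq_nonneg _)
    (mul_nonneg (by positivity) (totalSqDist_nonneg _ _))

lemma queue_le_sqrt_potential (hα : 0 ≤ α) (t : ℕ) (x : Ω) (i : Fin m) :
    Q (t + 1) x i ≤ √(potential α θ Q z t x) := by
  refine Real.le_sqrt_of_sq_le (le_add_of_le_of_nonneg ?_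
    (mul_nonneg (by positivity) (totalSqDist_nonneg _ _)))
  exact Finset.single_le_sum (f := fun i => Q (t + 1) x i ^ 2) (fun _ _ => sq_nonneg _)
    (Finset.mem_univ i)

namespace Model.IsAlgorithmRun

lemma isBddMeasurable_potential (h : M.IsAlgorithmRun V α ω μ θ Q) (hα : 0 < α) (t : ℕ) :
    IsBddMeasurable (sigmaHistory ω μ t) (potential α θ Q z t) :=
  .add (.sum _ fun i _ => ((h.isBddMeasurable hα t).2 i).pow 2)
    (.const_mul _ (.totalSqDist (fun _ _ _ => .const _ _) (h.isBddMeasurable hα t).1))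

lemma potential_zero_le (h : M.IsAlgorithmRun V α ω μ θ Q) (hα : 0 ≤ α) (hz : M.Feasible z)
    (x : Ω) : potential α θ Q z 0 x ≤ 4 * K * α := by
  have h1 := hz.totalSqDist_le (h.feasible 0 x)
  simp only [potential, zero_add, h.queue_one]
  have := mul_le_mul_of_nonneg_left h1 (by positivity : 0 ≤ 2 * α)
  simp only [ne_eq, OfNat.ofNat_ne_zero, not_false_eq_true, zero_pow, Finset.sum_const_zero,
    zero_add]
  linarith

/-- For queue control the penalties are simply bounded by `K Ψ` and the proximal term `‖θ (t+1) - θ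
t‖²` is dropped. -/
lemma potential_succ_le (h : M.IsAlgorithmRun V α ω μ θ Q) (hα : 0 ≤ α) (hV : 0 ≤ V)
    (hz : M.Feasible z) (t : ℕ) (x : Ω) :
    potential α θ Q z (t + 1) x - potential α θ Q z t x ≤
      2 * ∑ i, Q (t + 1) x i * M.slotConstraint i (ω t x) z +
        (4 * V * (K * M.Ψ) + m * (K * M.Ψ) ^ 2) := by
  have h1 := h.sum_queue_sq_le t x
  have h2 := h.drift_plus_penalty_le t x hz
  have h3 := (abs_le.1 ((h.feasible (t + 1) x).abs_slotPenalty_le (μ t x))).1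
  have h4 := (abs_le.1 (hz.abs_slotPenalty_le (μ t x))).2
  have h5 := mul_nonneg hα (totalSqDist_nonneg (θ (t + 1) x) (θ t x))
  have h6 := mul_le_mul_of_nonneg_left h3 hV
  have h7 := mul_le_mul_of_nonneg_left h4 hV
  simp only [potential]
  linarith

/-- The comparison concerns `θ (t + 1)`, chosen after `μ t` is seen, whereas regret concerns `θ t`.
By Young's inequality the proximal term, now kept, pays exactly for this exchange. -/
lemma regret_le (h : M.IsAlgorithmRun V α ω μ θ Q) (hα : 0 < α) (hV : 0 ≤ V)
    (hz : M.Feasible z) (t : ℕ) (x : Ω) :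
    2 * V * (M.slotPenalty (μ t x) (θ t x) - M.slotPenalty (μ t x) z) ≤
      potential α θ Q z t x - potential α θ Q z (t + 1) x +
        2 * ∑ i, Q (t + 1) x i * M.slotConstraint i (ω t x) z +
        (m * (K * M.Ψ) ^ 2 + V ^ 2 * M.Ψ ^ 2 * totalCard S A / (2 * α)) := by
  have h1 := h.sum_queue_sq_le t x
  have h2 := h.drift_plus_penalty_le t x hz
  have h3 := M.mul_slotPenalty_sub_le (μ t x) (θ t x) (θ (t + 1) x) hV hα
  have e1 : totalSqDist (θ t x) (θ (t + 1) x) = totalSqDist (θ (t + 1) x) (θ t x) := by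
    simp only [totalSqDist, sqDist_comm]
  have e2 : V ^ 2 * M.Ψ ^ 2 * totalCard S A / (2 * α) =
      2 * (V ^ 2 * M.Ψ ^ 2 * totalCard S A / (4 * α)) := by
    field_simp; ring
  rw [e1] at h3
  rw [e2]
  simp only [potential]
  linarith

/-- Queue squares change by a bounded step times a sum of queues, and the distance term changes by
at most a multiple of `V + ∑ Q`. Queues are dominated by the root of the potential, and the
assumption on `V` absorbs the remaining term; `α` cancels against the step length `1/α`. -/
lemma abs_potential_sub_le (h : M.IsAlgorithmRun V α ω μ θ Q) (hα : 0 < α) (hV : 0 ≤ V)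
    (hz : M.Feasible z) (t : ℕ) (x : Ω)
    (hVy : V ≤ √(potential α θ Q z t x) + √(potential α θ Q z (t + 1) x)) :
    |potential α θ Q z (t + 1) x - potential α θ Q z t x| ≤
      (m * (K * M.Ψ) + 2 * totalCard S A * M.Ψ * (1 + m)) *
        (√(potential α θ Q z t x) + √(potential α θ Q z (t + 1) x)) := by
  have hq : ∀ t i, Q (t + 1) x i ≤ √(potential α θ Q z t x) := fun t i =>
    queue_le_sqrt_potential hα.le t x i
  have h1 : |totalSqDist z (θ (t + 1) x) - totalSqDist z (θ t x)| ≤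
      2 * totalDist (θ (t + 1) x) (θ t x) :=
    hz.abs_totalSqDist_sub_le (h.feasible (t + 1) x) (h.feasible t x)
  have h2 := h.totalDist_le hα hV t x
  have hN : 0 ≤ totalCard S A := Finset.sum_nonneg fun k _ => by positivity
  have hq1 := hq t
  have hq2 := hq (t + 1)
  simp only [potential] at hVy hq1 hq2 ⊢
  set y := √(∑ i, Q (t + 1) x i ^ 2 + 2 * α * totalSqDist z (θ t x))
  set y' := √(∑ i, Q (t + 1 + 1) x i ^ 2 + 2 * α * totalSqDist z (θ (t + 1) x))
  have hy : 0 ≤ y := Real.sqrt_nonneg _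
  have hy' : 0 ≤ y' := Real.sqrt_nonneg _
  have hΨ := M.Ψ_pos
  have h3 : |∑ i, Q (t + 1 + 1) x i ^ 2 - ∑ i, Q (t + 1) x i ^ 2| ≤ m * (K * M.Ψ * (y + y')) := by
    rw [← Finset.sum_sub_distrib]
    refine (Finset.abs_sum_le_sum_abs _ _).trans
      ((Finset.sum_le_sum (g := fun _ => K * M.Ψ * (y + y')) fun i _ => ?_).trans (by simp))
    have e : Q (t + 1 + 1) x i ^ 2 - Q (t + 1) x i ^ 2 =
        (Q (t + 2) x i - Q (t + 1) x i) * (Q (t + 1) x i + Q (t + 2) x i) := by ring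
    rw [e, abs_mul, abs_of_nonneg (add_nonneg (h.queue_nonneg _ x i) (h.queue_nonneg _ x i))]
    exact mul_le_mul (h.abs_queue_sub_le t x i) (add_le_add (hq1 i) (hq2 i))
      (add_nonneg (h.queue_nonneg _ x i) (h.queue_nonneg _ x i)) (by positivity)
  have h4 : ∑ i, Q (t + 1) x i ≤ m * (y + y') := by
    refine (Finset.sum_le_sum (g := fun _ => y + y') fun i _ => ?_).trans (by simp [mul_add])
    linarith [hq1 i]
  have h5 : totalCard S A * (M.Ψ * (V + ∑ i, Q (t + 1) x i)) ≤
      totalCard S A * (M.Ψ * ((1 + m) * (y + y'))) := by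
    refine mul_le_mul_of_nonneg_left (mul_le_mul_of_nonneg_left ?_ hΨ.le) hN
    linarith
  have h6 : |2 * α * (totalSqDist z (θ (t + 1) x) - totalSqDist z (θ t x))| ≤
      2 * (totalCard S A * (M.Ψ * ((1 + m) * (y + y')))) := by
    rw [abs_mul, abs_of_pos (by positivity)]
    have := mul_le_mul_of_nonneg_left h1 (by positivity : 0 ≤ 2 * α)
    linarith
  calc _ = |(∑ i, Q (t + 1 + 1) x i ^ 2 - ∑ i, Q (t + 1) x i ^ 2) +
        2 * α * (totalSqDist z (θ (t + 1) x) - totalSqDist z (θ t x))| := by congr 1; ring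
    _ ≤ _ := (abs_add_le _ _).trans (add_le_add h3 h6)
    _ = _ := by ring

variable [mΩ : MeasurableSpace Ω] {Pr : Measure Ω} [IsProbabilityMeasure Pr]

/-- The queue-weighted constraint values of a fixed feasible point have the expectation predicted
by independence. -/
lemma integral_mul_sum_queue_le (h : M.IsAlgorithmRun V α ω μ θ Q) (hα : 0 < α)
    (henv : IsEnvironment Pr ω μ) {η : ℝ} (t : ℕ)
    (hη : ∀ i, ∫ x, M.slotConstraint i (ω t x) z ∂Pr ≤ -η) {w : Ω → ℝ}
    (hw : IsBddMeasurable (sigmaHistory ω μ t) w) (hw0 : ∀ x, 0 ≤ w x) :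
    ∫ x, w x * ∑ i, Q (t + 1) x i * M.slotConstraint i (ω t x) z ∂Pr ≤
      -η * ∫ x, w x * ∑ i, Q (t + 1) x i ∂Pr := by
  have hle := (sigmaHistory_le_sigmaEnv t).trans henv.sigmaEnv_le
  have hwq := fun i => hw.mul ((h.isBddMeasurable hα t).2 i)
  have hc : ∀ i, IsBddMeasurable (MeasurableSpace.comap (ω t) mE)
      fun x => M.slotConstraint i (ω t x) z :=
    fun i => .slotConstraint (X := ω t) (z := fun _ => z) le_rfl (fun _ _ _ => .const _ _) i
  simp only [Finset.mul_sum, ← mul_assoc]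
  rw [integral_finsetSum _ fun i _ => (((hwq i).mono hle).mul
    ((hc i).mono (henv.measurable_ω t).comap_le)).integrable Pr,
    integral_finsetSum _ fun i _ => ((hwq i).mono hle).integrable Pr, Finset.mul_sum]
  refine Finset.sum_le_sum fun i _ => ?_
  -- The factor `w * Q` belongs to the history before slot `t` and the constraint value of the fixed
  -- `z` to slot `t`, so the expectation factors.
  rw [henv.integral_mul_eq (hwq i) (hc i), mul_comm]
  exact mul_le_mul_of_nonneg_right (hη i)
    (integral_nonneg fun x => mul_nonneg (hw0 x) (h.queue_nonneg _ x i))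

/-- The conditional drift inequality, tested against nonnegative weights from the history. It is
needed with `w = 1` for average queues and with the relative excess of `√X` over a level for the
final queue. -/
lemma integral_mul_potential_sub_le (h : M.IsAlgorithmRun V α ω μ θ Q) (hα : 0 < α) (hV : 0 ≤ V)
    (hz : M.Feasible z) (henv : IsEnvironment Pr ω μ) {η : ℝ} (t : ℕ)
    (hη : ∀ i, ∫ x, M.slotConstraint i (ω t x) z ∂Pr ≤ -η) {w : Ω → ℝ}
    (hw : IsBddMeasurable (sigmaHistory ω μ t) w) (hw0 : ∀ x, 0 ≤ w x) :
    ∫ x, w x * (potential α θ Q z (t + 1) x - potential α θ Q z t x) ∂Pr ≤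
      ∫ x, w x * ((4 * V * (K * M.Ψ) + m * (K * M.Ψ) ^ 2) - 2 * η * ∑ i, Q (t + 1) x i) ∂Pr := by
  have hle := fun t => (sigmaHistory_le_sigmaEnv (ω := ω) (μ := μ) t).trans henv.sigmaEnv_le
  have hw' := hw.mono (hle t)
  have hq := fun i => ((h.isBddMeasurable hα t).2 i).mono (hle t)
  have hc : ∀ i, IsBddMeasurable mΩ fun x => M.slotConstraint i (ω t x) z :=
    fun i => .slotConstraint (X := ω t) (z := fun _ => z) (henv.measurable_ω t).comap_le
      (fun _ _ _ => .const _ _) i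
  have hX := fun t => (h.isBddMeasurable_potential (z := z) hα t).mono (hle t)
  set c₀ := 4 * V * (K * M.Ψ) + m * (K * M.Ψ) ^ 2
  have h1 := h.integral_mul_sum_queue_le hα henv t hη hw hw0
  have hi1 : IsBddMeasurable mΩ fun x =>
      w x * ∑ i, Q (t + 1) x i * M.slotConstraint i (ω t x) z :=
    hw'.mul (.sum _ fun i _ => (hq i).mul (hc i))
  have hi2 : IsBddMeasurable mΩ fun x => w x * ∑ i, Q (t + 1) x i :=
    hw'.mul (.sum _ fun i _ => hq i)
  calc _ ≤ ∫ x, (2 * (w x * ∑ i, Q (t + 1) x i * M.slotConstraint i (ω t x) z) + c₀ * w x) ∂Pr := by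
        refine integral_mono ((hw'.mul ((hX _).sub (hX _))).integrable Pr)
          (((hi1.const_mul 2).add (hw'.const_mul c₀)).integrable Pr) fun x => ?_
        have := mul_le_mul_of_nonneg_left (h.potential_succ_le hα.le hV hz t x) (hw0 x)
        simp only
        linarith
    _ = 2 * ∫ x, w x * ∑ i, Q (t + 1) x i * M.slotConstraint i (ω t x) z ∂Pr +
        c₀ * ∫ x, w x ∂Pr := by
        rw [integral_add ((hi1.const_mul 2).integrable Pr) ((hw'.const_mul c₀).integrable Pr),
          integral_const_mul, integral_const_mul]
    _ ≤ c₀ * ∫ x, w x ∂Pr - 2 * η * ∫ x, w x * ∑ i, Q (t + 1) x i ∂Pr := by linarith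
    _ = ∫ x, (c₀ * w x - 2 * η * (w x * ∑ i, Q (t + 1) x i)) ∂Pr := by
        rw [integral_sub ((hw'.const_mul c₀).integrable Pr) ((hi2.const_mul _).integrable Pr),
          integral_const_mul, integral_const_mul]
    _ = _ := integral_congr_ae (Filter.Eventually.of_forall fun x => by simp only; ring)

/-- Time average of the expected queue lengths under Slater's condition. -/
lemma sum_integral_queue_le (h : M.IsAlgorithmRun V α ω μ θ Q) (hα : 0 < α) (hV : 0 ≤ V)
    (hz : M.Feasible z) (henv : IsEnvironment Pr ω μ) {η : ℝ}
    (hη : ∀ t i, ∫ x, M.slotConstraint i (ω t x) z ∂Pr ≤ -η) (T : ℕ) :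
    2 * η * ∑ t ∈ Finset.range T, ∫ x, ∑ i, Q (t + 1) x i ∂Pr ≤
      4 * K * α + T * (4 * V * (K * M.Ψ) + m * (K * M.Ψ) ^ 2) := by
  have hle := fun t => (sigmaHistory_le_sigmaEnv (ω := ω) (μ := μ) t).trans henv.sigmaEnv_le
  have hX := fun t => (h.isBddMeasurable_potential (z := z) hα t).mono (hle t)
  have hq : ∀ t, IsBddMeasurable mΩ fun x => ∑ i, Q (t + 1) x i := fun t =>
    .sum _ fun i _ => ((h.isBddMeasurable hα t).2 i).mono (hle t)
  set c₀ := 4 * V * (K * M.Ψ) + m * (K * M.Ψ) ^ 2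
  have step : ∀ t, ∫ x, potential α θ Q z (t + 1) x ∂Pr - ∫ x, potential α θ Q z t x ∂Pr ≤
      c₀ - 2 * η * ∫ x, ∑ i, Q (t + 1) x i ∂Pr := fun t => by
    have := h.integral_mul_potential_sub_le hα hV hz henv t (hη t) (.const _ 1)
      (fun _ => zero_le_one)
    simp only [one_mul] at this
    rw [integral_sub ((hX _).integrable Pr) ((hX _).integrable Pr),
      integral_sub (integrable_const _) (((hq t).const_mul _).integrable Pr),
      integral_const_mul] at this
    simpa using this
  have hsum : ∫ x, potential α θ Q z T x ∂Pr - ∫ x, potential α θ Q z 0 x ∂Pr ≤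
      T * c₀ - 2 * η * ∑ t ∈ Finset.range T, ∫ x, ∑ i, Q (t + 1) x i ∂Pr := by
    rw [← Finset.sum_range_sub (fun t => ∫ x, potential α θ Q z t x ∂Pr), Finset.mul_sum]
    refine (Finset.sum_le_sum fun t _ => step t).trans (le_of_eq ?_)
    rw [Finset.sum_sub_distrib]
    simp
  have h0 : ∫ x, potential α θ Q z 0 x ∂Pr ≤ 4 * K * α := by
    refine (integral_mono ((hX 0).integrable Pr) (integrable_const (4 * K * α)) fun x =>
      h.potential_zero_le hα.le hz x).trans (by simp)
  have hT : 0 ≤ ∫ x, potential α θ Q z T x ∂Pr :=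
    integral_nonneg fun x => potential_nonneg hα.le T x
  linarith

/-- Only time-averaged queues enter the total movement, so no uniform bound on the queues is needed
for tracking. -/
lemma sum_integral_totalDist_le (h : M.IsAlgorithmRun V α ω μ θ Q) (hα : 0 < α) (hV : 0 ≤ V)
    (henv : IsEnvironment Pr ω μ) (T : ℕ) :
    2 * α * ∑ t ∈ Finset.range T, ∫ x, totalDist (θ (t + 1) x) (θ t x) ∂Pr ≤
      totalCard S A * (M.Ψ * (T * V + ∑ t ∈ Finset.range T, ∫ x, ∑ i, Q (t + 1) x i ∂Pr)) := by
  have hle := fun t => (sigmaHistory_le_sigmaEnv (ω := ω) (μ := μ) t).trans henv.sigmaEnv_le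
  have hq : ∀ t, IsBddMeasurable mΩ fun x => ∑ i, Q (t + 1) x i := fun t =>
    .sum _ fun i _ => ((h.isBddMeasurable hα t).2 i).mono (hle t)
  have hθ := fun t k a s => ((h.isBddMeasurable hα t).1 k a s).mono (hle t)
  have step : ∀ t, 2 * α * ∫ x, totalDist (θ (t + 1) x) (θ t x) ∂Pr ≤
      totalCard S A * (M.Ψ * (V + ∫ x, ∑ i, Q (t + 1) x i ∂Pr)) := fun t => by
    have e : totalCard S A * (M.Ψ * (V + ∫ x, ∑ i, Q (t + 1) x i ∂Pr)) =
        ∫ x, totalCard S A * (M.Ψ * (V + ∑ i, Q (t + 1) x i)) ∂Pr := by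
      rw [integral_const_mul, integral_const_mul,
        integral_add (integrable_const _) ((hq t).integrable Pr)]
      simp
    rw [e, ← integral_const_mul]
    exact integral_mono
      (((IsBddMeasurable.totalDist (hθ (t + 1)) (hθ t)).const_mul _).integrable Pr)
      ((((IsBddMeasurable.const _ V).add (hq t)).const_mul _).const_mul _ |>.integrable Pr)
      fun x => h.totalDist_le hα hV t x
  rw [Finset.mul_sum]
  refine (Finset.sum_le_sum fun t _ => step t).trans (le_of_eq ?_)
  rw [← Finset.mul_sum, ← Finset.mul_sum, Finset.sum_add_distrib]
  simp

end Model.IsAlgorithmRun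

end Drift

/-! ### Expected regret and expected final queue -/

section Expectation

variable {K m : ℕ} {S A : Fin K → Type*} [∀ k, Fintype (S k)]
  [∀ k, Fintype (A k)] {E : Type*} [mE : MeasurableSpace E] {Ω : Type*}
  {M : Model K m S A E} {V α : ℝ} {ω μ : ℕ → Ω → E} {θ : ℕ → Ω → ∀ k, A k → S k → ℝ}
  {Q : ℕ → Ω → Fin m → ℝ} {z : ∀ k, A k → S k → ℝ}
  [mΩ : MeasurableSpace Ω] {Pr : Measure Ω} [IsProbabilityMeasure Pr]

namespace Model.IsAlgorithmRun

/-- Regret of the state-action vectors against a fixed feasible point that satisfies the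
constraints on average. -/
lemma sum_integral_regret_le (h : M.IsAlgorithmRun V α ω μ θ Q) (hα : 0 < α) (hV : 0 ≤ V)
    (hz : M.Feasible z) (henv : IsEnvironment Pr ω μ)
    (hz0 : ∀ t i, ∫ x, M.slotConstraint i (ω t x) z ∂Pr ≤ 0) (T : ℕ) :
    2 * V * ∑ t ∈ Finset.range T,
        ∫ x, (M.slotPenalty (μ t x) (θ t x) - M.slotPenalty (μ t x) z) ∂Pr ≤
      4 * K * α + T * (m * (K * M.Ψ) ^ 2 + V ^ 2 * M.Ψ ^ 2 * totalCard S A / (2 * α)) := by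
  have hle := fun t => (sigmaHistory_le_sigmaEnv (ω := ω) (μ := μ) t).trans henv.sigmaEnv_le
  have hX := fun t => (h.isBddMeasurable_potential (z := z) hα t).mono (hle t)
  have hθ := fun t k a s => ((h.isBddMeasurable hα t).1 k a s).mono (hle t)
  have hq := fun t i => ((h.isBddMeasurable hα t).2 i).mono (hle t)
  have hc : ∀ t i, IsBddMeasurable mΩ fun x => M.slotConstraint i (ω t x) z :=
    fun t i => .slotConstraint (X := ω t) (z := fun _ => z) (henv.measurable_ω t).comap_le
      (fun _ _ _ => .const _ _) i
  have hp : ∀ t, IsBddMeasurable mΩ fun x =>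
      M.slotPenalty (μ t x) (θ t x) - M.slotPenalty (μ t x) z := fun t =>
    (IsBddMeasurable.slotPenalty (M := M) (X := μ t) (henv.measurable_μ t).comap_le (hθ t)).sub
      (.slotPenalty (X := μ t) (z := fun _ => z) (henv.measurable_μ t).comap_le
        (fun _ _ _ => .const _ _))
  have hs : ∀ t, IsBddMeasurable mΩ fun x =>
      ∑ i, Q (t + 1) x i * M.slotConstraint i (ω t x) z := fun t =>
    .sum _ fun i _ => (hq t i).mul (hc t i)
  set c₀ := m * (K * M.Ψ) ^ 2 + V ^ 2 * M.Ψ ^ 2 * totalCard S A / (2 * α)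
  have step : ∀ t, 2 * V * ∫ x, (M.slotPenalty (μ t x) (θ t x) - M.slotPenalty (μ t x) z) ∂Pr ≤
      c₀ - (∫ x, potential α θ Q z (t + 1) x ∂Pr - ∫ x, potential α θ Q z t x ∂Pr) := fun t => by
    have h1 := h.integral_mul_sum_queue_le (η := 0) hα henv t (by simpa using hz0 t)
      (.const _ 1) (fun _ => zero_le_one)
    simp only [one_mul, neg_zero, zero_mul] at h1
    rw [← integral_const_mul]
    refine (integral_mono (((hp t).const_mul _).integrable Pr)
      (((((hX t).sub (hX (t + 1))).add ((hs t).const_mul 2)).add (.const _ c₀)).integrable Pr)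
      fun x => h.regret_le hα hV hz t x).trans ?_
    rw [integral_add ((((hX t).sub (hX (t + 1))).add ((hs t).const_mul 2)).integrable Pr)
        (integrable_const _),
      integral_add (((hX t).sub (hX (t + 1))).integrable Pr) (((hs t).const_mul 2).integrable Pr),
      integral_sub ((hX t).integrable Pr) ((hX (t + 1)).integrable Pr), integral_const_mul]
    simp only [integral_const, probReal_univ, one_smul]
    linarith
  have h0 : ∫ x, potential α θ Q z 0 x ∂Pr ≤ 4 * K * α := by
    refine (integral_mono ((hX 0).integrable Pr) (integrable_const (4 * K * α)) fun x =>
      h.potential_zero_le hα.le hz x).trans (by simp)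
  have hT : 0 ≤ ∫ x, potential α θ Q z T x ∂Pr :=
    integral_nonneg fun x => potential_nonneg hα.le T x
  rw [Finset.mul_sum]
  refine (Finset.sum_le_sum fun t _ => step t).trans ?_
  rw [Finset.sum_sub_distrib, Finset.sum_range_sub (fun t => ∫ x, potential α θ Q z t x ∂Pr)]
  simp only [Finset.sum_const, Finset.card_range, nsmul_eq_mul]
  linarith

/-- Expected queue length at the end of the horizon under Slater's condition. -/
lemma integral_queue_le {T : ℕ} (h : M.IsAlgorithmRun √T T ω μ θ Q) (hT : 1 ≤ T) (hK : 1 ≤ K)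
    (hm : 1 ≤ m) (hz : M.Feasible z) (henv : IsEnvironment Pr ω μ) {η : ℝ} (hη0 : 0 < η)
    (hη : ∀ t i, ∫ x, M.slotConstraint i (ω t x) z ∂Pr ≤ -η) (i : Fin m) :
    ∫ x, Q (T + 1) x i ∂Pr ≤
      √T * ((4 * (K * M.Ψ) + m * (K * M.Ψ) ^ 2) / (2 * η) + 2 * K) +
        (m * (K * M.Ψ) + 2 * totalCard S A * M.Ψ * (1 + m)) * √T := by
  have hle := fun t => (sigmaHistory_le_sigmaEnv (ω := ω) (μ := μ) t).trans henv.sigmaEnv_le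
  have hΨ := M.Ψ_pos
  have hK1 : (1 : ℝ) ≤ K := by exact_mod_cast hK
  have hm1 : (1 : ℝ) ≤ m := by exact_mod_cast hm
  have hT1 : (1 : ℝ) ≤ T := by exact_mod_cast hT
  have hT0 : (0 : ℝ) < T := by linarith
  have hV1 : 1 ≤ √(T : ℝ) := Real.one_le_sqrt.2 hT1
  have hVsq : √(T : ℝ) ^ 2 = T := Real.sq_sqrt hT0.le
  have hN : 0 ≤ totalCard S A := Finset.sum_nonneg fun k _ => by positivity
  set c₁ := 4 * (K * M.Ψ) + m * (K * M.Ψ) ^ 2 with hc₁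
  set b₀ := c₁ / (2 * η) with hb₀
  have hb0 : 0 ≤ b₀ := by positivity
  have hb1 : 2 * η * b₀ = c₁ := by rw [hb₀]; field_simp
  -- The part `b₀` makes the Slater drift outweigh the constant terms, and `2 K` accounts for the
  -- distance term `4 K T` of the potential. The level also dominates `V = √T` and the root of the
  -- initial potential.
  set B := √(T : ℝ) * (b₀ + 2 * K) with hB
  have hVB : √(T : ℝ) ≤ B := le_mul_of_one_le_right (by linarith) (by linarith)
  have hB0 : 0 < B := by linarith
  have hBsq : T * b₀ ^ 2 + 4 * K * T ≤ B ^ 2 := by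
    rw [hB, mul_pow, hVsq]
    nlinarith [mul_nonneg hT0.le (mul_nonneg hb0 (by linarith : (0 : ℝ) ≤ K)),
      mul_nonneg hT0.le (mul_nonneg (by linarith : (0 : ℝ) ≤ K) (by linarith : (0 : ℝ) ≤ K - 1))]
  set ζ := m * (K * M.Ψ) + 2 * totalCard S A * M.Ψ * (1 + m) with hζ
  have hζ0 : 0 < ζ := by positivity
  set X := potential (T : ℝ) θ Q z with hXdef
  have hX0 : ∀ t x, 0 ≤ X t x := fun t x => potential_nonneg hT0.le t x
  have hXm : ∀ t, IsBddMeasurable (sigmaHistory ω μ t) (X t) :=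
    fun t => h.isBddMeasurable_potential hT0 t
  have hXm' := fun t => (hXm t).mono (hle t)
  have hZm : ∀ t, IsBddMeasurable mΩ fun x => max (√(X t x) - B) 0 :=
    fun t => ((hXm' t).sqrt.sub (.const _ B)).max_zero
  have hwm : ∀ t, IsBddMeasurable (sigmaHistory ω μ t)
      fun x => max (√(X t x) - B) 0 / √(X t x) :=
    fun t => (hXm t).sqrt.excess_weight (fun x => Real.sqrt_nonneg _) hB0.le
  have hw0 : ∀ t x, 0 ≤ max (√(X t x) - B) 0 / √(X t x) := fun t x =>
    div_nonneg (le_max_right _ _) (Real.sqrt_nonneg _)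
  have hdrift : ∀ t x, max (√(X t x) - B) 0 / √(X t x) *
      ((4 * √(T : ℝ) * (K * M.Ψ) + m * (K * M.Ψ) ^ 2) - 2 * η * ∑ i, Q (t + 1) x i) ≤ 0 := by
    intro t x
    rcases le_or_gt (√(X t x)) B with hyB | hyB
    · rw [max_eq_right (by linarith), zero_div, zero_mul]
    · refine mul_nonpos_of_nonneg_of_nonpos (hw0 t x) ?_
      -- Above level `B` the distance part explains at most `4 K T` of the potential, so the queues
      -- themselves must be large.
      have h1 : √(T : ℝ) * b₀ ≤ ∑ i, Q (t + 1) x i := by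
        by_contra! hcon
        refine absurd (Real.sqrt_le_iff.2 ⟨hB0.le, ?_⟩) (not_le.2 hyB)
        have h2 : ∑ i, Q (t + 1) x i ^ 2 ≤ (∑ i, Q (t + 1) x i) ^ 2 :=
          Finset.sum_sq_le_sq_sum_of_nonneg fun i _ => h.queue_nonneg _ x i
        have h3 : (∑ i, Q (t + 1) x i) ^ 2 ≤ (√(T : ℝ) * b₀) ^ 2 :=
          pow_le_pow_left₀ (Finset.sum_nonneg fun i _ => h.queue_nonneg _ x i) hcon.le 2
        rw [mul_pow, hVsq] at h3
        have h4 := mul_le_mul_of_nonneg_left (hz.totalSqDist_le (h.feasible t x))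
          (by positivity : (0 : ℝ) ≤ 2 * T)
        simp only [hXdef, potential]
        linarith
      have h5 := mul_le_mul_of_nonneg_left h1 (by positivity : 0 ≤ 2 * η)
      have h6 : 2 * η * (√(T : ℝ) * b₀) = √(T : ℝ) * c₁ := by rw [← hb1]; ring
      have h7 : m * (K * M.Ψ) ^ 2 ≤ √(T : ℝ) * (m * (K * M.Ψ) ^ 2) :=
        le_mul_of_one_le_left (by positivity) hV1
      rw [h6, hc₁, mul_add] at h5
      linarith
  -- The weight vanishes below `B` and the drift bound is nonpositive above it, so only the squared
  -- jump size `ζ ^ 2` remains.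
  have step : ∀ t, ∫ x, max (√(X (t + 1) x) - B) 0 ^ 2 ∂Pr ≤
      ∫ x, max (√(X t x) - B) 0 ^ 2 ∂Pr + ζ ^ 2 := fun t => by
    have hwX := ((hwm t).mono (hle t)).mul ((hXm' (t + 1)).sub (hXm' t))
    refine (integral_mono (((hZm (t + 1)).pow 2).integrable Pr)
      (((((hZm t).pow 2).add hwX).add (.const _ (ζ ^ 2))).integrable Pr) fun x =>
        sq_excess_le (hX0 t x) (hX0 (t + 1) x) hB0 fun hmax => ?_).trans ?_
    · refine h.abs_potential_sub_le hT0 (by linarith) hz t x ?_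
      have h1 := Real.sqrt_nonneg (X t x)
      have h2 := Real.sqrt_nonneg (X (t + 1) x)
      have := max_le_add_of_nonneg h1 h2
      linarith
    · rw [integral_add ((((hZm t).pow 2).add hwX).integrable Pr) (integrable_const _),
        integral_add (((hZm t).pow 2).integrable Pr) (hwX.integrable Pr)]
      have h1 := (h.integral_mul_potential_sub_le hT0 (by linarith) hz henv t (hη t) (hwm t)
        (hw0 t)).trans (integral_nonpos (hdrift t))
      simp only [integral_const, probReal_univ, one_smul]
      linarith
  have hzero : ∀ x, max (√(X 0 x) - B) 0 = 0 := fun x => by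
    refine max_eq_right (sub_nonpos.2 (Real.sqrt_le_iff.2 ⟨hB0.le, ?_⟩))
    have := h.potential_zero_le hT0.le hz x
    have h2 : 0 ≤ T * b₀ ^ 2 := by positivity
    exact this.trans (by linarith)
  have hsq : ∀ t : ℕ, ∫ x, max (√(X t x) - B) 0 ^ 2 ∂Pr ≤ t * ζ ^ 2 := fun t => by
    induction t with
    | zero => simp [hzero]
    | succ t ih =>
      push_cast
      linarith [step t]
  -- Young's inequality with parameter `ζ √T`, chosen because the expected squared excess is at most
  -- `T ζ²`; both halves then contribute `ζ √T / 2`.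
  have hpt : ∀ x, Q (T + 1) x i ≤
      B + ζ * √T / 2 + 1 / (2 * (ζ * √T)) * max (√(X T x) - B) 0 ^ 2 := fun x => by
    have h1 : Q (T + 1) x i ≤ √(X T x) := queue_le_sqrt_potential hT0.le T x i
    have h2 := le_max_left (√(X T x) - B) 0
    set Z := max (√(X T x) - B) 0
    have hpos : 0 < ζ * √T := by positivity
    have h3 : ζ * √T / 2 + 1 / (2 * (ζ * √T)) * Z ^ 2 - Z =
        (ζ * √T - Z) ^ 2 / (2 * (ζ * √T)) := by
      field_simp
      ring
    have h4 : 0 ≤ (ζ * √T - Z) ^ 2 / (2 * (ζ * √T)) := by positivity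
    linarith
  refine (integral_mono ((((h.isBddMeasurable hT0 T).2 i).mono (hle T)).integrable Pr)
    (((IsBddMeasurable.const _ (B + ζ * √T / 2)).add
      (((hZm T).pow 2).const_mul (1 / (2 * (ζ * √T))))).integrable Pr) hpt).trans ?_
  rw [integral_add (integrable_const _) ((((hZm T).pow 2).const_mul _).integrable Pr),
    integral_const_mul]
  have hfin : 1 / (2 * (ζ * √T)) * ∫ x, max (√(X T x) - B) 0 ^ 2 ∂Pr ≤ ζ * √T / 2 := by
    refine (mul_le_mul_of_nonneg_left (hsq T) (by positivity)).trans (le_of_eq ?_)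
    have e : (T : ℝ) * ζ ^ 2 = (√T) ^ 2 * ζ ^ 2 := by rw [hVsq]
    rw [e]
    field_simp
  simp only [integral_const, probReal_univ, one_smul]
  linarith

end Model.IsAlgorithmRun

end Expectation

/-! ### Distance between the true occupancy and the algorithm's vectors -/

section Tracking

open Matrix

variable {K m : ℕ} {S A : Fin K → Type*} [∀ k, Fintype (S k)] [∀ k, DecidableEq (S k)]
  [∀ k, Fintype (A k)] {E : Type*} [mE : MeasurableSpace E] {Ω : Type*}
  {M : Model K m S A E} {V α : ℝ} {ω μ : ℕ → Ω → E} {θ : ℕ → Ω → ∀ k, A k → S k → ℝ}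
  {Q : ℕ → Ω → Fin m → ℝ} {d₀ : (∀ k, S k) → ℝ}

/-- The laws of the state-action pairs of the MDPs at slot `t` when the actions are drawn from
`p 0, p 1, …`. -/
noncomputable def Model.occupancy (M : Model K m S A E) (d₀ : (∀ k, S k) → ℝ)
    (p : ℕ → (∀ k, S k) → (∀ k, A k) → ℝ) (t : ℕ) (k : Fin K) : A k → S k → ℝ :=
  occupancyMarginal (fun σ b => M.stateLaw d₀ p t σ * p t σ b) k

lemma Model.Unichain.marginal_pos (hM : M.Unichain) {z : ∀ k, A k → S k → ℝ} (hz : M.Feasible z)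
    (k : Fin K) (s : S k) : 0 < ∑ a, z k a s := by
  obtain ⟨r, -, hr⟩ := hM
  exact stateActionPolyhedron.marginal_pos (M.P_nonneg k) (hr r le_rfl k) (hz k) s

lemma Model.Unichain.isRandomizedPolicy (hM : M.Unichain) {z : ∀ k, A k → S k → ℝ}
    (hz : M.Feasible z) (k : Fin K) : IsRandomizedPolicy (recoveredPolicy (z k)) :=
  recoveredPolicy_isRandomizedPolicy (hz k).1 (hM.marginal_pos hz k)

/-- The true law and `θ t` have the same conditional action probabilities given the state, so their
`ℓ¹` distance is that of the state marginals. -/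
lemma Model.IsAlgorithmRun.totalDist_occupancy (h : M.IsAlgorithmRun V α ω μ θ Q)
    (hM : M.Unichain) (t : ℕ) (x : Ω) :
    totalDist (M.occupancy d₀ (fun t => algorithmPolicy θ t x) t) (θ t x) =
      ∑ k, ∑ y, |stateMarginal (M.stateLaw d₀ (fun t => algorithmPolicy θ t x) t) k y -
        ∑ a, θ t x k a y| := by
  refine Finset.sum_congr rfl fun k _ => ?_
  have hpol := fun k => hM.isRandomizedPolicy (h.feasible t x) k
  rw [Finset.sum_comm]
  refine Finset.sum_congr rfl fun y _ => ?_
  have e : ∀ a, |M.occupancy d₀ (fun t => algorithmPolicy θ t x) t k a y - θ t x k a y| =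
      |stateMarginal (M.stateLaw d₀ (fun t => algorithmPolicy θ t x) t) k y -
        ∑ a, θ t x k a y| * recoveredPolicy (θ t x k) y a := fun a => by
    have h1 := occupancyMarginal_separable hpol
      (M.stateLaw d₀ (fun t => algorithmPolicy θ t x) t) k a y
    have h2 := marginal_mul_recoveredPolicy (hM.marginal_pos (h.feasible t x) k) a y
    simp only [Model.occupancy]
    rw [← abs_of_nonneg ((hpol k y).1 a), ← abs_mul, sub_mul, h2]
    exact congrArg (fun u => |u - θ t x k a y|) h1
  simp only [e]
  rw [← Finset.mul_sum, (hpol k y).2, mul_one]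

/-- The laws of the state-action pairs under the algorithm stay close to its state-action
vectors. -/
lemma Model.IsAlgorithmRun.sum_totalDist_occupancy_le (h : M.IsAlgorithmRun V α ω μ θ Q)
    (hM : M.Unichain) {r : ℕ} {τ : ℝ} (hmix : M.IsMixing r τ) (hd₀ : IsProbVector d₀) (T : ℕ)
    (x : Ω) :
    ∑ t ∈ Finset.range (T + 1),
        totalDist (M.occupancy d₀ (fun t => algorithmPolicy θ t x) t) (θ t x) ≤
      r * (2 * K + ∑ t ∈ Finset.range T, totalDist (θ (t + 1) x) (θ t x)) /
        (1 - Real.exp (-1 / τ)) := by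
  obtain ⟨-, hτ, hmix⟩ := hmix
  have hρ : Real.exp (-1 / τ) < 1 :=
    Real.exp_lt_one_iff.2 (div_neg_of_neg_of_pos (by norm_num) (by linarith))
  have hpol := fun t k => hM.isRandomizedPolicy (h.feasible t x) k
  have hk : ∀ k, ∑ t ∈ Finset.range (T + 1),
      ∑ y, |stateMarginal (M.stateLaw d₀ (fun t => algorithmPolicy θ t x) t) k y -
        ∑ a, θ t x k a y| ≤
      r * (2 + ∑ t ∈ Finset.range T, ∑ y, |∑ a, θ (t + 1) x k a y - ∑ a, θ t x k a y|) /
        (1 - Real.exp (-1 / τ)) := fun k =>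
    -- Given the noise, the marginal law of MDP `k` follows the recovered policies, and the state
    -- marginal of `θ t` is stationary for the policy of slot `t`.
    sum_abs_sub_le_of_mixing
      (v := fun t => stateMarginal (M.stateLaw d₀ (fun t => algorithmPolicy θ t x) t) k)
      (d := fun t y => ∑ a, θ t x k a y)
      (P := fun t => policyMatrix (M.P k) (recoveredPolicy (θ t x k)))
      (Real.exp_pos _).le hρ
      (fun t => policyMatrix_mem_rowStochastic (M.P_mem_rowStochastic k) (hpol t k))
      (hd₀.stateMarginal k)
      (fun t => M.stateMarginal_vecMul_separable (hpol t) _ k)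
      (fun t => stateActionPolyhedron.isProbVector_marginal (h.feasible t x k))
      (fun t => marginal_vecMul_policyMatrix (h.feasible t x k)
        (hM.marginal_pos (h.feasible t x) k))
      (fun t d₁ d₂ h₁ h₂ => hmix k d₁ d₂ h₁ h₂
        (fun j : Fin r => recoveredPolicy (θ (t + j) x k)) fun j => hpol _ k) T
  simp only [h.totalDist_occupancy hM]
  rw [Finset.sum_comm]
  refine (Finset.sum_le_sum fun k _ => hk k).trans ?_
  rw [← Finset.sum_div, ← Finset.mul_sum, Finset.sum_add_distrib, Finset.sum_comm]
  refine div_le_div_of_nonneg_right (mul_le_mul_of_nonneg_left (add_le_add (by simp [mul_comm])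
    (Finset.sum_le_sum fun t _ => Finset.sum_le_sum fun k _ => ?_)) (Nat.cast_nonneg r))
    (by linarith)
  rw [Finset.sum_comm (s := Finset.univ (α := A k))]
  refine Finset.sum_le_sum fun y _ => ?_
  rw [← Finset.sum_sub_distrib]
  exact Finset.abs_sum_le_sum_abs _ _

end Tracking

/-! ### Expected totals of a realization as integrals over the noise -/

section Realization

variable {K m : ℕ} {S A : Fin K → Type*} [∀ k, Fintype (S k)] [∀ k, DecidableEq (S k)]
  [∀ k, Fintype (A k)] {E : Type*} [mE : MeasurableSpace E] {Ω : Type*}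
  {M : Model K m S A E} {ω μ : ℕ → Ω → E} {d₀ : (∀ k, S k) → ℝ}
  {p : ℕ → Ω → (∀ k, S k) → (∀ k, A k) → ℝ}
  {s : ℕ → Ω → ∀ k, S k} {a : ℕ → Ω → ∀ k, A k}

omit [∀ k, DecidableEq (S k)] in
lemma Model.isBddMeasurable_stateLaw {mΩ : MeasurableSpace Ω}
    (hp : ∀ t σ b, IsBddMeasurable mΩ fun x => p t x σ b) (t : ℕ) (σ : ∀ k, S k) :
    IsBddMeasurable mΩ fun x => M.stateLaw d₀ (fun t => p t x) t σ := by
  induction t generalizing σ with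
  | zero => exact .const _ _
  | succ t ih =>
    exact .sum _ fun σ' _ => (ih σ').mul (.sum _ fun b _ => (hp t σ' b).mul (.const _ _))

lemma Model.isBddMeasurable_occupancy {mΩ : MeasurableSpace Ω}
    (hp : ∀ t σ b, IsBddMeasurable mΩ fun x => p t x σ b) (t : ℕ) (k : Fin K) (b : A k) (y : S k) :
    IsBddMeasurable mΩ fun x => M.occupancy d₀ (fun t => p t x) t k b y := by
  classical
  refine .sum _ fun σ _ => .sum _ fun b' _ => ?_
  by_cases hc : b' k = b ∧ σ k = y
  · simp only [hc, and_self, if_true]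
    exact (M.isBddMeasurable_stateLaw hp t σ).mul (hp t σ b')
  · simp only [hc, if_false]
    exact .const _ _

variable [mΩ : MeasurableSpace Ω] {Pr : Measure Ω} [IsProbabilityMeasure Pr]

omit [∀ k, DecidableEq (S k)] [IsProbabilityMeasure Pr] in
lemma Model.IsTrajectory.isBddMeasurable_comp (h : M.IsTrajectory Pr ω μ d₀ p s a) (t : ℕ)
    (k : Fin K) {φ : A k → S k → Ω → ℝ} (hφ : ∀ b y, IsBddMeasurable mΩ (φ b y)) :
    IsBddMeasurable mΩ fun x => φ (a t x k) (s t x k) x := by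
  have hs : Measurable[mΩ, ⊤] (s t) := (measurable_sigmaBefore (Nat.lt_succ_self t)).mono
    (sigmaBefore_le h.measurable_state (t + 1)) le_rfl
  have ha : Measurable[mΩ, ⊤] (a t) := (measurable_sigmaBefore (Nat.lt_succ_self t)).mono
    (sigmaBefore_le h.measurable_action (t + 1)) le_rfl
  exact IsBddMeasurable.comp_discrete hs (F := fun σ x => φ (a t x k) (σ k) x) fun σ =>
    IsBddMeasurable.comp_discrete ha (F := fun b x => φ (b k) (σ k) x) fun b => hφ _ _

/-- Expected value at slot `t` of a sum over the MDPs of functions of action, state and noise. -/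
lemma Model.IsTrajectory.integral_sum_eq (h : M.IsTrajectory Pr ω μ d₀ p s a)
    (henv : IsEnvironment Pr ω μ)
    (hp : ∀ t σ b, IsBddMeasurable (sigmaEnv ω μ) fun x => p t x σ b) (t : ℕ)
    {φ : ∀ k, A k → S k → Ω → ℝ} (hφ : ∀ k b y, IsBddMeasurable (sigmaEnv ω μ) (φ k b y)) :
    ∫ x, ∑ k, φ k (a t x k) (s t x k) x ∂Pr =
      ∫ x, ∑ k, pairing (fun b y => φ k b y x) (M.occupancy d₀ (fun t => p t x) t k) ∂Pr := by
  have hpair : ∀ k, IsBddMeasurable (sigmaEnv ω μ) fun x =>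
      pairing (fun b y => φ k b y x) (M.occupancy d₀ (fun t => p t x) t k) := fun k =>
    .sum _ fun b _ => .sum _ fun y _ => (hφ k b y).mul (M.isBddMeasurable_occupancy hp t k b y)
  rw [integral_finsetSum _ fun k _ => (h.isBddMeasurable_comp t k fun b y =>
      (hφ k b y).mono henv.sigmaEnv_le).integrable Pr,
    integral_finsetSum _ fun k _ => ((hpair k).mono henv.sigmaEnv_le).integrable Pr]
  exact Finset.sum_congr rfl fun k _ =>
    h.integral_eq_integral_pairing hp (M.isBddMeasurable_stateLaw hp) henv t k (hφ k)

lemma Model.IsTrajectory.constraint_eq (h : M.IsTrajectory Pr ω μ d₀ p s a)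
    (henv : IsEnvironment Pr ω μ)
    (hp : ∀ t σ b, IsBddMeasurable (sigmaEnv ω μ) fun x => p t x σ b) (i : Fin m) (b T : ℕ) :
    M.constraint Pr ω s a i b T = ∑ t ∈ Finset.Ico b (b + T),
      ∫ x, M.slotConstraint i (ω t x) (M.occupancy d₀ (fun t => p t x) t) ∂Pr := by
  have hg : ∀ t k b y, IsBddMeasurable (sigmaEnv ω μ) fun x => M.ghat i k b y (ω t x) :=
    fun t k b y => (M.isBddMeasurable_ghat (ω t) i k b y).mono
      (le_sup_of_le_left (le_iSup (fun t => MeasurableSpace.comap (ω t) mE) t))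
  rw [Model.constraint, integral_finsetSum _ fun t _ => (IsBddMeasurable.sum _ fun k _ =>
    h.isBddMeasurable_comp t k (φ := fun b y x => M.ghat i k b y (ω t x))
      fun b y => (hg t k b y).mono henv.sigmaEnv_le).integrable Pr]
  exact Finset.sum_congr rfl fun t _ => h.integral_sum_eq henv hp t (hg t)

lemma Model.IsTrajectory.penalty_eq (h : M.IsTrajectory Pr ω μ d₀ p s a)
    (henv : IsEnvironment Pr ω μ)
    (hp : ∀ t σ b, IsBddMeasurable (sigmaEnv ω μ) fun x => p t x σ b) (b T : ℕ) :
    M.penalty Pr μ s a b T = ∑ t ∈ Finset.Ico b (b + T),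
      ∫ x, M.slotPenalty (μ t x) (M.occupancy d₀ (fun t => p t x) t) ∂Pr := by
  have hf : ∀ t k b y, IsBddMeasurable (sigmaEnv ω μ) fun x => M.fhat k b y (μ t x) :=
    fun t k b y => (M.isBddMeasurable_fhat (μ t) k b y).mono
      (le_sup_of_le_right (le_iSup (fun t => MeasurableSpace.comap (μ t) mE) t))
  rw [Model.penalty, integral_finsetSum _ fun t _ => (IsBddMeasurable.sum _ fun k _ =>
    h.isBddMeasurable_comp t k (φ := fun b y x => M.fhat k b y (μ t x))
      fun b y => (hf t k b y).mono henv.sigmaEnv_le).integrable Pr]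
  exact Finset.sum_congr rfl fun t _ => h.integral_sum_eq henv hp t (hf t)

end Realization

/-! ### Slater's condition as a feasible point, and shifts of the horizon -/

section Comparison

variable {K m : ℕ} {S A : Fin K → Type*} [∀ k, Fintype (S k)] [∀ k, DecidableEq (S k)]
  [∀ k, Fintype (A k)] {E : Type*} [mE : MeasurableSpace E] {Ω : Type*}
  {M : Model K m S A E}

lemma Model.slotConstraint_occupancyMarginal (M : Model K m S A E)
    (o : (∀ k, S k) → (∀ k, A k) → ℝ) (i : Fin m) (e : E) :
    M.slotConstraint i e (occupancyMarginal o) =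
      ∑ s, ∑ a, o s a * ∑ k, M.ghat i k (a k) (s k) e := by
  simp only [Model.slotConstraint, pairing_occupancyMarginal, Finset.mul_sum]
  rw [Finset.sum_comm]
  refine Finset.sum_congr rfl fun s _ => ?_
  rw [Finset.sum_comm]
  simp only [mul_comm]

/-- Slater's condition in terms of state-action vectors. -/
lemma Model.Slater.exists_feasible [mΩ : MeasurableSpace Ω] {Pr : Measure Ω}
    [IsProbabilityMeasure Pr] {ω μ : ℕ → Ω → E} (henv : IsEnvironment Pr ω μ) {η : ℝ}
    (h : M.Slater Pr ω η) :
    ∃ z, M.Feasible z ∧ ∀ t i, ∫ x, M.slotConstraint i (ω t x) z ∂Pr ≤ -η := by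
  obtain ⟨-, π, d, hπ, hd, h⟩ := h
  refine ⟨occupancyMarginal fun s a => d s * separable π s a,
    M.occupancyMarginal_mem (separable_isRandomizedPolicy hπ) hd, fun t i => le_trans (le_of_eq ?_)
      (h t i)⟩
  have hint : ∀ (s : ∀ k, S k) (a : ∀ k, A k), IsBddMeasurable mΩ fun x =>
      d s * separable π s a * ∑ k, M.ghat i k (a k) (s k) (ω t x) := fun s a =>
    .const_mul _ (.sum _ fun k _ => (M.isBddMeasurable_ghat (ω t) i k _ _).mono
      (henv.measurable_ω t).comap_le)
  simp only [Model.slotConstraint_occupancyMarginal]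
  rw [integral_finsetSum _ fun s _ => (IsBddMeasurable.sum _ fun a _ => hint s a).integrable Pr]
  refine Finset.sum_congr rfl fun s _ => ?_
  rw [integral_finsetSum _ fun a _ => (hint s a).integrable Pr]
  simp only [integral_const_mul]

-- Without MDPs every constraint value is an empty sum, hence zero, and cannot be at most `-η`.
omit [∀ k, DecidableEq (S k)] in
lemma Model.Slater.one_le [MeasurableSpace Ω] {Pr : Measure Ω} {ω : ℕ → Ω → E} {η : ℝ}
    (h : M.Slater Pr ω η) (hm : 1 ≤ m) : 1 ≤ K := by
  by_contra hK
  obtain rfl : K = 0 := by omega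
  obtain ⟨hη, π, d, -, -, h⟩ := h
  have := h 0 ⟨0, hm⟩
  simp at this
  linarith

-- A vector of total mass one needs at least one state-action pair, so every MDP contributes at
-- least `1`.
omit [∀ k, DecidableEq (S k)] in
lemma Model.Feasible.le_totalCard {z : ∀ k, A k → S k → ℝ} (hz : M.Feasible z) :
    (K : ℝ) ≤ totalCard S A := by
  have : (K : ℝ) = ∑ _k : Fin K, (1 : ℝ) := by simp
  rw [this]
  refine Finset.sum_le_sum fun k _ => ?_
  have h1 := (hz k).2.1
  have hS : Nonempty (S k) := by
    by_contra hS
    rw [not_nonempty_iff] at hS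
    simp at h1
  have hA : Nonempty (A k) := by
    by_contra hA
    rw [not_nonempty_iff] at hA
    simp at h1
  exact_mod_cast Nat.mul_pos Fintype.card_pos Fintype.card_pos

/-- Counting from slot `1` exchanges the first term for one at the end. This handles both horizon
conventions at a constant cost. -/
lemma sum_Ico_le_sum_range_add {u : ℕ → ℝ} {c : ℝ} (hu : ∀ t, |u t| ≤ c) {b : ℕ} (hb : b ≤ 1)
    (T : ℕ) : ∑ t ∈ Finset.Ico b (b + T), u t ≤ ∑ t ∈ Finset.range T, u t + 2 * c := by
  have hc : 0 ≤ c := (abs_nonneg _).trans (hu 0)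
  interval_cases b
  · simp [hc]
  · have h1 := Finset.sum_range_succ u T
    rw [Finset.range_eq_Ico, Finset.sum_eq_sum_Ico_succ_bot (Nat.succ_pos T)] at h1
    have h2 := abs_le.1 (hu 0)
    have h3 := abs_le.1 (hu T)
    rw [add_comm 1 T, Finset.range_eq_Ico]
    simp only [zero_add, Nat.Ico_zero_eq_range] at h1 ⊢
    linarith

lemma sum_Ico_le_sum_range_succ {u : ℕ → ℝ} (hu : ∀ t, 0 ≤ u t) {b : ℕ} (hb : b ≤ 1) (T : ℕ) :
    ∑ t ∈ Finset.Ico b (b + T), u t ≤ ∑ t ∈ Finset.range (T + 1), u t :=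
  Finset.sum_le_sum_of_subset_of_nonneg (fun t ht => by
    rw [Finset.mem_Ico] at ht
    rw [Finset.mem_range]
    omega) fun t _ _ => hu t

end Comparison

/-! ### Decomposition of constraint violation and regret -/

section Bounds

variable {K m : ℕ} {S A : Fin K → Type*} [∀ k, Fintype (S k)] [∀ k, DecidableEq (S k)]
  [∀ k, Fintype (A k)] {E : Type*} [mE : MeasurableSpace E] {Ω : Type*}
  {M : Model K m S A E} {V α : ℝ} {ω μ : ℕ → Ω → E} {θ : ℕ → Ω → ∀ k, A k → S k → ℝ}
  {Q : ℕ → Ω → Fin m → ℝ} {d₀ : (∀ k, S k) → ℝ}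
  {s : ℕ → Ω → ∀ k, S k} {a : ℕ → Ω → ∀ k, A k}
  [mΩ : MeasurableSpace Ω] {Pr : Measure Ω} [IsProbabilityMeasure Pr]

omit mΩ in
lemma Model.IsAlgorithmRun.isBddMeasurable_algorithmPolicy (h : M.IsAlgorithmRun V α ω μ θ Q)
    (hα : 0 < α) (hM : M.Unichain) (t : ℕ) (σ : ∀ k, S k) (b : ∀ k, A k) :
    IsBddMeasurable (sigmaEnv ω μ) fun x => algorithmPolicy θ t x σ b := by
  change IsBddMeasurable _ fun x => ∏ k, recoveredPolicy (θ t x k) (σ k) (b k)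
  refine .prod _ fun k _ => ⟨?_, 1, fun x => ?_⟩
  · have hθ := fun a => ((h.isBddMeasurable hα t).1 k a (σ k)).mono (sigmaHistory_le_sigmaEnv t)
    exact (hθ _).1.div (IsBddMeasurable.sum _ fun a _ => hθ a).1
  · have hpol := hM.isRandomizedPolicy (h.feasible t x) k (σ k)
    rw [abs_of_nonneg (hpol.1 _), ← hpol.2]
    exact Finset.single_le_sum (fun a _ => hpol.1 a) (Finset.mem_univ _)

/-- Expected tracking error of the algorithm over the horizon. -/
lemma Model.IsAlgorithmRun.sum_integral_totalDist_occupancy_le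
    (h : M.IsAlgorithmRun V α ω μ θ Q) (hα : 0 < α) (hM : M.Unichain) {r : ℕ} {τ : ℝ}
    (hmix : M.IsMixing r τ) (hd₀ : IsProbVector d₀) (henv : IsEnvironment Pr ω μ) (T : ℕ) :
    ∑ t ∈ Finset.range (T + 1),
        ∫ x, totalDist (M.occupancy d₀ (fun t => algorithmPolicy θ t x) t) (θ t x) ∂Pr ≤
      r * (2 * K + ∑ t ∈ Finset.range T, ∫ x, totalDist (θ (t + 1) x) (θ t x) ∂Pr) /
        (1 - Real.exp (-1 / τ)) := by
  have hle := fun t => (sigmaHistory_le_sigmaEnv (ω := ω) (μ := μ) t).trans henv.sigmaEnv_le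
  have hθ := fun t k a s => ((h.isBddMeasurable hα t).1 k a s).mono (hle t)
  have hocc := fun t k b y => (M.isBddMeasurable_occupancy (d₀ := d₀)
    (h.isBddMeasurable_algorithmPolicy hα hM) t k b y).mono henv.sigmaEnv_le
  have h1 : ∀ t, IsBddMeasurable mΩ fun x =>
      totalDist (M.occupancy d₀ (fun t => algorithmPolicy θ t x) t) (θ t x) :=
    fun t => .totalDist (hocc t) (hθ t)
  have h2 : ∀ t, IsBddMeasurable mΩ fun x => totalDist (θ (t + 1) x) (θ t x) :=
    fun t => .totalDist (hθ (t + 1)) (hθ t)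
  have h3 : IsBddMeasurable mΩ fun x => ∑ t ∈ Finset.range T, totalDist (θ (t + 1) x) (θ t x) :=
    .sum _ fun t _ => h2 t
  rw [← integral_finsetSum _ fun t _ => (h1 t).integrable Pr,
    ← integral_finsetSum _ fun t _ => (h2 t).integrable Pr]
  have e : r * (2 * K + ∫ x, ∑ t ∈ Finset.range T, totalDist (θ (t + 1) x) (θ t x) ∂Pr) /
      (1 - Real.exp (-1 / τ)) =
      ∫ x, r / (1 - Real.exp (-1 / τ)) *
        (2 * K + ∑ t ∈ Finset.range T, totalDist (θ (t + 1) x) (θ t x)) ∂Pr := by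
    rw [integral_const_mul, integral_add (integrable_const _) (h3.integrable Pr)]
    simp only [integral_const, probReal_univ, one_smul]
    ring
  rw [e]
  refine integral_mono ((IsBddMeasurable.sum _ fun t _ => h1 t).integrable Pr)
    ((((IsBddMeasurable.const _ (2 * K : ℝ)).add h3).const_mul _).integrable Pr) fun x =>
      (h.sum_totalDist_occupancy_le hM hmix hd₀ T x).trans (le_of_eq ?_)
  ring

/-- Constraint violation of the algorithm in terms of queues, step sizes and tracking errors. -/
lemma Model.IsTrajectory.constraint_le
    (htr : M.IsTrajectory Pr ω μ d₀ (algorithmPolicy θ) s a)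
    (h : M.IsAlgorithmRun V α ω μ θ Q) (hα : 0 < α) (hM : M.Unichain)
    (henv : IsEnvironment Pr ω μ) (T : ℕ) {b : ℕ} (hb : b ≤ 1) (i : Fin m) :
    M.constraint Pr ω s a i b T ≤ ∫ x, Q (T + 1) x i ∂Pr + 2 * (K * M.Ψ) +
      M.Ψ * ∑ t ∈ Finset.range T, ∫ x, totalDist (θ (t + 1) x) (θ t x) ∂Pr +
      M.Ψ * ∑ t ∈ Finset.range (T + 1),
        ∫ x, totalDist (M.occupancy d₀ (fun t => algorithmPolicy θ t x) t) (θ t x) ∂Pr := by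
  have hle := fun t => (sigmaHistory_le_sigmaEnv (ω := ω) (μ := μ) t).trans henv.sigmaEnv_le
  have hθ := fun t k a s => ((h.isBddMeasurable hα t).1 k a s).mono (hle t)
  have hpm := h.isBddMeasurable_algorithmPolicy hα hM
  have hocc := fun t k b y => (M.isBddMeasurable_occupancy (d₀ := d₀) hpm t k b y).mono
    henv.sigmaEnv_le
  have hω := fun t => (henv.measurable_ω t).comap_le
  have hcθ : ∀ t t', IsBddMeasurable mΩ fun x => M.slotConstraint i (ω t x) (θ t' x) :=
    fun t t' => .slotConstraint (hω t) (hθ t') i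
  have hdist : ∀ t, IsBddMeasurable mΩ fun x => totalDist (θ (t + 1) x) (θ t x) :=
    fun t => .totalDist (hθ (t + 1)) (hθ t)
  have hdocc : ∀ t, IsBddMeasurable mΩ fun x =>
      totalDist (M.occupancy d₀ (fun t => algorithmPolicy θ t x) t) (θ t x) :=
    fun t => .totalDist (hocc t) (hθ t)
  rw [htr.constraint_eq henv hpm]
  -- First exchange: the true occupancy at slot `t` is replaced by `θ t`, at the price of the
  -- tracking error.
  have h1 : ∀ t, ∫ x, M.slotConstraint i (ω t x)
      (M.occupancy d₀ (fun t => algorithmPolicy θ t x) t) ∂Pr ≤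
      ∫ x, M.slotConstraint i (ω t x) (θ t x) ∂Pr + M.Ψ *
        ∫ x, totalDist (M.occupancy d₀ (fun t => algorithmPolicy θ t x) t) (θ t x) ∂Pr :=
    fun t => by
      rw [← integral_const_mul, ← integral_add ((hcθ t t).integrable Pr)
        (((hdocc t).const_mul _).integrable Pr)]
      refine integral_mono ((IsBddMeasurable.slotConstraint (hω t) (hocc t) i).integrable Pr)
        (((hcθ t t).add ((hdocc t).const_mul _)).integrable Pr) fun x => ?_
      have := (abs_le.1 (M.abs_slotConstraint_sub_le i (ω t x)
        (M.occupancy d₀ (fun t => algorithmPolicy θ t x) t) (θ t x))).2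
      simp only
      linarith
  have h2 : ∀ t, |∫ x, M.slotConstraint i (ω t x) (θ t x) ∂Pr| ≤ K * M.Ψ := fun t => by
    have := norm_integral_le_of_norm_le_const (μ := Pr) (f := fun x =>
      M.slotConstraint i (ω t x) (θ t x)) (C := K * M.Ψ) (Filter.Eventually.of_forall fun x =>
        (h.feasible t x).abs_slotConstraint_le i (ω t x))
    simpa using this
  -- Second exchange: the queue update pairs `ω t` with `θ (t + 1)`, so `θ t` is replaced by it at
  -- the price of one step of movement.
  have h3 : ∀ t, ∫ x, M.slotConstraint i (ω t x) (θ t x) ∂Pr ≤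
      ∫ x, M.slotConstraint i (ω t x) (θ (t + 1) x) ∂Pr +
        M.Ψ * ∫ x, totalDist (θ (t + 1) x) (θ t x) ∂Pr := fun t => by
    rw [← integral_const_mul, ← integral_add ((hcθ t (t + 1)).integrable Pr)
      (((hdist t).const_mul _).integrable Pr)]
    refine integral_mono ((hcθ t t).integrable Pr)
      (((hcθ t (t + 1)).add ((hdist t).const_mul _)).integrable Pr) fun x => ?_
    have := (abs_le.1 (M.abs_slotConstraint_sub_le i (ω t x) (θ (t + 1) x) (θ t x))).1
    simp only
    linarith
  have h4 : ∑ t ∈ Finset.range T, ∫ x, M.slotConstraint i (ω t x) (θ (t + 1) x) ∂Pr ≤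
      ∫ x, Q (T + 1) x i ∂Pr := by
    rw [← integral_finsetSum _ fun t _ => (hcθ t (t + 1)).integrable Pr]
    exact integral_mono ((IsBddMeasurable.sum _ fun t _ => hcθ t (t + 1)).integrable Pr)
      ((((h.isBddMeasurable hα T).2 i).mono (hle T)).integrable Pr)
      fun x => h.sum_slotConstraint_le_queue T x i
  have h5 := Finset.sum_le_sum fun t (_ : t ∈ Finset.Ico b (b + T)) => h1 t
  have h6 := Finset.sum_le_sum fun t (_ : t ∈ Finset.range T) => h3 t
  rw [Finset.sum_add_distrib, ← Finset.mul_sum] at h5 h6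
  have h7 := sum_Ico_le_sum_range_add h2 hb T
  have h8 := mul_le_mul_of_nonneg_left (sum_Ico_le_sum_range_succ (u := fun t =>
    ∫ x, totalDist (M.occupancy d₀ (fun t => algorithmPolicy θ t x) t) (θ t x) ∂Pr)
    (fun t => integral_nonneg fun x => totalDist_nonneg _ _) hb T) M.Ψ_pos.le
  linarith

/-- Regret of the algorithm in terms of the regret of its state-action vectors and the tracking
errors. -/
lemma Model.IsTrajectory.penalty_sub_le
    (htr : M.IsTrajectory Pr ω μ d₀ (algorithmPolicy θ) s a)
    (h : M.IsAlgorithmRun V α ω μ θ Q) (hα : 0 < α) (hM : M.Unichain)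
    (henv : IsEnvironment Pr ω μ) (T : ℕ) {b : ℕ} (hb : b ≤ 1) {z : ∀ k, A k → S k → ℝ}
    (hz : M.Feasible z) :
    M.penalty Pr μ s a b T -
        ∑ t ∈ Finset.Ico b (b + T), ∫ x, M.slotPenalty (μ t x) z ∂Pr ≤
      ∑ t ∈ Finset.range T,
        ∫ x, (M.slotPenalty (μ t x) (θ t x) - M.slotPenalty (μ t x) z) ∂Pr +
      4 * (K * M.Ψ) + M.Ψ * ∑ t ∈ Finset.range (T + 1),
        ∫ x, totalDist (M.occupancy d₀ (fun t => algorithmPolicy θ t x) t) (θ t x) ∂Pr := by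
  have hle := fun t => (sigmaHistory_le_sigmaEnv (ω := ω) (μ := μ) t).trans henv.sigmaEnv_le
  have hθ := fun t k a s => ((h.isBddMeasurable hα t).1 k a s).mono (hle t)
  have hpm := h.isBddMeasurable_algorithmPolicy hα hM
  have hocc := fun t k b y => (M.isBddMeasurable_occupancy (d₀ := d₀) hpm t k b y).mono
    henv.sigmaEnv_le
  have hμ := fun t => (henv.measurable_μ t).comap_le
  have hpθ : ∀ t, IsBddMeasurable mΩ fun x => M.slotPenalty (μ t x) (θ t x) :=
    fun t => .slotPenalty (hμ t) (hθ t)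
  have hpz : ∀ t, IsBddMeasurable mΩ fun x => M.slotPenalty (μ t x) z :=
    fun t => .slotPenalty (X := μ t) (z := fun _ => z) (hμ t) (fun _ _ _ => .const _ _)
  have hpo : ∀ t, IsBddMeasurable mΩ fun x => M.slotPenalty (μ t x)
      (M.occupancy d₀ (fun t => algorithmPolicy θ t x) t) := fun t => .slotPenalty (hμ t) (hocc t)
  have hdocc : ∀ t, IsBddMeasurable mΩ fun x =>
      totalDist (M.occupancy d₀ (fun t => algorithmPolicy θ t x) t) (θ t x) :=
    fun t => .totalDist (hocc t) (hθ t)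
  rw [htr.penalty_eq henv hpm, ← Finset.sum_sub_distrib]
  -- Only the tracking error is paid here, since the regret estimate already concerns `θ t`.
  have h1 : ∀ t, ∫ x, M.slotPenalty (μ t x)
      (M.occupancy d₀ (fun t => algorithmPolicy θ t x) t) ∂Pr - ∫ x, M.slotPenalty (μ t x) z ∂Pr ≤
      ∫ x, (M.slotPenalty (μ t x) (θ t x) - M.slotPenalty (μ t x) z) ∂Pr + M.Ψ *
        ∫ x, totalDist (M.occupancy d₀ (fun t => algorithmPolicy θ t x) t) (θ t x) ∂Pr :=
    fun t => by
      rw [← integral_const_mul, ← integral_sub ((hpo t).integrable Pr) ((hpz t).integrable Pr),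
        ← integral_add (((hpθ t).sub (hpz t)).integrable Pr)
        (((hdocc t).const_mul _).integrable Pr)]
      refine integral_mono (((hpo t).sub (hpz t)).integrable Pr)
        ((((hpθ t).sub (hpz t)).add ((hdocc t).const_mul _)).integrable Pr) fun x => ?_
      have := (abs_le.1 (M.abs_slotPenalty_sub_le (μ t x)
        (M.occupancy d₀ (fun t => algorithmPolicy θ t x) t) (θ t x))).2
      simp only
      linarith
  have h2 : ∀ t, |∫ x, (M.slotPenalty (μ t x) (θ t x) - M.slotPenalty (μ t x) z) ∂Pr| ≤
      2 * (K * M.Ψ) := fun t => by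
    have := norm_integral_le_of_norm_le_const (μ := Pr) (f := fun x =>
      M.slotPenalty (μ t x) (θ t x) - M.slotPenalty (μ t x) z) (C := 2 * (K * M.Ψ))
      (Filter.Eventually.of_forall fun x => by
        have h1 := (h.feasible t x).abs_slotPenalty_le (μ t x)
        have h2 := hz.abs_slotPenalty_le (μ t x)
        exact (abs_sub _ _).trans (by linarith))
    simpa using this
  have h5 := Finset.sum_le_sum fun t (_ : t ∈ Finset.Ico b (b + T)) => h1 t
  rw [Finset.sum_add_distrib, ← Finset.mul_sum] at h5
  have h7 := sum_Ico_le_sum_range_add h2 hb T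
  have h8 := mul_le_mul_of_nonneg_left (sum_Ico_le_sum_range_succ (u := fun t =>
    ∫ x, totalDist (M.occupancy d₀ (fun t => algorithmPolicy θ t x) t) (θ t x) ∂Pr)
    (fun t => integral_nonneg fun x => totalDist_nonneg _ _) hb T) M.Ψ_pos.le
  linarith

end Bounds

/-! ### The benchmark policy as a feasible point -/

section Benchmark

variable {K m : ℕ} {S A : Fin K → Type*} [∀ k, Fintype (S k)] [∀ k, DecidableEq (S k)]
  [∀ k, Fintype (A k)] {E : Type*} [mE : MeasurableSpace E] {M : Model K m S A E}

omit [∀ k, DecidableEq (S k)] in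
lemma Model.measurable_slotConstraint (M : Model K m S A E) (i : Fin m)
    (z : ∀ k, A k → S k → ℝ) : Measurable fun e => M.slotConstraint i e z :=
  Finset.measurable_fun_sum _ fun k _ => Finset.measurable_fun_sum _ fun a _ =>
    Finset.measurable_fun_sum _ fun s _ => (M.ghat_measurable i k a s).mul_const _

omit [∀ k, DecidableEq (S k)] in
lemma Model.measurable_slotPenalty (M : Model K m S A E)
    (z : ∀ k, A k → S k → ℝ) : Measurable fun e => M.slotPenalty e z :=
  Finset.measurable_fun_sum _ fun k _ => Finset.measurable_fun_sum _ fun a _ =>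
    Finset.measurable_fun_sum _ fun s _ => (M.fhat_measurable k a s).mul_const _

omit [∀ k, DecidableEq (S k)] in
lemma IsEnvironment.integral_slotConstraint_eq {Ω : Type*} [MeasurableSpace Ω] {Pr : Measure Ω}
    {ω μ : ℕ → Ω → E} (henv : IsEnvironment Pr ω μ) (i : Fin m) (z : ∀ k, A k → S k → ℝ) (t : ℕ) :
    ∫ x, M.slotConstraint i (ω t x) z ∂Pr = ∫ x, M.slotConstraint i (ω 0 x) z ∂Pr :=
  ((henv.ident_ω t).comp (M.measurable_slotConstraint i z)).integral_eq

variable {Ω Ω' : Type*} [MeasurableSpace Ω] {Pr : Measure Ω} {ω μ : ℕ → Ω → E}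
  [MeasurableSpace Ω'] {Pr' : Measure Ω'} [IsProbabilityMeasure Pr'] {ω' μ' : ℕ → Ω' → E}

/-- The stationary state-action vectors of a benchmark policy: they satisfy the constraints on
average and realize its penalty. -/
lemma Model.IsTrajectory.exists_feasible_of_isStationary
    (henv : IsEnvironment Pr ω μ) (henv' : IsEnvironment Pr' ω' μ')
    (hid : IdentDistrib (fun x => (fun t => ω t x, fun t => μ t x))
      (fun x => (fun t => ω' t x, fun t => μ' t x)) Pr Pr')
    {pol : (∀ k, S k) → (∀ k, A k) → ℝ} {d : (∀ k, S k) → ℝ}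
    (hpol : IsRandomizedPolicy pol) (hd : IsStationary (policyMatrix M.jointP pol) d)
    {s' : ℕ → Ω' → ∀ k, S k} {a' : ℕ → Ω' → ∀ k, A k}
    (htr : M.IsTrajectory Pr' ω' μ' d (fun _ _ => pol) s' a') {b T : ℕ} (hT : 1 ≤ T)
    (hcon : ∀ i, M.constraint Pr' ω' s' a' i b T ≤ 0) :
    ∃ z, M.Feasible z ∧ (∀ t i, ∫ x, M.slotConstraint i (ω t x) z ∂Pr ≤ 0) ∧
      M.penalty Pr' μ' s' a' b T =
        ∑ t ∈ Finset.Ico b (b + T), ∫ x, M.slotPenalty (μ t x) z ∂Pr := by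
  have hp : ∀ (t : ℕ) σ b, IsBddMeasurable (sigmaEnv ω' μ') fun _ => pol σ b :=
    fun _ _ _ => .const _ _
  have hocc : ∀ t, M.occupancy d (fun _ => pol) t = occupancyMarginal fun σ b => d σ * pol σ b :=
    fun t => by
      funext k
      rw [Model.occupancy, M.stateLaw_eq_of_isStationary hd]
  set z : ∀ k, A k → S k → ℝ := occupancyMarginal fun σ b => d σ * pol σ b
  have hω : ∀ i, ∫ x, M.slotConstraint i (ω 0 x) z ∂Pr =
      ∫ x, M.slotConstraint i (ω' 0 x) z ∂Pr' := fun i =>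
    (hid.comp (u := fun q : (ℕ → E) × (ℕ → E) => M.slotConstraint i (q.1 0) z)
      ((M.measurable_slotConstraint i z).comp
        ((measurable_pi_apply 0).comp measurable_fst))).integral_eq
  have hμ : ∀ t, ∫ x, M.slotPenalty (μ t x) z ∂Pr = ∫ x, M.slotPenalty (μ' t x) z ∂Pr' := fun t =>
    (hid.comp (u := fun q : (ℕ → E) × (ℕ → E) => M.slotPenalty (q.2 t) z)
      ((M.measurable_slotPenalty z).comp
        ((measurable_pi_apply t).comp measurable_snd))).integral_eq
  refine ⟨z, M.occupancyMarginal_mem hpol hd, fun t i => ?_, ?_⟩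
  -- Stationarity and identical distribution of `ω` make all slots contribute the same expected
  -- value, so a nonpositive total over `T ≥ 1` slots makes each slot nonpositive.
  · rw [henv.integral_slotConstraint_eq, hω]
    have h1 := hcon i
    rw [htr.constraint_eq henv' hp] at h1
    simp only [hocc, henv'.integral_slotConstraint_eq] at h1
    simp only [Finset.sum_const, Nat.card_Ico, add_tsub_cancel_left, nsmul_eq_mul] at h1
    exact nonpos_of_mul_nonpos_right h1 (by exact_mod_cast hT)
  · rw [htr.penalty_eq henv' hp]
    simp only [hocc, hμ]

end Benchmark

/-! ### Arithmetic of the constants, with `R = √T`, `V = R` and `α = R²` -/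

section Constants

/-- Factor in the bound of the total movement of the state-action vectors. -/
noncomputable def movementConst (Ψ η : ℝ) : ℝ := Ψ / 2 * (1 + (4 + 4 * Ψ + Ψ ^ 2) / (2 * η))

/-- The constant of the regret and constraint violation bounds. -/
noncomputable def regretConst (Ψ η : ℝ) (r : ℕ) (τ : ℝ) : ℝ :=
  4 * Ψ + ((4 * Ψ + Ψ ^ 2) / (2 * η) + 2 + 5 * Ψ) + Ψ * movementConst Ψ η +
    (2 + Ψ ^ 2 / 2 + Ψ ^ 2 / 4) +
    Ψ * (r * (2 + movementConst Ψ η) / (1 - Real.exp (-1 / τ)))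

variable {K m N R Ψ η : ℝ}

/-- All error terms are monomials dominated by `m K² N R`, where `N` stands for the total number of
state-action pairs. -/
lemma scale_bounds (hK : 1 ≤ K) (hm : 1 ≤ m) (hKN : K ≤ N) (hR : 1 ≤ R) :
    m * K ^ 2 * R ≤ m * K ^ 2 * N * R ∧ K * R ≤ m * K ^ 2 * R ∧ N * R * m ≤ m * K ^ 2 * N * R := by
  have hK2 : K ≤ K ^ 2 := by nlinarith
  have hmK : K ^ 2 ≤ m * K ^ 2 := le_mul_of_one_le_left (by positivity) hm
  refine ⟨?_, ?_, ?_⟩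
  · exact mul_le_mul_of_nonneg_right (le_mul_of_one_le_right (by positivity) (by linarith))
      (by linarith)
  · exact mul_le_mul_of_nonneg_right (hK2.trans hmK) (by linarith)
  · have : N * R * m * 1 ≤ N * R * m * K ^ 2 :=
      mul_le_mul_of_nonneg_left (by nlinarith)
        (mul_nonneg (mul_nonneg (by linarith) (by linarith)) (by linarith))
    linarith

/-- Here `q` is the sum of the expected queues over the horizon, of order `R³`, and `D` the expected
total movement: its linear term is also of order `R³`, and division by `α = R²` leaves order `R`. -/
lemma movement_le (hK : 1 ≤ K) (hm : 1 ≤ m) (hKN : K ≤ N) (hR : 1 ≤ R) (hΨ : 0 < Ψ) (hη : 0 < η)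
    {q D : ℝ} (hq : 2 * η * q ≤ 4 * K * R ^ 2 + R ^ 2 * (4 * R * (K * Ψ) + m * (K * Ψ) ^ 2))
    (hD : 2 * R ^ 2 * D ≤ N * (Ψ * (R ^ 2 * R + q))) :
    D ≤ movementConst Ψ η * (m * K ^ 2 * N * R) := by
  obtain ⟨-, h2, -⟩ := scale_bounds hK hm hKN hR
  have hR2 : 0 < R ^ 2 := by positivity
  have hKR : K ≤ K * R := le_mul_of_one_le_right (by linarith) hR
  have hmKR : m * K ^ 2 ≤ m * K ^ 2 * R := le_mul_of_one_le_right (by positivity) hR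
  have hRK : R ≤ K * R := le_mul_of_one_le_left (by linarith) hK
  set W := m * K ^ 2 * R with hW
  have h3 : 4 * K + (4 * R * (K * Ψ) + m * (K * Ψ) ^ 2) ≤ (4 + 4 * Ψ + Ψ ^ 2) * W := by
    have e1 : 4 * R * (K * Ψ) ≤ 4 * Ψ * W := by
      have := mul_le_mul_of_nonneg_left h2 (by positivity : 0 ≤ 4 * Ψ)
      linarith
    have e2 : m * (K * Ψ) ^ 2 ≤ Ψ ^ 2 * W := by
      have := mul_le_mul_of_nonneg_left hmKR (by positivity : 0 ≤ Ψ ^ 2)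
      linarith
    linarith
  have h4 : q ≤ R ^ 2 * ((4 + 4 * Ψ + Ψ ^ 2) / (2 * η) * W) := by
    have h5 := mul_le_mul_of_nonneg_left h3 hR2.le
    have h6 : 2 * η * (R ^ 2 * ((4 + 4 * Ψ + Ψ ^ 2) / (2 * η) * W)) =
        R ^ 2 * ((4 + 4 * Ψ + Ψ ^ 2) * W) := by field_simp
    refine le_of_mul_le_mul_left ?_ (by positivity : 0 < 2 * η)
    linarith
  have h7 : R ^ 2 * R + q ≤ R ^ 2 * ((1 + (4 + 4 * Ψ + Ψ ^ 2) / (2 * η)) * W) := by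
    have := mul_le_mul_of_nonneg_left (hRK.trans h2) hR2.le
    linarith
  have h8 := mul_le_mul_of_nonneg_left (mul_le_mul_of_nonneg_left h7 hΨ.le)
    (by linarith : 0 ≤ N)
  refine le_of_mul_le_mul_left ?_ (by positivity : 0 < 2 * R ^ 2)
  refine hD.trans (h8.trans (le_of_eq ?_))
  rw [movementConst, hW]
  ring

lemma queue_bound_le (hK : 1 ≤ K) (hm : 1 ≤ m) (hKN : K ≤ N) (hR : 1 ≤ R) (hΨ : 0 < Ψ)
    (hη : 0 < η) :
    R * ((4 * (K * Ψ) + m * (K * Ψ) ^ 2) / (2 * η) + 2 * K) +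
        (m * (K * Ψ) + 2 * N * Ψ * (1 + m)) * R ≤
      ((4 * Ψ + Ψ ^ 2) / (2 * η) + 2 + 5 * Ψ) * (m * K ^ 2 * N * R) := by
  obtain ⟨h1, h2, h3⟩ := scale_bounds hK hm hKN hR
  have h12 := h2.trans h1
  set U := m * K ^ 2 * N * R
  have a1 : R * ((4 * (K * Ψ) + m * (K * Ψ) ^ 2) / (2 * η)) ≤ (4 * Ψ + Ψ ^ 2) / (2 * η) * U := by
    have : R * (4 * (K * Ψ) + m * (K * Ψ) ^ 2) ≤ (4 * Ψ + Ψ ^ 2) * U := by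
      have e1 := mul_le_mul_of_nonneg_left h12 (by positivity : 0 ≤ 4 * Ψ)
      have e2 := mul_le_mul_of_nonneg_left h1 (by positivity : 0 ≤ Ψ ^ 2)
      linarith
    rw [← mul_div_assoc, div_mul_eq_mul_div]
    exact div_le_div_of_nonneg_right this (by positivity)
  have a2 : m * (K * Ψ) * R ≤ Ψ * U := by
    have e0 : K * (R * m) ≤ N * (R * m) :=
      mul_le_mul_of_nonneg_right hKN (mul_nonneg (by linarith) (by linarith))
    have := mul_le_mul_of_nonneg_left (show K * (R * m) ≤ U by linarith) hΨ.le
    linarith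
  have a3 : 2 * N * Ψ * (1 + m) * R ≤ 4 * Ψ * U := by
    have e1 := mul_le_mul_of_nonneg_left h3 (by positivity : 0 ≤ 4 * Ψ)
    have e2 : N * R * Ψ * 1 ≤ N * R * Ψ * m :=
      mul_le_mul_of_nonneg_left hm (mul_nonneg (mul_nonneg (by linarith) (by linarith)) hΨ.le)
    linarith
  linarith

lemma regret_bound_le (hK : 1 ≤ K) (hm : 1 ≤ m) (hKN : K ≤ N) (hR : 1 ≤ R) {D : ℝ}
    (hD : 2 * R * D ≤ 4 * K * R ^ 2 +
      R ^ 2 * (m * (K * Ψ) ^ 2 + R ^ 2 * Ψ ^ 2 * N / (2 * R ^ 2))) :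
    D ≤ (2 + Ψ ^ 2 / 2 + Ψ ^ 2 / 4) * (m * K ^ 2 * N * R) := by
  obtain ⟨h1, h2, h3⟩ := scale_bounds hK hm hKN hR
  have h12 := h2.trans h1
  have hR0 : 0 < R := by linarith
  have e : R ^ 2 * Ψ ^ 2 * N / (2 * R ^ 2) = Ψ ^ 2 * N / 2 := by field_simp
  rw [e] at hD
  have h4 : D ≤ 2 * (K * R) + Ψ ^ 2 / 2 * (m * K ^ 2 * R) + Ψ ^ 2 / 4 * (N * R) := by
    refine le_of_mul_le_mul_left ?_ (by positivity : 0 < 2 * R)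
    linarith
  have hNR : N * R ≤ N * R * m := le_mul_of_one_le_right (mul_nonneg (by linarith) hR0.le) hm
  have e1 := mul_le_mul_of_nonneg_left h1 (by positivity : 0 ≤ Ψ ^ 2 / 2)
  have e2 := mul_le_mul_of_nonneg_left (hNR.trans h3) (by positivity : 0 ≤ Ψ ^ 2 / 4)
  linarith

end Constants

end OCMDP

theorem mainTheorem2 :
    -- the constant depends only on the bound `Ψ`, the Slater margin `η` and the mixing
    -- parameters `r`, `τ`
    ∃ C : ℝ → ℝ → ℕ → ℝ → ℝ,
    ∀ (K m : ℕ), 1 ≤ m →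
    ∀ (S A : Fin K → Type*) [∀ k, Fintype (S k)] [∀ k, DecidableEq (S k)] [∀ k, Fintype (A k)]
      (E : Type*) [MeasurableSpace E] (M : OCMDP.Model K m S A E), M.Unichain →
    -- mixing parameters exist, and the bounds hold for any choice of them
    (∃ (r : ℕ) (τ : ℝ), M.IsMixing r τ) ∧
    ∀ (r : ℕ) (τ : ℝ), M.IsMixing r τ →
    ∀ (Ω : Type*) [MeasurableSpace Ω] (Pr : Measure Ω) [IsProbabilityMeasure Pr]
      (ω μ : ℕ → Ω → E), OCMDP.IsEnvironment Pr ω μ →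
    ∀ η : ℝ, M.Slater Pr ω η →
    -- the algorithm with `V = √T`, `α = T`, started from an arbitrary distribution `d₀`
    ∀ T : ℕ, 1 ≤ T →
    ∀ (θ : ℕ → Ω → ∀ k, A k → S k → ℝ) (Q : ℕ → Ω → Fin m → ℝ),
      M.IsAlgorithmRun (Real.sqrt T) T ω μ θ Q →
    ∀ (d₀ : (∀ k, S k) → ℝ), OCMDP.IsProbVector d₀ →
    ∀ (s : ℕ → Ω → ∀ k, S k) (a : ℕ → Ω → ∀ k, A k),
      M.IsTrajectory Pr ω μ d₀ (OCMDP.algorithmPolicy θ) s a →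
    -- the horizon consists of `T` slots, counted from slot `0` or from slot `1`
    ∀ b : ℕ, b ≤ 1 →
      (∀ i, M.constraint Pr ω s a i b T ≤
        C M.Ψ η r τ * ((m : ℝ) ^ (3 / 2 : ℝ) * (K : ℝ) ^ 2 *
          (∑ k, (Fintype.card (A k) : ℝ) * Fintype.card (S k)) * Real.sqrt T)) ∧
      -- the benchmark: a joint randomized stationary policy `pol` in its stationary distribution
      -- `d`, realized on any probability space with noise of the same law
      ∀ (Ω' : Type*) [MeasurableSpace Ω'] (Pr' : Measure Ω') [IsProbabilityMeasure Pr']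
        (ω' μ' : ℕ → Ω' → E), OCMDP.IsEnvironment Pr' ω' μ' →
        IdentDistrib (fun x => (fun t => ω t x, fun t => μ t x))
          (fun x => (fun t => ω' t x, fun t => μ' t x)) Pr Pr' →
      ∀ (pol : (∀ k, S k) → (∀ k, A k) → ℝ) (d : (∀ k, S k) → ℝ),
        OCMDP.IsRandomizedPolicy pol → OCMDP.IsStationary (OCMDP.policyMatrix M.jointP pol) d →
      ∀ (s' : ℕ → Ω' → ∀ k, S k) (a' : ℕ → Ω' → ∀ k, A k),
        M.IsTrajectory Pr' ω' μ' d (fun _ _ => pol) s' a' →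
        (∀ i, M.constraint Pr' ω' s' a' i b T ≤ 0) →
        M.penalty Pr μ s a b T - M.penalty Pr' μ' s' a' b T ≤
          C M.Ψ η r τ * ((m : ℝ) ^ (3 / 2 : ℝ) * (K : ℝ) ^ 2 *
            (∑ k, (Fintype.card (A k) : ℝ) * Fintype.card (S k)) * Real.sqrt T) := by
  refine ⟨OCMDP.regretConst, ?_⟩
  intro K m hm S A _ _ _ E _ M hM
  refine ⟨hM.exists_isMixing, ?_⟩
  intro r τ hmix Ω _ Pr _ ω μ henv η hSl T hT θ Q hrun d₀ hd₀ s a htr b hb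
  obtain ⟨zS, hzS, hzη⟩ := hSl.exists_feasible henv
  have hη : 0 < η := hSl.1
  have hΨ := M.Ψ_pos
  have hK := hSl.one_le hm
  have hK1 : (1 : ℝ) ≤ K := by exact_mod_cast hK
  have hm1 : (1 : ℝ) ≤ m := by exact_mod_cast hm
  have hT1 : (1 : ℝ) ≤ T := by exact_mod_cast hT
  have hT0 : (0 : ℝ) < T := by linarith
  have hR1 : 1 ≤ √(T : ℝ) := Real.one_le_sqrt.2 hT1
  have hR0 : 0 ≤ √(T : ℝ) := by linarith
  have hRsq : √(T : ℝ) ^ 2 = T := Real.sq_sqrt hT0.le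
  have hKN : (K : ℝ) ≤ OCMDP.totalCard S A := hzS.le_totalCard
  have hρ : 0 < 1 - Real.exp (-1 / τ) := sub_pos.2
    (Real.exp_lt_one_iff.2 (div_neg_of_neg_of_pos (by norm_num) (by linarith [hmix.2.1])))
  have hKU : (K : ℝ) ≤ m * (K : ℝ) ^ 2 * OCMDP.totalCard S A * √T := by
    obtain ⟨h1, h2, -⟩ := OCMDP.scale_bounds hK1 hm1 hKN hR1
    exact (le_mul_of_one_le_right (by linarith) hR1).trans (h2.trans h1)
  have hmove := hrun.sum_integral_totalDist_le hT0 hR0 henv T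
  have hq := hrun.sum_integral_queue_le hT0 hR0 hzS henv hzη T
  have htrack := hrun.sum_integral_totalDist_occupancy_le hT0 hM hmix hd₀ henv T
  have hqueue := fun i => (hrun.integral_queue_le hT hK hm hzS henv hη hzη i).trans
    (OCMDP.queue_bound_le hK1 hm1 hKN hR1 hΨ hη)
  have hc1 : 0 ≤ OCMDP.movementConst M.Ψ η := by
    rw [OCMDP.movementConst]; positivity
  have hmove' := OCMDP.movement_le hK1 hm1 hKN hR1 hΨ hη
    (by rw [hRsq]; exact hq) (by rw [hRsq]; exact hmove)
  set D₁ := ∑ t ∈ Finset.range T, ∫ x, OCMDP.totalDist (θ (t + 1) x) (θ t x) ∂Pr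
  set D₂ := ∑ t ∈ Finset.range (T + 1), ∫ x, OCMDP.totalDist
    (M.occupancy d₀ (fun t => OCMDP.algorithmPolicy θ t x) t) (θ t x) ∂Pr
  set U := m * (K : ℝ) ^ 2 * OCMDP.totalCard S A * √T with hU
  have hU0 : 0 ≤ U := by linarith
  have htrack' : D₂ ≤ r * (2 + OCMDP.movementConst M.Ψ η) / (1 - Real.exp (-1 / τ)) * U := by
    refine htrack.trans ?_
    rw [div_mul_eq_mul_div, mul_assoc]
    exact div_le_div_of_nonneg_right (mul_le_mul_of_nonneg_left (by linarith)
      (Nat.cast_nonneg r)) hρ.le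
  have hC0 : 0 ≤ M.Ψ * (r * (2 + OCMDP.movementConst M.Ψ η) / (1 - Real.exp (-1 / τ))) :=
    mul_nonneg hΨ.le (div_nonneg (by positivity) hρ.le)
  have hq0 : 0 ≤ (4 * M.Ψ + M.Ψ ^ 2) / (2 * η) := by positivity
  -- The argument gives a factor `m`, which is weakened to `m^{3/2}` only here.
  have hUR : OCMDP.regretConst M.Ψ η r τ * U ≤ OCMDP.regretConst M.Ψ η r τ *
      ((m : ℝ) ^ (3 / 2 : ℝ) * (K : ℝ) ^ 2 *
        (∑ k, (Fintype.card (A k) : ℝ) * Fintype.card (S k)) * √T) := by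
    refine mul_le_mul_of_nonneg_left ?_ (by rw [OCMDP.regretConst]; positivity)
    have hmm : (m : ℝ) ≤ (m : ℝ) ^ (3 / 2 : ℝ) := by
      simpa using Real.rpow_le_rpow_of_exponent_le hm1 (by norm_num : (1 : ℝ) ≤ 3 / 2)
    have hN0 : 0 ≤ OCMDP.totalCard S A := by linarith
    exact mul_le_mul_of_nonneg_right (mul_le_mul_of_nonneg_right
      (mul_le_mul_of_nonneg_right hmm (by positivity)) hN0) hR0
  have hΨU : K * M.Ψ ≤ M.Ψ * U := by
    rw [mul_comm]; exact mul_le_mul_of_nonneg_left hKU hΨ.le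
  have hΨ1 := mul_le_mul_of_nonneg_left hmove' hΨ.le
  have hΨ2 := mul_le_mul_of_nonneg_left htrack' hΨ.le
  have hp1 : 0 ≤ M.Ψ * U := mul_nonneg hΨ.le hU0
  have hp2 : 0 ≤ M.Ψ ^ 2 * U := mul_nonneg (sq_nonneg _) hU0
  have hp3 : 0 ≤ (4 * M.Ψ + M.Ψ ^ 2) / (2 * η) * U := mul_nonneg hq0 hU0
  have hp4 : 0 ≤ M.Ψ * (OCMDP.movementConst M.Ψ η * U) :=
    mul_nonneg hΨ.le (mul_nonneg hc1 hU0)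
  refine ⟨fun i => le_trans ?_ hUR, ?_⟩
  · have h1 := htr.constraint_le hrun hT0 hM henv T hb i
    have h2 := hqueue i
    rw [OCMDP.regretConst]
    linarith
  · intro Ω' _ Pr' _ ω' μ' henv' hid pol d hpol hd s' a' htr' hcon
    obtain ⟨z, hz, hz0, hpen⟩ := OCMDP.Model.IsTrajectory.exists_feasible_of_isStationary
      henv henv' hid hpol hd htr' hT hcon
    have h1 := htr.penalty_sub_le hrun hT0 hM henv T hb hz
    have h2 := OCMDP.regret_bound_le (Ψ := M.Ψ) hK1 hm1 hKN hR1
      (by rw [hRsq]; simpa only [hRsq] using hrun.sum_integral_regret_le hT0 hR0 hz henv hz0 T)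
    rw [hpen]
    refine le_trans ?_ hUR
    rw [OCMDP.regretConst]
    linarith
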